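/- **Lemma (Collapsing).** A robust MDP (RMDP) $\mathcal M=(S,A,\mathcal P,r)$ has finite sets $S$ of states and $A$ of actions, rewards $r:S\times A\to\mathbb N$, and for each $(s,a)$ an uncertainty set $\mathcal P(s,a)$ of probability distributions on $S$; action $a$ is available in $s$, $a\in A(s)$, if $\mathcal P(s,a)\neq\emptyset$, and $A(s)\ne\emptyset$ for all $s$. It is *closed constant-support* if every $\mathcal P(s,a)$ is closed and all its elements have the same support. Agent policies $\pi$ map histories to distributions on available actions, environment policies $\tau$ map a history ending in $(s,a)$ to an element of $\mathcal P(s,a)$; $V^{\pi,\tau}(s)\in[0,\infty]$ is the expected total reward from $s$, and $V^{\max}_{\mathcal M}=\sup_\pi\inf_\tau V^{\pi,\tau}$, $V^{\min}_{\mathcal M}=\inf_\pi\sup_\tau V^{\pi,\tau}$. An *end component* is a pair $(T,R)$ of a nonempty set $T\subseteq S$ and a nonempty set $R$ of available state-action pairs with states in $T$, such that every $(s,a)\in R$ has a distribution in $\mathcal P(s,a)$ supported in $T$, and any two states of $T$ are connected by a path in $T$ that uses only pairs of $R$. It is *zero-reward* if $r=0$ on $R$; a *zero-reward MEC* is an inclusion-maximal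 zero-reward end component. $\mathcal M'=\mathsf{COLLAPSE}(\mathcal M)$ is obtained by replacing every zero-reward MEC $E=(T,R)$ by one state $s_E$ whose actions are copies $\alpha_{s,a}$ of all available pairs $(s,a)\notin R$ with $s\in T$ (same reward and uncertainty set) and a zero-reward action $\mathit{stay}$ leading surely to a new sink, which has only a zero-reward self-loop; in all distributions the probability of $s_E$ is the sum of the probabilities of the states of $T$; all other states, actions and rewards are kept. Let $\mathcal M$ be a closed constant-support RMDP. Then: 1. (*Polynomial time.*) There is one program of a random access machine with unit-cost operations (constants, addition, truncated subtraction, comparison, memory access; no multiplication) and a polynomial $p$ such that, for every such $\mathcal M$ with $n$ states and $m$ actions, given as tables of the available pairs, their rewards and supports (uncertainty sets being passed by reference), the program outputs within $p(n+m)$ steps the corresponding tables of $\mathcal M'$, the map sending each state of $\mathcal M$ to the state of $\mathcal M'$ that represents it, and for each available pair of $\mathcal M'$ the original pair of which it is a copy, or the information that it is a staying action. 2. (*Linear size.*) $\mathcal M'$ has at most one state and at most one available state-action pair more than $\mathcal M$, and $|\mathcal M'|\le|\mathcal M|+3$, where $|\cdot|$ is the number of states, available pairs and transitions (triples $(s,a,t)$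 with $t$ in the support of $(s,a)$) plus the total bit length of the rewards of the available pairs. 3. (*Same values.*) For $\mathit{opt}\in\{\max,\min\}$: $V^{\mathit{opt}}_{\mathcal M}(s)=V^{\mathit{opt}}_{\mathcal M'}(s)$ for every kept state $s$, and $V^{\mathit{opt}}_{\mathcal M}(s)=V^{\mathit{opt}}_{\mathcal M'}(s_E)$ for every $s$ in a zero-reward MEC $E$. 4. (*Unique fixpoint.*) For $\mathit{opt}\in\{\max,\min\}$ with opposite direction $\overline{\mathit{opt}}$, the robust Bellman operator of $\mathcal M'$, $$(\mathcal T V)(s)=\mathit{opt}_{a\in A'(s)}\Big(r'(s,a)+\overline{\mathit{opt}}_{P\in\mathcal P'(s,a)}\sum_{t}P(t)\,V(t)\Big),$$ has exactly one fixpoint among the functions $V:S'\to(-\infty,\infty]$ that are $0$ at terminal states (states all of whose available actions are deterministic self-loops with reward $0$) and finite at every state $s$ with $V^{\mathit{opt}}_{\mathcal M'}(s)<\infty$. This fixpoint is $V^{\mathit{opt}}_{\mathcal M'}$. 5. For $\mathit{opt}=\max$, $\mathcal T$ maps this class of functions to itself and is a contraction in a weighted supremum distance on the states of finite value: there are $w:S'\to(0,\infty)$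 and $\gamma\in[0,1)$ such that $\max_s|\mathcal TV(s)-\mathcal TW(s)|/w(s)\le\gamma\max_s|V(s)-W(s)|/w(s)$ for all $V,W$ in the class, the maxima being over the states with $V^{\max}_{\mathcal M'}(s)<\infty$. -/

import Mathlib

open MeasureTheory ProbabilityTheory
open scoped ENNReal

noncomputable section

/-! ## Robust Markov decision processes -/

/-- A robust MDP with finite state set `S` and action set `A`. The uncertainty set `unc s a` is a
set of probability distributions on `S`; the action `a` is available in `s` exactly if
`unc s a` is nonempty, and every state has an available action. -/
structure RMDP (S A : Type*) [Fintype S] where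
  unc : S → A → Set (stdSimplex ℝ S)
  reward : S → A → ℕ
  exists_avail : ∀ s, ∃ a, (unc s a).Nonempty

/-- The optimization direction of the agent; the environment has the opposite direction. -/
inductive Opt
  | max
  | min

/-- The support of a probability distribution. -/
def distSupport {S : Type*} [Fintype S] (p : stdSimplex ℝ S) : Set S := {s | 0 < p s}

/-- A point of the standard simplex, as a probability mass function. -/
def distPMF {S : Type*} [Fintype S] (p : stdSimplex ℝ S) : PMF S :=
  PMF.ofFintype (fun s => ENNReal.ofReal (p s)) (by
    have h0 : ∀ s ∈ Finset.univ, 0 ≤ p s := fun s _ => p.2.1 s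
    have h1 : ∑ s, p s = 1 := p.2.2
    rw [← ENNReal.ofReal_sum_of_nonneg h0, h1, ENNReal.ofReal_one])

/-- One step of a path: a state together with the action chosen in it. -/
def Step (S A : Type*) : Type _ := S × A

instance {S A : Type*} : MeasurableSpace (Step S A) := ⊤

instance {S A : Type*} : DiscreteMeasurableSpace (Step S A) := ⟨fun _ => trivial⟩

instance {S A : Type*} [Finite S] [Finite A] : Finite (Step S A) :=
  inferInstanceAs (Finite (S × A))

namespace RMDP

variable {S A : Type*} [Fintype S]

/-- The set of available actions of a state. -/
def avail (M : RMDP S A) (s : S) : Set A := {a | (M.unc s a).Nonempty}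

/-- All uncertainty sets are closed. -/
def IsClosedRMDP (M : RMDP S A) : Prop := ∀ s a, IsClosed (M.unc s a)

/-- Two distributions in the same uncertainty set have the same support. -/
def ConstantSupport (M : RMDP S A) : Prop :=
  ∀ s a, ∀ p ∈ M.unc s a, ∀ q ∈ M.unc s a, distSupport p = distSupport q

/-- The possible successors of a state-action pair. -/
def succ (M : RMDP S A) (s : S) (a : A) : Set S := {t | ∃ p ∈ M.unc s a, t ∈ distSupport p}

/-! ### Bellman updates -/

/-- The robust Bellman operator on extended real valued functions. -/
def bellman (M : RMDP S A) (opt : Opt) (V : S → EReal) (s : S) : EReal :=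
  match opt with
  | .max => ⨆ a ∈ M.avail s, ((M.reward s a : EReal) +
      ⨅ p ∈ M.unc s a, ∑ t, ((p t : ℝ) : EReal) * V t)
  | .min => ⨅ a ∈ M.avail s, ((M.reward s a : EReal) +
      ⨆ p ∈ M.unc s a, ∑ t, ((p t : ℝ) : EReal) * V t)

/-! ### Policies, path measure, value -/

/-- A (history-dependent, randomized) agent policy. The history `s₀a₀ … sₙ₋₁aₙ₋₁` is given as a
list, the current state `sₙ` separately. -/
structure AgentPolicy (M : RMDP S A) where
  act : List (Step S A) → S → PMF A
  act_avail : ∀ h s, (act h s).support ⊆ M.avail s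

/-- A (history-dependent) environment policy: after the history `h` followed by the state `s` and
the action `a`, it picks a distribution from the uncertainty set of `(s, a)`. Its choice at
unavailable pairs is irrelevant, as these never occur. -/
structure EnvPolicy (M : RMDP S A) where
  pick : List (Step S A) → S → A → stdSimplex ℝ S
  pick_mem : ∀ h s a, a ∈ M.avail s → pick h s a ∈ M.unc s a

/-- The first `n` steps of a path that is known up to and including step `n`. -/
def past {n : ℕ} (x : Finset.Iic n → Step S A) : List (Step S A) :=
  List.ofFn fun i : Fin n => x ⟨i, Finset.mem_Iic.2 i.2.le⟩

/-- The current (last) step of a path that is known up to and including step `n`. -/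
def current {n : ℕ} (x : Finset.Iic n → Step S A) : Step S A := x ⟨n, Finset.mem_Iic.2 le_rfl⟩

/-- The law of the first step of a path starting in `s`. -/
def firstStep {M : RMDP S A} (π : AgentPolicy M) (s : S) : PMF (Step S A) :=
  (π.act [] s).map fun a => (s, a)

/-- The law of step `n + 1`, given the steps `0, …, n`: the environment picks a distribution, the
successor state is sampled from it, and the agent chooses the next action. -/
def nextStep {M : RMDP S A} (π : AgentPolicy M) (τ : EnvPolicy M) {n : ℕ}
    (x : Finset.Iic n → Step S A) : PMF (Step S A) :=
  (distPMF (τ.pick (past x) (current x).1 (current x).2)).bind fun t =>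
    (π.act (past x ++ [current x]) t).map fun a => (t, a)

section Values

variable [Finite A]

/-- The probability measure on infinite paths from `s` induced by a pair of policies. -/
def pathMeasure {M : RMDP S A} (π : AgentPolicy M) (τ : EnvPolicy M) (s : S) :
    Measure (ℕ → Step S A) :=
  haveI : IsProbabilityMeasure (firstStep π s).toMeasure := PMF.toMeasure.isProbabilityMeasure _
  haveI : ∀ n, IsMarkovKernel (Kernel.ofFunOfCountable
      fun x : Finset.Iic n → Step S A => (nextStep π τ x).toMeasure) :=
    fun _ => ⟨fun _ => PMF.toMeasure.isProbabilityMeasure _⟩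
  Kernel.trajMeasure (X := fun _ => Step S A) (firstStep π s).toMeasure fun n =>
    Kernel.ofFunOfCountable fun x : Finset.Iic n → Step S A => (nextStep π τ x).toMeasure

/-- The total reward of an infinite path. -/
def totalReward (M : RMDP S A) (ρ : ℕ → Step S A) : ℝ≥0∞ :=
  ∑' t, (M.reward (ρ t).1 (ρ t).2 : ℝ≥0∞)

/-- The expected total reward from `s` under a pair of policies. -/
def payoff {M : RMDP S A} (π : AgentPolicy M) (τ : EnvPolicy M) (s : S) : ℝ≥0∞ :=
  ∫⁻ ρ, M.totalReward ρ ∂(pathMeasure π τ s)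

/-- The optimal value of the total reward objective. -/
def value (M : RMDP S A) (opt : Opt) (s : S) : ℝ≥0∞ :=
  match opt with
  | .max => ⨆ π : AgentPolicy M, ⨅ τ : EnvPolicy M, payoff π τ s
  | .min => ⨅ π : AgentPolicy M, ⨆ τ : EnvPolicy M, payoff π τ s

/-- A terminal state: every available action is a deterministic self-loop with reward zero. -/
def IsTerminal (M : RMDP S A) (s : S) : Prop :=
  ∀ a ∈ M.avail s, M.reward s a = 0 ∧ ∀ p ∈ M.unc s a, p s = 1

/-- Functions `V : S → (-∞, ∞]` that vanish on terminal states and are finite at all states whose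
value is finite. -/
def IsEstimate (M : RMDP S A) (opt : Opt) (V : S → EReal) : Prop :=
  (∀ s, V s ≠ ⊥) ∧ (∀ s, M.IsTerminal s → V s = 0) ∧ (∀ s, M.value opt s ≠ ⊤ → V s ≠ ⊤)

/-- The robust Bellman operator contracts a weighted supremum distance over the states with finite
value: `max |V s - W s| / w s ≤ D` implies `max |(TV) s - (TW) s| / w s ≤ γ D`, for
functions `V, W` as above. -/
def BellmanContraction (M : RMDP S A) (opt : Opt) : Prop :=
  ∃ (w : S → ℝ) (γ : ℝ), (∀ s, 0 < w s) ∧ 0 ≤ γ ∧ γ < 1 ∧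
    ∀ V W : S → EReal, M.IsEstimate opt V → M.IsEstimate opt W →
      M.IsEstimate opt (M.bellman opt V) ∧
      ∀ D : ℝ,
        (∀ s, M.value opt s ≠ ⊤ → |(V s).toReal - (W s).toReal| ≤ D * w s) →
        ∀ s, M.value opt s ≠ ⊤ →
          |(M.bellman opt V s).toReal - (M.bellman opt W s).toReal| ≤ γ * D * w s

end Values

/-! ### Size -/

/-- The set of available state-action pairs. -/
def pairs (M : RMDP S A) : Set (S × A) := {x | x.2 ∈ M.avail x.1}

/-- The set of transitions `(s, a, t)`, i.e. `t` is a possible successor of `(s, a)`. -/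
def transitions (M : RMDP S A) : Set (S × A × S) := {x | x.2.2 ∈ M.succ x.1 x.2.1}

/-- The size of an RMDP: the number of states, available state-action pairs and transitions, plus
the total bit length of the rewards. -/
def size (M : RMDP S A) : ℕ :=
  Nat.card S + M.pairs.ncard + M.transitions.ncard +
    ∑ᶠ x ∈ M.pairs, Nat.size (M.reward x.1 x.2)

/-! ### End components -/

/-- `E = (T, R)` with `T` a set of states and `R` a set of available state-action pairs with states
in `T` is an end component: both are nonempty, the pairs in `R` can be kept inside `T`, and any two
states of `T` are connected by a path inside `T` that uses only pairs in `R`. -/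
def IsEndComponent (M : RMDP S A) (E : Set S × Set (S × A)) : Prop :=
  E.1.Nonempty ∧ E.2.Nonempty ∧
  (∀ s a, (s, a) ∈ E.2 → s ∈ E.1 ∧ a ∈ M.avail s) ∧
  (∀ s a, (s, a) ∈ E.2 → ∃ p ∈ M.unc s a, distSupport p ⊆ E.1) ∧
  ∀ s ∈ E.1, ∀ t ∈ E.1, Relation.ReflTransGen
    (fun u v => v ∈ E.1 ∧ ∃ a, (u, a) ∈ E.2 ∧ v ∈ M.succ u a) s t

/-- An end component in which all rewards are zero. -/
def IsZeroEC (M : RMDP S A) (E : Set S × Set (S × A)) : Prop :=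
  M.IsEndComponent E ∧ ∀ s a, (s, a) ∈ E.2 → M.reward s a = 0

/-- The zero-reward maximal end components: inclusion-maximal zero-reward end components. -/
def ZeroMEC (M : RMDP S A) : Type _ := {E : Set S × Set (S × A) // Maximal M.IsZeroEC E}

/-- The states of a zero-reward maximal end component. -/
def ZeroMEC.states {M : RMDP S A} (E : M.ZeroMEC) : Set S := E.1.1

/-- The staying state-action pairs of a zero-reward maximal end component. -/
def ZeroMEC.staying {M : RMDP S A} (E : M.ZeroMEC) : Set (S × A) := E.1.2

instance {M : RMDP S A} [Finite A] : Finite M.ZeroMEC :=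
  inferInstanceAs (Finite {E : Set S × Set (S × A) // Maximal M.IsZeroEC E})

/-! ### Collapsing -/

/-- States of the collapsed RMDP: the states outside all zero-reward MECs, a representative of each
zero-reward MEC, and a sink. -/
inductive CState (M : RMDP S A)
  | keep (s : S) (hs : ∀ E : M.ZeroMEC, s ∉ E.states) : CState M
  | rep (E : M.ZeroMEC) : CState M
  | sink : CState M

instance {M : RMDP S A} [Finite A] : Finite M.CState :=
  Finite.of_injective
    (fun x : M.CState => match x with
      | .keep s _ => (Sum.inl s : S ⊕ Option M.ZeroMEC)
      | .rep E => Sum.inr (some E)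
      | .sink => Sum.inr none)
    (by rintro (_ | _ | _) (_ | _ | _) h <;> simp_all)

instance {M : RMDP S A} [Finite A] : Fintype M.CState := Fintype.ofFinite _

end RMDP

/-- Actions of the collapsed RMDP: the original actions, an action `exit s a` for taking `a` in
the collapsed state `s`, and the staying action. -/
inductive CAction (S A : Type*)
  | orig (a : A) : CAction S A
  | exit (s : S) (a : A) : CAction S A
  | stay : CAction S A

instance {S A : Type*} [Finite S] [Finite A] : Finite (CAction S A) :=
  Finite.of_injective
    (fun x : CAction S A => match x with
      | .orig a => (Sum.inl a : A ⊕ Option (S × A))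
      | .exit s a => Sum.inr (some (s, a))
      | .stay => Sum.inr none)
    (by rintro (_ | _ | _) (_ | _ | _) h <;> simp_all)

namespace RMDP

variable {S A : Type*} [Fintype S]

open Classical in
/-- The state of the collapsed RMDP that represents a given state. -/
def proj (M : RMDP S A) (s : S) : M.CState :=
  if h : ∃ E : M.ZeroMEC, s ∈ E.states then .rep h.choose
  else .keep s (not_exists.1 h)

variable [Finite A]

/-- The uncertainty sets of the collapsed RMDP. A set that is copied from the original RMDP is
pushed forward along `proj`, i.e. the probabilities of the states in a collapsed MEC are summed.
`{q | q .sink = 1}` consists of the Dirac distribution in the sink. -/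
def collapseUnc (M : RMDP S A) : M.CState → CAction S A → Set (stdSimplex ℝ M.CState)
  | .keep s _, .orig a => stdSimplex.map M.proj '' M.unc s a
  | .rep E, .exit s a =>
      {q | s ∈ E.states ∧ (s, a) ∉ E.staying ∧ q ∈ stdSimplex.map M.proj '' M.unc s a}
  | .rep _, .stay => {q | q .sink = 1}
  | .sink, .stay => {q | q .sink = 1}
  | _, _ => ∅

/-- The rewards of the collapsed RMDP. -/
def collapseReward (M : RMDP S A) : M.CState → CAction S A → ℕ
  | .keep s _, .orig a => M.reward s a
  | .rep _, .exit s a => M.reward s a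
  | _, _ => 0

/-- The collapsed RMDP. -/
def collapse (M : RMDP S A) : RMDP M.CState (CAction S A) where
  unc := M.collapseUnc
  reward := M.collapseReward
  exists_avail x := by
    classical
    have hs : ({q | q .sink = 1} : Set (stdSimplex ℝ M.CState)).Nonempty :=
      ⟨stdSimplex.vertex .sink, by simp⟩
    match x with
    | .keep s h =>
      obtain ⟨a, ha⟩ := M.exists_avail s
      exact ⟨.orig a, ha.image _⟩
    | .rep E => exact ⟨.stay, hs⟩
    | .sink => exact ⟨.stay, hs⟩

end RMDP

/-! ## A machine model with a step count -/

/-- The memory of a random access machine: natural-number registers, and natural-number cells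
addressed by the name of an array and three indices. -/
structure Memory where
  reg : ℕ → ℕ
  cell : ℕ → ℕ → ℕ → ℕ → ℕ

/-- Expressions. There is no multiplication, so that with unit costs numbers stay of polynomial
bit length within polynomially many steps. -/
inductive Expr
  | lit (c : ℕ)
  | reg (x : ℕ)
  | cell (name : ℕ) (i j k : Expr)
  | add (e f : Expr)
  | sub (e f : Expr)
  | lt (e f : Expr)
  | eq (e f : Expr)

/-- The value of an expression; truth values are `1` and `0`. -/
def Expr.eval (μ : Memory) : Expr → ℕ
  | .lit c => c
  | .reg x => μ.reg x
  | .cell n i j k => μ.cell n (i.eval μ) (j.eval μ) (k.eval μ)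
  | .add e f => e.eval μ + f.eval μ
  | .sub e f => e.eval μ - f.eval μ
  | .lt e f => if e.eval μ < f.eval μ then 1 else 0
  | .eq e f => if e.eval μ = f.eval μ then 1 else 0

/-- The number of steps for evaluating an expression: one for each of its nodes. -/
def Expr.cost : Expr → ℕ
  | .lit _ => 1
  | .reg _ => 1
  | .cell _ i j k => 1 + i.cost + j.cost + k.cost
  | .add e f => 1 + e.cost + f.cost
  | .sub e f => 1 + e.cost + f.cost
  | .lt e f => 1 + e.cost + f.cost
  | .eq e f => 1 + e.cost + f.cost

/-- Programs. `loop x e p` runs `p` for `x = 0, 1, …, n - 1`, where `n` is the value of `e`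
at the beginning of the loop. -/
inductive Prog
  | skip
  | set (x : ℕ) (e : Expr)
  | write (name : ℕ) (i j k e : Expr)
  | seq (p q : Prog)
  | ite (e : Expr) (p q : Prog)
  | loop (x : ℕ) (e : Expr) (p : Prog)

/-- Assign a value to a register. -/
def Memory.setReg (μ : Memory) (x v : ℕ) : Memory :=
  { μ with reg := Function.update μ.reg x v }

/-- Assign a value to a cell. -/
def Memory.setCell (μ : Memory) (n i j k v : ℕ) : Memory :=
  { μ with cell := fun n' i' j' k' =>
      if n' = n ∧ i' = i ∧ j' = j ∧ k' = k then v else μ.cell n' i' j' k' }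

/-- Run a program; the result is the final memory and the number of steps. -/
def Prog.run : Prog → Memory → Memory × ℕ
  | .skip, μ => (μ, 1)
  | .set x e, μ => (μ.setReg x (e.eval μ), 1 + e.cost)
  | .write n i j k e, μ =>
      (μ.setCell n (i.eval μ) (j.eval μ) (k.eval μ) (e.eval μ),
        1 + i.cost + j.cost + k.cost + e.cost)
  | .seq p q, μ => ((q.run (p.run μ).1).1, (p.run μ).2 + (q.run (p.run μ).1).2)
  | .ite e p q, μ =>
      if e.eval μ ≠ 0 then ((p.run μ).1, 1 + e.cost + (p.run μ).2)
      else ((q.run μ).1, 1 + e.cost + (q.run μ).2)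
  | .loop x e p, μ =>
      (List.range (e.eval μ)).foldl
        (fun r i => ((p.run (r.1.setReg x i)).1, r.2 + 1 + (p.run (r.1.setReg x i)).2))
        (μ, 1 + e.cost)

namespace RMDP

variable {S A : Type*} [Fintype S]

open Classical in
/-- The memory `μ` presents the RMDP `M`, with states and actions numbered by `eS` and `eA`, in the
registers `b` (number of states) and `b + 1` (number of actions) and in the arrays `b`
(availability), `b + 1` (rewards) and `b + 2` (supports). -/
def Presents (b : ℕ) (μ : Memory) (M : RMDP S A) {n m : ℕ} (eS : S ≃ Fin n) (eA : A ≃ Fin m) :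
    Prop :=
  μ.reg b = n ∧ μ.reg (b + 1) = m ∧
  ∀ s a, μ.cell b (eS s) (eA a) 0 = (if a ∈ M.avail s then 1 else 0) ∧
    (a ∈ M.avail s → μ.cell (b + 1) (eS s) (eA a) 0 = M.reward s a ∧
      ∀ t, μ.cell (b + 2) (eS s) (eA a) (eS t) = if t ∈ M.succ s a then 1 else 0)

/-- An input memory for `M`: it presents `M`, and everything not used for that is zero. The
uncertainty set of the pair `(s, a)`, an arbitrary closed set, is referred to by the numbers of `s`
and `a`. -/
def IsInput (μ : Memory) (M : RMDP S A) {n m : ℕ} (eS : S ≃ Fin n) (eA : A ≃ Fin m) : Prop :=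
  Presents 0 μ M eS eA ∧ (∀ x, 2 ≤ x → μ.reg x = 0) ∧
    ∀ x i j k, 3 ≤ x → μ.cell x i j k = 0

/-- The memory `μ` contains the collapsed RMDP: some numbering of its states and actions; the
RMDP in the registers `3, 4` and the arrays `3, 4, 5`; the map `proj` in the array `6`; and, in
the arrays `7, 8, 9`, for each available pair a flag that tells whether it is a copy of an original
pair (so that its uncertainty set is the push-forward of the one of this original pair along
`proj`) or a staying action (leading to the sink), and the original state and action of a copy. -/
def IsCollapseOutput (μ : Memory) (M : RMDP S A) [Finite A] {n m : ℕ} (eS : S ≃ Fin n)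
    (eA : A ≃ Fin m) : Prop :=
  ∃ (n' m' : ℕ) (eS' : M.CState ≃ Fin n') (eA' : CAction S A ≃ Fin m'),
    Presents 3 μ M.collapse eS' eA' ∧
    (∀ s, μ.cell 6 (eS s) 0 0 = eS' (M.proj s)) ∧
    (∀ s hs a, .orig a ∈ M.collapse.avail (.keep s hs) →
      μ.cell 7 (eS' (.keep s hs)) (eA' (.orig a)) 0 = 1 ∧
      μ.cell 8 (eS' (.keep s hs)) (eA' (.orig a)) 0 = eS s ∧
      μ.cell 9 (eS' (.keep s hs)) (eA' (.orig a)) 0 = eA a) ∧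
    (∀ E s a, .exit s a ∈ M.collapse.avail (.rep E) →
      μ.cell 7 (eS' (.rep E)) (eA' (.exit s a)) 0 = 1 ∧
      μ.cell 8 (eS' (.rep E)) (eA' (.exit s a)) 0 = eS s ∧
      μ.cell 9 (eS' (.rep E)) (eA' (.exit s a)) 0 = eA a) ∧
    (∀ x, .stay ∈ M.collapse.avail x → μ.cell 7 (eS' x) (eA' .stay) 0 = 0)

end RMDP
end

/-!
The expected total reward is the supremum of the finite-horizon expected rewards
(`payoff_eq_iSup_expReward`), which satisfy a recursion over the horizon. In a closed
constant-support RMDP, uncertainty sets are compact, and the expectation of an extended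
nonnegative function is constantly infinite or continuous on them, so optimal choices
exist. Value iteration from zero therefore converges to the value, which is the least nonnegative
function that is at least its Bellman update (`value_le_of_updateLe`, `value_fixpoint`).

*Values.* On a zero-reward MEC the value is constant, since the agent can move around in
it for free, and it is zero for minimization. So the value of either RMDP yields a function
for the other one that is at least its Bellman update, and leastness gives both inequalities
(`value_collapse_proj`).

*Fixpoints.* By maximality of the MECs, every zero-reward end component of the collapsed RMDP
contains the sink (`sink_mem_of_isZeroEC`). Hence so does every set in which the agent can
remain without collecting a reward (`mem_of_trap`). Applied to the states where a fixpoint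
is minimal, this shows that fixpoints are nonnegative, hence at least the value; applied to
the states where the difference of a fixpoint and the finite value is maximal, it shows that
they equal the value (`eq_value_of_fixpoint`).

*Contraction.* For maximization, all actions in states of finite value lead to states of finite
value, and each of them makes progress towards the sink, with a probability that is bounded
below by compactness (`exists_rank`, `exists_prob_lower_bound`). This is the situation of
a stochastic shortest path problem all of whose policies are proper, and weights that grow
with the distance to the sink give a contraction (`bellmanContraction_max`).

*Size.* Every pair and every transition of the collapsed RMDP is charged to one of the original
RMDP, without repetition, except for the loop at the sink (`ChargedTo.inj`, `size_collapse_le`).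

*Running time.* Starting from the zero-reward pairs, repeatedly remove the pairs that
have a successor from which the way back is blocked. After as many rounds as there are
pairs, the remaining pairs are the staying pairs of all zero-reward MECs, and two different
states belong to the same MEC if and only if one can be reached from the other by the remaining
pairs (`exists_mem_staying_iff`, `proj_eq_iff`). The program does this and then writes
the tables, with nested loops over all states and actions (`collapseProg_spec`); the numbers
of rounds of its loops are numbers of states or actions,
so a polynomial bound for its running time can be read off (`run_le_timeBound`).
-/

noncomputable section

/-! ### The expected total reward as a supremum of finite-horizon rewards -/

namespace PMF

/-- The expectation of an extended nonnegative function under a probability mass function. -/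
def avg {α : Type*} (p : PMF α) (f : α → ℝ≥0∞) : ℝ≥0∞ := ∑' a, p a * f a

variable {α β : Type*}

lemma avg_map (p : PMF α) (g : α → β) (f : β → ℝ≥0∞) :
    (p.map g).avg f = p.avg fun a => f (g a) := by
  classical
  unfold avg
  simp only [PMF.map_apply, ← ENNReal.tsum_mul_right]
  rw [ENNReal.tsum_comm]
  refine tsum_congr fun a => ?_
  rw [tsum_eq_single (g a)]
  · simp
  · intro b hb
    simp [hb]

lemma avg_bind (p : PMF α) (g : α → PMF β) (f : β → ℝ≥0∞) :
    (p.bind g).avg f = p.avg fun a => (g a).avg f := by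
  unfold avg
  simp only [PMF.bind_apply, ← ENNReal.tsum_mul_right, ← ENNReal.tsum_mul_left]
  rw [ENNReal.tsum_comm]
  simp only [mul_assoc]

lemma avg_pure (a : α) (f : α → ℝ≥0∞) : (PMF.pure a).avg f = f a := by
  classical
  unfold avg
  rw [tsum_eq_single a]
  · simp
  · intro b hb
    simp [hb]

lemma avg_const_add (p : PMF α) (c : ℝ≥0∞) (f : α → ℝ≥0∞) :
    (p.avg fun a => c + f a) = c + p.avg f := by
  unfold avg
  simp only [mul_add]
  rw [ENNReal.tsum_add, ENNReal.tsum_mul_right, p.tsum_coe, one_mul]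

lemma avg_le_of_forall_support (p : PMF α) (f : α → ℝ≥0∞) (c : ℝ≥0∞)
    (h : ∀ a ∈ p.support, f a ≤ c) : p.avg f ≤ c := by
  unfold avg
  calc ∑' a, p a * f a ≤ ∑' a, p a * c := by
        refine ENNReal.tsum_le_tsum fun a => ?_
        by_cases ha : p a = 0
        · simp [ha]
        · exact mul_le_mul_right (h a ((PMF.mem_support_iff _ _).2 ha)) _
    _ = c := by rw [ENNReal.tsum_mul_right, p.tsum_coe, one_mul]

lemma le_avg_of_forall_support (p : PMF α) (f : α → ℝ≥0∞) (c : ℝ≥0∞)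
    (h : ∀ a ∈ p.support, c ≤ f a) : c ≤ p.avg f := by
  unfold avg
  calc c = ∑' a, p a * c := by rw [ENNReal.tsum_mul_right, p.tsum_coe, one_mul]
    _ ≤ ∑' a, p a * f a := by
        refine ENNReal.tsum_le_tsum fun a => ?_
        by_cases ha : p a = 0
        · simp [ha]
        · exact mul_le_mul_right (h a ((PMF.mem_support_iff _ _).2 ha)) _

lemma lintegral_toMeasure_eq_avg [Countable α] [MeasurableSpace α] [MeasurableSingletonClass α]
    (p : PMF α) (f : α → ℝ≥0∞) : ∫⁻ a, f a ∂p.toMeasure = p.avg f := by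
  rw [lintegral_countable', avg]
  refine tsum_congr fun a => ?_
  rw [PMF.toMeasure_apply_singleton _ _ (measurableSet_singleton a), mul_comm]

end PMF

/-- The expectation of `f` under a point `p` of the standard simplex. -/
def distAvg {S : Type*} [Fintype S] (p : stdSimplex ℝ S) (f : S → ℝ≥0∞) : ℝ≥0∞ :=
  ∑ t, ENNReal.ofReal (p t) * f t

lemma distPMF_avg {S : Type*} [Fintype S] (p : stdSimplex ℝ S) (f : S → ℝ≥0∞) :
    (distPMF p).avg f = distAvg p f := by
  unfold PMF.avg distAvg
  rw [tsum_fintype]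
  rfl

namespace RMDP

lemma past_append_current {S A : Type*} (ρ : ℕ → Step S A) (n : ℕ) :
    past (Preorder.frestrictLe (π := fun _ => Step S A) n ρ) ++
      [current (Preorder.frestrictLe (π := fun _ => Step S A) n ρ)] =
    past (Preorder.frestrictLe (π := fun _ => Step S A) (n + 1) ρ) := by
  unfold past
  rw [List.ofFn_succ', List.concat_eq_append]
  rfl

variable {S A : Type*} [Fintype S] {M : RMDP S A}

/-- The expected reward of the next `n` steps after the history `h`, in the state `s`. -/
def expReward (π : AgentPolicy M) (τ : EnvPolicy M) : ℕ → List (Step S A) → S → ℝ≥0∞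
  | 0, _, _ => 0
  | n + 1, h, s => (π.act h s).avg fun a => (M.reward s a : ℝ≥0∞) +
      distAvg (τ.pick h s a) fun t => expReward π τ n (h ++ ([(s, a)] : List (Step S A))) t

/-- The reward of the step `x` plus the expected reward of the `k` steps following it. -/
def contReward (π : AgentPolicy M) (τ : EnvPolicy M) (k : ℕ) (h : List (Step S A))
    (x : Step S A) : ℝ≥0∞ :=
  (M.reward x.1 x.2 : ℝ≥0∞) + distAvg (τ.pick h x.1 x.2) fun t => expReward π τ k (h ++ [x]) t

lemma expReward_succ_eq (π : AgentPolicy M) (τ : EnvPolicy M) (k : ℕ) (h : List (Step S A))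
    (s : S) : expReward π τ (k + 1) h s = (π.act h s).avg fun a => contReward π τ k h (s, a) :=
  rfl

lemma firstStep_avg (π : AgentPolicy M) (s : S) (g : Step S A → ℝ≥0∞) :
    (firstStep π s).avg g = (π.act [] s).avg fun a => g (s, a) :=
  PMF.avg_map _ _ _

lemma nextStep_avg (π : AgentPolicy M) (τ : EnvPolicy M) {n : ℕ} (x : Finset.Iic n → Step S A)
    (g : Step S A → ℝ≥0∞) :
    (nextStep π τ x).avg g = distAvg (τ.pick (past x) (current x).1 (current x).2) fun t =>
      (π.act (past x ++ [current x]) t).avg fun a => g (t, a) := by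
  unfold nextStep
  rw [PMF.avg_bind, distPMF_avg]
  congr 1
  funext t
  exact PMF.avg_map _ _ _

lemma contReward_succ (π : AgentPolicy M) (τ : EnvPolicy M) (k n : ℕ)
    (x : Finset.Iic n → Step S A) :
    contReward π τ (k + 1) (past x) (current x) =
      (M.reward (current x).1 (current x).2 : ℝ≥0∞) +
        (nextStep π τ x).avg (contReward π τ k (past x ++ [current x])) := by
  rw [nextStep_avg]
  rfl

variable [Finite A]

lemma lintegral_pathMeasure_zero (π : AgentPolicy M) (τ : EnvPolicy M) (s : S)
    (g : Step S A → ℝ≥0∞) :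
    ∫⁻ ρ, g (ρ 0) ∂(pathMeasure π τ s) = (firstStep π s).avg g := by
  have : IsProbabilityMeasure (firstStep π s).toMeasure := PMF.toMeasure.isProbabilityMeasure _
  have : ∀ n, IsMarkovKernel (Kernel.ofFunOfCountable
      fun x : Finset.Iic n → Step S A => (nextStep π τ x).toMeasure) :=
    fun _ => ⟨fun _ => PMF.toMeasure.isProbabilityMeasure _⟩
  have hmap : (pathMeasure π τ s).map (Preorder.frestrictLe (π := fun _ => Step S A) 0) =
      (firstStep π s).toMeasure.map
        (MeasurableEquiv.piUnique (fun _ : Finset.Iic 0 => Step S A)).symm := by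
    unfold pathMeasure Kernel.trajMeasure
    rw [Measure.map_comp _ _ (by fun_prop), Kernel.traj_map_frestrictLe,
      Kernel.partialTraj_self]
    exact Measure.id_comp
  have h1 : ∫⁻ ρ, g (ρ 0) ∂(pathMeasure π τ s) =
      ∫⁻ x, g (x ⟨0, by simp⟩)
        ∂((pathMeasure π τ s).map (Preorder.frestrictLe (π := fun _ => Step S A) 0)) := by
    rw [lintegral_map (measurable_of_countable _) (by fun_prop)]
    rfl
  rw [h1, hmap, lintegral_map (measurable_of_countable _) (by fun_prop),
    ← PMF.lintegral_toMeasure_eq_avg]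
  rfl

lemma lintegral_pathMeasure_succ (π : AgentPolicy M) (τ : EnvPolicy M) (s : S) (n : ℕ)
    (g : (Finset.Iic n → Step S A) → Step S A → ℝ≥0∞) :
    ∫⁻ ρ, g (Preorder.frestrictLe (π := fun _ => Step S A) n ρ) (ρ (n + 1))
        ∂(pathMeasure π τ s) =
      ∫⁻ ρ, (nextStep π τ (Preorder.frestrictLe (π := fun _ => Step S A) n ρ)).avg
        (g (Preorder.frestrictLe (π := fun _ => Step S A) n ρ)) ∂(pathMeasure π τ s) := by
  have : IsProbabilityMeasure (firstStep π s).toMeasure := PMF.toMeasure.isProbabilityMeasure _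
  have : ∀ n, IsMarkovKernel (Kernel.ofFunOfCountable
      fun x : Finset.Iic n → Step S A => (nextStep π τ x).toMeasure) :=
    fun _ => ⟨fun _ => PMF.toMeasure.isProbabilityMeasure _⟩
  have key := Kernel.map_frestrictLe_trajMeasure_compProd_eq_map_trajMeasure
    (X := fun _ => Step S A) (μ₀ := (firstStep π s).toMeasure)
    (κ := fun n => Kernel.ofFunOfCountable
      fun x : Finset.Iic n → Step S A => (nextStep π τ x).toMeasure) (a := n)
  change (pathMeasure π τ s).map _ ⊗ₘ _ = (pathMeasure π τ s).map _ at key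
  have : IsProbabilityMeasure (pathMeasure π τ s) := by
    unfold pathMeasure; infer_instance
  have h1 : ∫⁻ ρ, g (Preorder.frestrictLe (π := fun _ => Step S A) n ρ) (ρ (n + 1))
        ∂(pathMeasure π τ s) = ∫⁻ z, g z.1 z.2 ∂((pathMeasure π τ s).map
          (fun ρ => (Preorder.frestrictLe (π := fun _ => Step S A) n ρ, ρ (n + 1)))) := by
    rw [lintegral_map (measurable_of_countable _) (by fun_prop)]
  rw [h1, ← key, Measure.lintegral_compProd (measurable_of_countable _),
    lintegral_map (measurable_of_countable _) (by fun_prop)]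
  refine lintegral_congr fun ρ => ?_
  exact PMF.lintegral_toMeasure_eq_avg _ _

/-- Splitting an `(n + k + 1)`-step reward after step `n`. -/
lemma expReward_eq_lintegral (π : AgentPolicy M) (τ : EnvPolicy M) (s : S) (n k : ℕ) :
    expReward π τ (n + k + 1) [] s =
      ∫⁻ ρ, ∑ i ∈ Finset.range n, (M.reward (ρ i).1 (ρ i).2 : ℝ≥0∞) +
        contReward π τ k (past (Preorder.frestrictLe (π := fun _ => Step S A) n ρ)) (ρ n)
          ∂(pathMeasure π τ s) := by
  induction n generalizing k with
  | zero =>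
    have := lintegral_pathMeasure_zero π τ s (contReward π τ k [])
    simp only [Finset.range_zero, Finset.sum_empty, zero_add]
    rw [expReward_succ_eq]
    rw [firstStep_avg] at this
    exact this.symm
  | succ n ih =>
    have h := ih (k + 1)
    rw [show n + 1 + k + 1 = n + (k + 1) + 1 by omega, h]
    have h2 := lintegral_pathMeasure_succ π τ s n (fun x y =>
      ∑ i : Fin n, (M.reward (x ⟨i, Finset.mem_Iic.2 i.2.le⟩).1
          (x ⟨i, Finset.mem_Iic.2 i.2.le⟩).2 : ℝ≥0∞) +
        (M.reward (current x).1 (current x).2 : ℝ≥0∞) +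
        contReward π τ k (past x ++ [current x]) y)
    simp only [PMF.avg_const_add] at h2
    refine Eq.trans ?_ (h2.symm.trans ?_)
    · refine lintegral_congr fun ρ => ?_
      have h3 := contReward_succ π τ k n (Preorder.frestrictLe (π := fun _ => Step S A) n ρ)
      rw [add_assoc, ← h3, Finset.sum_range]
      rfl
    · refine lintegral_congr fun ρ => ?_
      rw [past_append_current, Finset.sum_range_succ, Finset.sum_range]
      rfl

/-- The expected total reward is the supremum of the expected finite-horizon rewards. -/
theorem payoff_eq_iSup_expReward (π : AgentPolicy M) (τ : EnvPolicy M) (s : S) :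
    payoff π τ s = ⨆ n, expReward π τ n [] s := by
  have h1 : ∀ n, expReward π τ (n + 1) [] s =
      ∫⁻ ρ, ∑ i ∈ Finset.range (n + 1), (M.reward (ρ i).1 (ρ i).2 : ℝ≥0∞)
        ∂(pathMeasure π τ s) := by
    intro n
    have h := expReward_eq_lintegral π τ s n 0
    rw [add_zero] at h
    rw [h]
    refine lintegral_congr fun ρ => ?_
    rw [Finset.sum_range_succ]
    simp [contReward, expReward, distAvg]
  have hmeas : ∀ i : ℕ, Measurable fun ρ : ℕ → Step S A =>
      (M.reward (ρ i).1 (ρ i).2 : ℝ≥0∞) := fun i =>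
    (measurable_of_countable fun x : Step S A => (M.reward x.1 x.2 : ℝ≥0∞)).comp
      (measurable_pi_apply i)
  have h2 : payoff π τ s = ⨆ n, ∫⁻ ρ, ∑ i ∈ Finset.range n,
      (M.reward (ρ i).1 (ρ i).2 : ℝ≥0∞) ∂(pathMeasure π τ s) := by
    unfold payoff totalReward
    simp only [ENNReal.tsum_eq_iSup_nat]
    refine lintegral_iSup (fun n => Finset.measurable_sum _ fun i _ => hmeas i) ?_
    intro n m hnm ρ
    exact Finset.sum_le_sum_of_subset (Finset.range_mono hnm)
  rw [h2]
  congr 1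
  funext n
  cases n with
  | zero => simp [expReward]
  | succ n => rw [h1]

end RMDP

/-! ### The value as the least fixpoint of the robust Bellman operator -/

section DistAvg

variable {S : Type*} [Fintype S]

lemma distAvg_mono (p : stdSimplex ℝ S) {f g : S → ℝ≥0∞} (h : ∀ t, f t ≤ g t) :
    distAvg p f ≤ distAvg p g :=
  Finset.sum_le_sum fun t _ => mul_le_mul_right (h t) _

lemma distAvg_congr (p : stdSimplex ℝ S) {f g : S → ℝ≥0∞}
    (h : ∀ t ∈ distSupport p, f t = g t) : distAvg p f = distAvg p g := by
  refine Finset.sum_congr rfl fun t _ => ?_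
  by_cases ht : 0 < p t
  · rw [h t ht]
  · rw [ENNReal.ofReal_of_nonpos (not_lt.1 ht), zero_mul, zero_mul]

lemma distAvg_eq_top (p : stdSimplex ℝ S) {f : S → ℝ≥0∞} {t : S} (ht : t ∈ distSupport p)
    (hf : f t = ⊤) : distAvg p f = ⊤ := by
  refine ENNReal.sum_eq_top.2 ⟨t, Finset.mem_univ _, ?_⟩
  rw [hf, ENNReal.mul_top]
  exact (ENNReal.ofReal_pos.2 ht).ne'

lemma distAvg_ne_top (p : stdSimplex ℝ S) {f : S → ℝ≥0∞} (hf : ∀ t ∈ distSupport p, f t ≠ ⊤) :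
    distAvg p f ≠ ⊤ := by
  refine (ENNReal.sum_lt_top.2 fun t _ => ?_).ne
  by_cases ht : 0 < p t
  · exact ENNReal.mul_lt_top ENNReal.ofReal_lt_top (hf t ht).lt_top
  · rw [ENNReal.ofReal_of_nonpos (not_lt.1 ht), zero_mul]
    exact ENNReal.zero_lt_top

lemma distAvg_const (p : stdSimplex ℝ S) (c : ℝ≥0∞) : distAvg p (fun _ => c) = c := by
  unfold distAvg
  have h0 : ∀ s ∈ Finset.univ, 0 ≤ p s := fun s _ => p.2.1 s
  have h1 : ∑ s, p s = 1 := p.2.2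
  rw [← Finset.sum_mul, ← ENNReal.ofReal_sum_of_nonneg h0, h1, ENNReal.ofReal_one, one_mul]

lemma distAvg_iSup (p : stdSimplex ℝ S) {f : ℕ → S → ℝ≥0∞} (hf : Monotone f) :
    distAvg p (fun t => ⨆ n, f n t) = ⨆ n, distAvg p (f n) := by
  unfold distAvg
  simp only [ENNReal.mul_iSup]
  rw [ENNReal.finsetSum_iSup_of_monotone]
  intro t n m hnm
  exact mul_le_mul_right (hf hnm t) _

lemma continuous_distAvg {f : S → ℝ≥0∞} (hf : ∀ t, f t ≠ ⊤) :
    Continuous fun p : stdSimplex ℝ S => distAvg p f := by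
  unfold distAvg
  refine continuous_finsetSum _ fun t _ => ?_
  refine (ENNReal.continuous_mul_const (hf t)).comp (ENNReal.continuous_ofReal.comp ?_)
  exact (continuous_apply t).comp continuous_subtype_val

/-- On a compact set of distributions with a common support, the expectation of an extended
function is either constantly infinite or continuous; in both cases it attains its extrema. -/
lemma exists_distAvg_min_max {K : Set (stdSimplex ℝ S)} (hK : IsClosed K) (hne : K.Nonempty)
    (hs : ∀ p ∈ K, ∀ q ∈ K, distSupport p = distSupport q) (f : S → ℝ≥0∞) :
    (∃ p ∈ K, ∀ q ∈ K, distAvg p f ≤ distAvg q f) ∧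
      ∃ p ∈ K, ∀ q ∈ K, distAvg q f ≤ distAvg p f := by
  classical
  obtain ⟨p₀, hp₀⟩ := hne
  by_cases htop : ∃ t ∈ distSupport p₀, f t = ⊤
  · obtain ⟨t, ht, hft⟩ := htop
    have h : ∀ q ∈ K, distAvg q f = ⊤ := fun q hq =>
      distAvg_eq_top q (by rwa [hs q hq p₀ hp₀]) hft
    exact ⟨⟨p₀, hp₀, fun q hq => by rw [h q hq]; exact le_top⟩,
      ⟨p₀, hp₀, fun q _ => by rw [h p₀ hp₀]; exact le_top⟩⟩
  · push Not at htop
    have h : ∀ q ∈ K, distAvg q f =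
        distAvg q fun t => if t ∈ distSupport p₀ then f t else 0 := fun q hq =>
      distAvg_congr q fun t ht => by rw [hs q hq p₀ hp₀] at ht; rw [if_pos ht]
    have hc : Continuous fun p : stdSimplex ℝ S =>
        distAvg p fun t => if t ∈ distSupport p₀ then f t else 0 := by
      refine continuous_distAvg fun t => ?_
      split_ifs with ht
      · exact htop t ht
      · exact ENNReal.zero_ne_top
    obtain ⟨p, hp, hp'⟩ := hK.isCompact.exists_isMinOn ⟨p₀, hp₀⟩ hc.continuousOn
    obtain ⟨q, hq, hq'⟩ := hK.isCompact.exists_isMaxOn ⟨p₀, hp₀⟩ hc.continuousOn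
    refine ⟨⟨p, hp, fun x hx => ?_⟩, ⟨q, hq, fun x hx => ?_⟩⟩
    · rw [h p hp, h x hx]; exact hp' hx
    · rw [h q hq, h x hx]; exact hq' hx

end DistAvg

/-- A decreasing sequence of nonempty sets in a finite type has a common element. -/
lemma exists_forall_of_antitone {A : Type*} [Finite A] (P : ℕ → A → Prop)
    (hP : ∀ n m a, n ≤ m → P m a → P n a) (h : ∀ n, ∃ a, P n a) : ∃ a, ∀ n, P n a := by
  by_contra! hcon
  choose N hN using hcon
  have := Fintype.ofFinite A
  obtain ⟨a, ha⟩ := h (Finset.univ.sup N)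
  exact hN a (hP _ _ a (Finset.le_sup (Finset.mem_univ a)) ha)

namespace RMDP

variable {S A : Type*} [Fintype S]

/-- The Bellman update of `W` in `s` is at least `v`: for maximization, some action is good against
every answer of the environment; for minimization, the environment has an answer to every
action. -/
def LeUpdate (M : RMDP S A) (opt : Opt) (W : S → ℝ≥0∞) (s : S) (v : ℝ≥0∞) : Prop :=
  match opt with
  | .max => ∃ a ∈ M.avail s, ∀ p ∈ M.unc s a, v ≤ (M.reward s a : ℝ≥0∞) + distAvg p W
  | .min => ∀ a ∈ M.avail s, ∃ p ∈ M.unc s a, v ≤ (M.reward s a : ℝ≥0∞) + distAvg p W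

/-- The Bellman update of `W` in `s` is at most `v`. -/
def UpdateLe (M : RMDP S A) (opt : Opt) (W : S → ℝ≥0∞) (s : S) (v : ℝ≥0∞) : Prop :=
  match opt with
  | .max => ∀ a ∈ M.avail s, ∃ p ∈ M.unc s a, (M.reward s a : ℝ≥0∞) + distAvg p W ≤ v
  | .min => ∃ a ∈ M.avail s, ∀ p ∈ M.unc s a, (M.reward s a : ℝ≥0∞) + distAvg p W ≤ v

variable {M : RMDP S A} {opt : Opt}

lemma LeUpdate.mono {W W' : S → ℝ≥0∞} {s : S} {v : ℝ≥0∞} (h : M.LeUpdate opt W s v)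
    (hW : ∀ t, W t ≤ W' t) : M.LeUpdate opt W' s v := by
  cases opt
  · obtain ⟨a, ha, h⟩ := h
    exact ⟨a, ha, fun p hp => (h p hp).trans (add_le_add_right (distAvg_mono p hW) _)⟩
  · intro a ha
    obtain ⟨p, hp, h⟩ := h a ha
    exact ⟨p, hp, h.trans (add_le_add_right (distAvg_mono p hW) _)⟩

lemma LeUpdate.exists_le {W : S → ℝ≥0∞} {s : S} {v : ℝ≥0∞} (h : M.LeUpdate opt W s v) :
    ∃ a ∈ M.avail s, ∃ p ∈ M.unc s a, v ≤ (M.reward s a : ℝ≥0∞) + distAvg p W := by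
  cases opt
  · obtain ⟨a, ha, h⟩ := h
    obtain ⟨p, hp⟩ := ha
    exact ⟨a, ⟨p, hp⟩, p, hp, h p hp⟩
  · obtain ⟨a, ha⟩ := M.exists_avail s
    obtain ⟨p, hp, h⟩ := h a ha
    exact ⟨a, ha, p, hp, h⟩

/-- A lower and an upper bound of the Bellman update are comparable. -/
lemma LeUpdate.le_of_updateLe {W : S → ℝ≥0∞} {s : S} {v v' : ℝ≥0∞} (h : M.LeUpdate opt W s v)
    (h' : M.UpdateLe opt W s v') : v ≤ v' := by
  cases opt
  · obtain ⟨a, ha, h⟩ := h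
    obtain ⟨p, hp, h'⟩ := h' a ha
    exact (h p hp).trans h'
  · obtain ⟨a, ha, h'⟩ := h'
    obtain ⟨p, hp, h⟩ := h a ha
    exact h.trans (h' p hp)

/-- The Bellman update exists, as optimal actions and answers exist. -/
lemma exists_update [Finite A] (hM : M.IsClosedRMDP) (hcs : M.ConstantSupport) (opt : Opt)
    (W : S → ℝ≥0∞) (s : S) : ∃ v, M.LeUpdate opt W s v ∧ M.UpdateLe opt W s v := by
  cases opt
  · have h1 : ∀ a, ∃ p, a ∈ M.avail s → p ∈ M.unc s a ∧
        ∀ q ∈ M.unc s a, distAvg p W ≤ distAvg q W := by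
      intro a
      by_cases ha : a ∈ M.avail s
      · obtain ⟨p, hp, h⟩ := (exists_distAvg_min_max (hM s a) ha (hcs s a) W).1
        exact ⟨p, fun _ => ⟨hp, h⟩⟩
      · classical
        exact ⟨stdSimplex.vertex s, fun h => absurd h ha⟩
    choose p hp using h1
    obtain ⟨a, ha, hmax⟩ := Set.exists_max_image (M.avail s)
      (fun a => (M.reward s a : ℝ≥0∞) + distAvg (p a) W) (Set.toFinite _) (M.exists_avail s)
    refine ⟨(M.reward s a : ℝ≥0∞) + distAvg (p a) W, ⟨a, ha, fun q hq => ?_⟩, fun b hb => ?_⟩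
    · exact add_le_add_right ((hp a ha).2 q hq) _
    · exact ⟨p b, (hp b hb).1, hmax b hb⟩
  · have h1 : ∀ a, ∃ p, a ∈ M.avail s → p ∈ M.unc s a ∧
        ∀ q ∈ M.unc s a, distAvg q W ≤ distAvg p W := by
      intro a
      by_cases ha : a ∈ M.avail s
      · obtain ⟨p, hp, h⟩ := (exists_distAvg_min_max (hM s a) ha (hcs s a) W).2
        exact ⟨p, fun _ => ⟨hp, h⟩⟩
      · classical
        exact ⟨stdSimplex.vertex s, fun h => absurd h ha⟩
    choose p hp using h1
    obtain ⟨a, ha, hmin⟩ := Set.exists_min_image (M.avail s)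
      (fun a => (M.reward s a : ℝ≥0∞) + distAvg (p a) W) (Set.toFinite _) (M.exists_avail s)
    refine ⟨(M.reward s a : ℝ≥0∞) + distAvg (p a) W, fun b hb => ?_, ⟨a, ha, fun q hq => ?_⟩⟩
    · exact ⟨p b, (hp b hb).1, hmin b hb⟩
    · exact add_le_add_right ((hp a ha).2 q hq) _

/-! ### Bounds on the value by policies -/

section Policies

variable [Finite A]

/-- The value is at most every nonnegative function that is at least its Bellman update: the
optimal stationary policy for the update of `W` keeps the expected reward below `W`. -/
theorem value_le_of_updateLe {W : S → ℝ≥0∞} (hW : ∀ s, M.UpdateLe opt W s (W s)) (s : S) :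
    M.value opt s ≤ W s := by
  classical
  cases opt
  -- at unavailable pairs, the choice of the environment is arbitrary
  · have h1 : ∀ s a, ∃ p, a ∈ M.avail s → p ∈ M.unc s a ∧
        (M.reward s a : ℝ≥0∞) + distAvg p W ≤ W s := by
      intro s a
      by_cases ha : a ∈ M.avail s
      · obtain ⟨p, hp, h⟩ := hW s a ha
        exact ⟨p, fun _ => ⟨hp, h⟩⟩
      · exact ⟨stdSimplex.vertex s, fun h => absurd h ha⟩
    choose p hp using h1
    refine iSup_le fun π => iInf_le_of_le
      (⟨fun _ s a => p s a, fun _ s a ha => (hp s a ha).1⟩ : EnvPolicy M) ?_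
    rw [payoff_eq_iSup_expReward]
    refine iSup_le fun n => ?_
    generalize ([] : List (Step S A)) = h
    induction n generalizing h s with
    | zero => exact zero_le
    | succ n ih =>
      refine PMF.avg_le_of_forall_support _ _ _ fun a ha => ?_
      have ha' := π.act_avail h s ha
      exact (add_le_add_right (distAvg_mono _ fun t => ih _ _) _).trans (hp s a ha').2
  · choose a ha h using hW
    refine iInf_le_of_le (⟨fun _ s => PMF.pure (a s), fun _ s b hb => by
      rw [PMF.support_pure, Set.mem_singleton_iff] at hb; rw [hb]; exact ha s⟩ : AgentPolicy M) ?_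
    refine iSup_le fun τ => ?_
    rw [payoff_eq_iSup_expReward]
    refine iSup_le fun n => ?_
    generalize ([] : List (Step S A)) = l
    induction n generalizing l s with
    | zero => exact zero_le
    | succ n ih =>
      rw [expReward, PMF.avg_pure]
      exact (add_le_add_right (distAvg_mono _ fun t => ih _ _) _).trans
        (h s _ (τ.pick_mem l s _ (ha s)))

/-- A sequence of functions, starting with `0`, each of which is at most the Bellman update of the
previous one, bounds the value from below: when `k` steps are left, play optimally for the
update of the `k`-th function. -/
theorem le_value_of_leUpdate {u : ℕ → S → ℝ≥0∞} (h0 : ∀ s, u 0 s = 0)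
    (hu : ∀ n s, M.LeUpdate opt (u n) s (u (n + 1) s)) (N : ℕ) (s : S) :
    u N s ≤ M.value opt s := by
  classical
  cases opt
  · choose a ha h using hu
    let π : AgentPolicy M := ⟨fun l s => PMF.pure (a (N - l.length - 1) s), fun _ s b hb => by
      rw [PMF.support_pure, Set.mem_singleton_iff] at hb; rw [hb]; exact ha _ s⟩
    refine le_iSup_of_le π (le_iInf fun τ => ?_)
    rw [payoff_eq_iSup_expReward]
    refine le_iSup_of_le N ?_
    have key : ∀ k (l : List (Step S A)) s, l.length + k = N → u k s ≤ expReward π τ k l s := by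
      intro k
      induction k with
      | zero => intro l s _; rw [h0]; exact zero_le
      | succ k ih =>
        intro l s hl
        have hπ : π.act l s = PMF.pure (a k s) := by
          change PMF.pure (a (N - l.length - 1) s) = _
          rw [show N - l.length - 1 = k by omega]
        rw [expReward, hπ, PMF.avg_pure]
        refine (h k s _ (τ.pick_mem l s _ (ha k s))).trans
          (add_le_add_right (distAvg_mono _ fun t => ih _ _ ?_) _)
        rw [List.length_append]
        change l.length + 1 + k = N
        omega
    exact key N [] s (by simp)
  · have h1 : ∀ n s a, ∃ p, a ∈ M.avail s → p ∈ M.unc s a ∧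
        u (n + 1) s ≤ (M.reward s a : ℝ≥0∞) + distAvg p (u n) := by
      intro n s a
      by_cases ha : a ∈ M.avail s
      · obtain ⟨p, hp, h⟩ := hu n s a ha
        exact ⟨p, fun _ => ⟨hp, h⟩⟩
      · exact ⟨stdSimplex.vertex s, fun h => absurd h ha⟩
    choose p hp using h1
    let τ : EnvPolicy M :=
      ⟨fun l s a => p (N - l.length - 1) s a, fun _ s a ha => (hp _ s a ha).1⟩
    refine le_iInf fun π => le_iSup_of_le τ ?_
    rw [payoff_eq_iSup_expReward]
    refine le_iSup_of_le N ?_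
    have key : ∀ k (l : List (Step S A)) s, l.length + k = N → u k s ≤ expReward π τ k l s := by
      intro k
      induction k with
      | zero => intro l s _; rw [h0]; exact zero_le
      | succ k ih =>
        intro l s hl
        refine PMF.le_avg_of_forall_support _ _ _ fun a ha => ?_
        have hτ : τ.pick l s a = p k s a := by
          change p (N - l.length - 1) s a = _
          rw [show N - l.length - 1 = k by omega]
        rw [hτ]
        refine ((hp k s a (π.act_avail l s ha)).2).trans
          (add_le_add_right (distAvg_mono _ fun t => ih _ _ ?_) _)
        rw [List.length_append]
        change l.length + 1 + k = N
        omega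
    exact key N [] s (by simp)

/-- In a closed constant-support RMDP the value is a fixpoint of the Bellman operator. It is the
limit of value iteration from `0`; the only delicate point is that for maximization, where the
environment minimizes, the infimum over a compact uncertainty set commutes with this limit. -/
theorem value_fixpoint (hM : M.IsClosedRMDP) (hcs : M.ConstantSupport) (opt : Opt) (s : S) :
    M.LeUpdate opt (M.value opt) s (M.value opt s) ∧
      M.UpdateLe opt (M.value opt) s (M.value opt s) := by
  choose B hB1 hB2 using fun W s => M.exists_update hM hcs opt W s
  let u : ℕ → S → ℝ≥0∞ := fun n => B^[n] fun _ => 0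
  have u0 : ∀ s, u 0 s = 0 := fun _ => rfl
  have us : ∀ n, u (n + 1) = B (u n) := fun n => Function.iterate_succ_apply' B n _
  have hsub : ∀ n s, M.LeUpdate opt (u n) s (u (n + 1) s) := fun n s => by
    rw [us]; exact hB1 _ s
  have hsup : ∀ n s, M.UpdateLe opt (u n) s (u (n + 1) s) := fun n s => by
    rw [us]; exact hB2 _ s
  have hBmono : Monotone B := fun W W' h s =>
    ((hB1 W s).mono h).le_of_updateLe (hB2 W' s)
  have umono : Monotone u := by
    refine monotone_nat_of_le_succ fun n => ?_
    induction n with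
    | zero => intro s; exact zero_le
    | succ n ih => rw [us, us]; exact hBmono ih
  have ufin : ∀ n s, u n s ≠ ⊤ := by
    intro n
    induction n with
    | zero => intro s; exact ENNReal.zero_ne_top
    | succ n ih =>
      intro s
      obtain ⟨a, _, p, _, h⟩ := (hsub n s).exists_le
      exact ne_top_of_le_ne_top
        (ENNReal.add_ne_top.2 ⟨ENNReal.natCast_ne_top _, distAvg_ne_top p fun t _ => ih t⟩) h
  let U : S → ℝ≥0∞ := fun s => ⨆ n, u n s
  have uU : ∀ n s, u n s ≤ U s := fun n s => le_iSup (fun n => u n s) n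
  have havg : ∀ p : stdSimplex ℝ S, distAvg p U = ⨆ n, distAvg p (u n) := fun p =>
    distAvg_iSup p umono
  have hUsup : ∀ s, M.UpdateLe opt U s (U s) := by
    intro s
    cases opt
    -- the good answers to `u n` form a decreasing sequence of compact sets
    · intro a ha
      have hne := IsCompact.nonempty_iInter_of_sequence_nonempty_isCompact_isClosed
        (fun n => M.unc s a ∩ {p | (M.reward s a : ℝ≥0∞) + distAvg p (u n) ≤ U s})
        (fun n p hp => ⟨hp.1, (add_le_add_right
          (distAvg_mono p (umono (Nat.le_succ n))) _).trans hp.2⟩)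
        (fun n => by
          obtain ⟨p, hp, h⟩ := hsup n s a ha
          exact ⟨p, hp, h.trans (uU _ s)⟩)
        (((hM s a).inter (isClosed_le (continuous_const.add
          (continuous_distAvg (ufin 0))) continuous_const)).isCompact)
        (fun n => (hM s a).inter (isClosed_le (continuous_const.add
          (continuous_distAvg (ufin n))) continuous_const))
      obtain ⟨p, hp⟩ := hne
      rw [Set.mem_iInter] at hp
      refine ⟨p, (hp 0).1, ?_⟩
      rw [havg, ENNReal.add_iSup]
      exact iSup_le fun n => (hp n).2
    -- one action is good for all `u n`, as there are finitely many
    · obtain ⟨a, ha⟩ := exists_forall_of_antitone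
        (fun n a => a ∈ M.avail s ∧ ∀ p ∈ M.unc s a,
          (M.reward s a : ℝ≥0∞) + distAvg p (u n) ≤ U s)
        (fun n m a hnm h => ⟨h.1, fun p hp =>
          (add_le_add_right (distAvg_mono p (umono hnm)) _).trans (h.2 p hp)⟩)
        (fun n => by
          obtain ⟨a, ha, h⟩ := hsup n s
          exact ⟨a, ha, fun p hp => (h p hp).trans (uU _ s)⟩)
      refine ⟨a, (ha 0).1, fun p hp => ?_⟩
      rw [havg, ENNReal.add_iSup]
      exact iSup_le fun n => (ha n).2 p hp
  have hval : M.value opt = U := by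
    funext s
    exact le_antisymm (value_le_of_updateLe hUsup s)
      (iSup_le fun n => le_value_of_leUpdate u0 hsub n s)
  rw [hval]
  refine ⟨?_, hUsup s⟩
  have hBU : U s ≤ B U s := by
    refine iSup_le fun n => ?_
    cases n with
    | zero => exact zero_le
    | succ n => rw [us]; exact hBmono (uU n) s
  have h := hB1 U s
  cases opt
  · obtain ⟨a, ha, h⟩ := h
    exact ⟨a, ha, fun p hp => hBU.trans (h p hp)⟩
  · intro a ha
    obtain ⟨p, hp, h⟩ := h a ha
    exact ⟨p, hp, hBU.trans h⟩

end Policies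

end RMDP

/-! ### End components -/

lemma reflTransGen_mono {α : Type*} {r q : α → α → Prop} (h : ∀ a b, r a b → q a b) {a b : α}
    (hab : Relation.ReflTransGen r a b) : Relation.ReflTransGen q a b :=
  Relation.ReflTransGen.mono h a b hab

namespace RMDP

variable {S A : Type*} [Fintype S] {M : RMDP S A}

lemma ConstantSupport.succ_eq (hcs : M.ConstantSupport) {s : S} {a : A} {p : stdSimplex ℝ S}
    (hp : p ∈ M.unc s a) : M.succ s a = distSupport p := by
  ext t
  constructor
  · rintro ⟨q, hq, ht⟩
    rwa [hcs s a p hp q hq]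
  · exact fun ht => ⟨p, hp, ht⟩

lemma succ_nonempty {s : S} {a : A} (ha : a ∈ M.avail s) : (M.succ s a).Nonempty := by
  obtain ⟨p, hp⟩ := ha
  by_contra h
  rw [Set.not_nonempty_iff_eq_empty] at h
  have h0 : ∀ t, p t = 0 := fun t => by
    refine le_antisymm (not_lt.1 fun ht => ?_) (p.2.1 t)
    have : t ∈ M.succ s a := ⟨p, hp, ht⟩
    rw [h] at this
    exact this
  have h1 : ∑ t, p t = 1 := p.2.2
  simp [h0] at h1

/-- The graph on states whose edges are the transitions of the pairs in `R`. -/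
def edge (M : RMDP S A) (R : Set (S × A)) (u v : S) : Prop := ∃ a, (u, a) ∈ R ∧ v ∈ M.succ u a

lemma edge_mono {R R' : Set (S × A)} (h : R ⊆ R') {u v : S} (huv : M.edge R u v) :
    M.edge R' u v := by
  obtain ⟨a, ha, hv⟩ := huv
  exact ⟨a, h ha, hv⟩

/-- With constant supports, a pair that can be kept inside a set is surely kept inside it. -/
lemma isEndComponent_iff (hcs : M.ConstantSupport) (E : Set S × Set (S × A)) :
    M.IsEndComponent E ↔ E.1.Nonempty ∧ E.2.Nonempty ∧
      (∀ s a, (s, a) ∈ E.2 → s ∈ E.1 ∧ a ∈ M.avail s ∧ M.succ s a ⊆ E.1) ∧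
      ∀ s ∈ E.1, ∀ t ∈ E.1, Relation.ReflTransGen (M.edge E.2) s t := by
  constructor
  · rintro ⟨h1, h2, h3, h4, h5⟩
    refine ⟨h1, h2, fun s a h => ⟨(h3 s a h).1, (h3 s a h).2, ?_⟩, fun s hs t ht =>
      reflTransGen_mono (fun u v h => h.2) (h5 s hs t ht)⟩
    obtain ⟨p, hp, hpT⟩ := h4 s a h
    rwa [hcs.succ_eq hp]
  · rintro ⟨h1, h2, h3, h4⟩
    refine ⟨h1, h2, fun s a h => ⟨(h3 s a h).1, (h3 s a h).2.1⟩, fun s a h => ?_,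
      fun s hs t ht => reflTransGen_mono ?_ (h4 s hs t ht)⟩
    · obtain ⟨p, hp⟩ := (h3 s a h).2.1
      refine ⟨p, hp, ?_⟩
      rw [← hcs.succ_eq hp]
      exact (h3 s a h).2.2
    · rintro u v ⟨a, ha, hv⟩
      exact ⟨(h3 u a ha).2.2 hv, a, ha, hv⟩

/-- A nonempty set `Z` of states in which the agent can remain with the pairs of `R` contains an end
component: a bottom strongly connected component of the graph of `R` on `Z`. -/
theorem exists_isEndComponent_subset (hcs : M.ConstantSupport) {Z : Set S} (hZ : Z.Nonempty)
    {R : Set (S × A)} (hR : ∀ s ∈ Z, ∀ a, (s, a) ∈ R → a ∈ M.avail s ∧ M.succ s a ⊆ Z)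
    (hne : ∀ s ∈ Z, ∃ a, (s, a) ∈ R) :
    ∃ T ⊆ Z, M.IsEndComponent (T, {x ∈ R | x.1 ∈ T}) := by
  let reach : S → Set S := fun s => {t | Relation.ReflTransGen (M.edge R) s t}
  obtain ⟨s, hs, hmin⟩ := Set.exists_min_image Z (fun s => (reach s).ncard) (Set.toFinite _) hZ
  have hsub : ∀ t, Relation.ReflTransGen (M.edge R) s t → t ∈ Z := by
    intro t ht
    induction ht with
    | refl => exact hs
    | tail _ huv ih =>
      obtain ⟨a, ha, hv⟩ := huv
      exact (hR _ ih a ha).2 hv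
  -- the reachable set of `s` is smallest possible, so each of its members reaches all of it
  have heq : ∀ t, Relation.ReflTransGen (M.edge R) s t → reach t = reach s := fun t ht =>
    Set.eq_of_subset_of_ncard_le (fun u hu => ht.trans hu) (hmin t (hsub t ht)) (Set.toFinite _)
  have hstep : ∀ u, Relation.ReflTransGen (M.edge R) s u → ∀ a, (u, a) ∈ R →
      M.succ u a ⊆ reach s := fun u hu a ha v hv => hu.tail ⟨a, ha, hv⟩
  refine ⟨reach s, hsub, (isEndComponent_iff hcs _).2 ⟨⟨s, .refl⟩, ?_, ?_, ?_⟩⟩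
  · obtain ⟨a, ha⟩ := hne s hs
    exact ⟨(s, a), ha, .refl⟩
  · rintro u a ⟨ha, hu⟩
    exact ⟨hu, (hR u (hsub u hu) a ha).1, hstep u hu a ha⟩
  · intro u hu v hv
    have hv' : v ∈ reach u := by rw [heq u hu]; exact hv
    have key : ∀ w, Relation.ReflTransGen (M.edge R) u w →
        Relation.ReflTransGen (M.edge {x ∈ R | x.1 ∈ reach s}) u w := by
      intro w hw
      induction hw with
      | refl => exact .refl
      | tail huw hwx ih =>
        obtain ⟨a, ha, hx⟩ := hwx
        exact ih.tail ⟨a, ⟨ha, Relation.ReflTransGen.trans hu huw⟩, hx⟩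
    exact key v hv'

/-- In an end component every state has a pair. -/
lemma IsEndComponent.exists_pair {E : Set S × Set (S × A)} (h : M.IsEndComponent E)
    {s : S} (hs : s ∈ E.1) : ∃ a, (s, a) ∈ E.2 := by
  obtain ⟨⟨u, a⟩, hua⟩ := h.2.1
  rcases (h.2.2.2.2 s hs u (h.2.2.1 u a hua).1).cases_head with rfl | ⟨v, ⟨_, b, hb, _⟩, _⟩
  · exact ⟨a, hua⟩
  · exact ⟨b, hb⟩

/-! ### Zero-reward maximal end components -/

lemma IsZeroEC.union (hcs : M.ConstantSupport) {E F : Set S × Set (S × A)} (hE : M.IsZeroEC E)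
    (hF : M.IsZeroEC F) {s : S} (hsE : s ∈ E.1) (hsF : s ∈ F.1) : M.IsZeroEC (E ⊔ F) := by
  obtain ⟨hE, hE0⟩ := hE
  obtain ⟨hF, hF0⟩ := hF
  rw [isEndComponent_iff hcs] at hE hF
  obtain ⟨E1, E2, E3, E4⟩ := hE
  obtain ⟨F1, F2, F3, F4⟩ := hF
  refine ⟨(isEndComponent_iff hcs _).2 ⟨E1.inl, E2.inl, ?_, ?_⟩, ?_⟩
  · rintro u a (h | h)
    · exact ⟨.inl (E3 u a h).1, (E3 u a h).2.1, fun x hx => .inl ((E3 u a h).2.2 hx)⟩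
    · exact ⟨.inr (F3 u a h).1, (F3 u a h).2.1, fun x hx => .inr ((F3 u a h).2.2 hx)⟩
  · have lE : ∀ u v, Relation.ReflTransGen (M.edge E.2) u v →
        Relation.ReflTransGen (M.edge (E ⊔ F).2) u v := fun u v h =>
      reflTransGen_mono (fun _ _ => edge_mono Set.subset_union_left) h
    have lF : ∀ u v, Relation.ReflTransGen (M.edge F.2) u v →
        Relation.ReflTransGen (M.edge (E ⊔ F).2) u v := fun u v h =>
      reflTransGen_mono (fun _ _ => edge_mono Set.subset_union_right) h
    rintro u (hu | hu) v (hv | hv)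
    · exact lE _ _ (E4 u hu v hv)
    · exact (lE _ _ (E4 u hu s hsE)).trans (lF _ _ (F4 s hsF v hv))
    · exact (lF _ _ (F4 u hu s hsF)).trans (lE _ _ (E4 s hsE v hv))
    · exact lF _ _ (F4 u hu v hv)
  · rintro u a (h | h)
    · exact hE0 u a h
    · exact hF0 u a h

lemma ZeroMEC.eq_of_mem (hcs : M.ConstantSupport) {E F : M.ZeroMEC} {s : S} (hE : s ∈ E.states)
    (hF : s ∈ F.states) : E = F := by
  have hU := IsZeroEC.union hcs E.2.prop F.2.prop hE hF
  exact Subtype.ext ((E.2.eq_of_le hU le_sup_left).trans (F.2.eq_of_le hU le_sup_right).symm)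

lemma IsZeroEC.exists_zeroMEC [Finite A] {E : Set S × Set (S × A)} (hE : M.IsZeroEC E) :
    ∃ F : M.ZeroMEC, E ≤ F.1 := by
  obtain ⟨F, hEF, hF⟩ := (Set.toFinite {E | M.IsZeroEC E}).exists_le_maximal hE
  exact ⟨⟨F, hF⟩, hEF⟩

lemma proj_eq_rep (hcs : M.ConstantSupport) {E : M.ZeroMEC} {s : S} (hs : s ∈ E.states) :
    M.proj s = .rep E := by
  have h : ∃ E : M.ZeroMEC, s ∈ E.states := ⟨E, hs⟩
  rw [proj, dif_pos h, ZeroMEC.eq_of_mem hcs h.choose_spec hs]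

lemma proj_eq_keep {s : S} (hs : ∀ E : M.ZeroMEC, s ∉ E.states) : M.proj s = .keep s hs := by
  rw [proj, dif_neg (not_exists.2 hs)]

lemma proj_ne_sink (s : S) : M.proj s ≠ .sink := by
  unfold proj
  split_ifs <;> simp

lemma eq_of_proj_eq_keep {s t : S} {hs : ∀ E : M.ZeroMEC, s ∉ E.states}
    (h : M.proj t = .keep s hs) : t = s := by
  unfold proj at h
  split_ifs at h
  exact (CState.keep.inj h)

lemma mem_of_proj_eq_rep {t : S} {E : M.ZeroMEC} (h : M.proj t = .rep E) : t ∈ E.states := by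
  unfold proj at h
  split_ifs at h with h'
  rw [← CState.rep.inj h]
  exact h'.choose_spec

lemma ZeroMEC.nonempty (E : M.ZeroMEC) : E.states.Nonempty := E.2.prop.1.1

lemma ZeroMEC.exists_staying (E : M.ZeroMEC) {s : S} (hs : s ∈ E.states) :
    ∃ a, (s, a) ∈ E.staying := E.2.prop.1.exists_pair hs

lemma ZeroMEC.mem_states (E : M.ZeroMEC) {s : S} {a : A} (h : (s, a) ∈ E.staying) :
    s ∈ E.states := (E.2.prop.1.2.2.1 s a h).1

lemma ZeroMEC.mem_avail (E : M.ZeroMEC) {s : S} {a : A} (h : (s, a) ∈ E.staying) :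
    a ∈ M.avail s := (E.2.prop.1.2.2.1 s a h).2

lemma ZeroMEC.reward_eq_zero (E : M.ZeroMEC) {s : S} {a : A} (h : (s, a) ∈ E.staying) :
    M.reward s a = 0 := E.2.prop.2 s a h

lemma ZeroMEC.succ_subset (hcs : M.ConstantSupport) (E : M.ZeroMEC) {s : S} {a : A}
    (h : (s, a) ∈ E.staying) : M.succ s a ⊆ E.states :=
  (((isEndComponent_iff hcs _).1 E.2.prop.1).2.2.1 s a h).2.2

lemma ZeroMEC.connected (hcs : M.ConstantSupport) (E : M.ZeroMEC) {s t : S}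
    (hs : s ∈ E.states) (ht : t ∈ E.states) :
    Relation.ReflTransGen (M.edge E.staying) s t :=
  ((isEndComponent_iff hcs _).1 E.2.prop.1).2.2.2 s hs t ht

/-! ### The collapsed RMDP -/

section Map

variable {X Y : Type*} [Fintype X] [Fintype Y]

lemma map_apply_eq_sum (f : X → Y) (p : stdSimplex ℝ X) (y : Y) [DecidableEq Y] :
    stdSimplex.map f p y = ∑ x with f x = y, p x := by
  rw [stdSimplex.map_coe, FunOnFinite.linearMap_apply_apply]

lemma distSupport_map (f : X → Y) (p : stdSimplex ℝ X) :
    distSupport (stdSimplex.map f p) = f '' distSupport p := by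
  classical
  ext y
  have h0 : ∀ x ∈ Finset.univ.filter (fun x => f x = y), 0 ≤ p x := fun x _ => p.2.1 x
  change 0 < stdSimplex.map f p y ↔ _
  rw [map_apply_eq_sum, Finset.sum_pos_iff_of_nonneg h0]
  simp only [Finset.mem_filter, Finset.mem_univ, true_and, Set.mem_image]
  exact exists_congr fun x => and_comm

lemma distAvg_map (f : X → Y) (p : stdSimplex ℝ X) (W : Y → ℝ≥0∞) :
    distAvg (stdSimplex.map f p) W = distAvg p fun x => W (f x) := by
  classical
  have h0 : ∀ y, ∀ x ∈ Finset.univ.filter (fun x => f x = y), 0 ≤ p x := fun _ x _ => p.2.1 x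
  have h : ∀ y, ENNReal.ofReal (stdSimplex.map f p y) * W y =
      ∑ x with f x = y, ENNReal.ofReal (p x) * W (f x) := by
    intro y
    rw [map_apply_eq_sum, ENNReal.ofReal_sum_of_nonneg (h0 y), Finset.sum_mul]
    refine Finset.sum_congr rfl fun x hx => ?_
    rw [(Finset.mem_filter.1 hx).2]
  unfold distAvg
  simp only [h]
  exact Finset.sum_fiberwise _ _ _

lemma distSupport_of_eq_one {q : stdSimplex ℝ X} {x : X} (h : q x = 1) : distSupport q = {x} := by
  classical
  ext y
  change 0 < q y ↔ y = x
  constructor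
  · intro hy
    by_contra hne
    have h1 : ∑ z, q z = 1 := q.2.2
    have h2 : q x + q y ≤ ∑ z, q z := by
      rw [← Finset.sum_pair (Ne.symm hne)]
      exact Finset.sum_le_sum_of_subset_of_nonneg (Finset.subset_univ _) fun z _ _ => q.2.1 z
    rw [h1, h] at h2
    linarith
  · rintro rfl
    rw [h]
    exact one_pos

lemma distAvg_of_eq_one {q : stdSimplex ℝ X} {x : X} (h : q x = 1) (W : X → ℝ≥0∞) :
    distAvg q W = W x := by
  rw [distAvg_congr q (g := fun _ => W x), distAvg_const]
  intro t ht
  rw [distSupport_of_eq_one h] at ht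
  rw [ht]

end Map

/-- The pairs of the collapsed RMDP: `x` is a copy of the pair `(s, a)`. -/
inductive IsCopy (M : RMDP S A) : M.CState → CAction S A → S → A → Prop
  | keep (s : S) (hs : ∀ E : M.ZeroMEC, s ∉ E.states) (a : A) :
      IsCopy M (.keep s hs) (.orig a) s a
  | exit (E : M.ZeroMEC) (s : S) (a : A) (hs : s ∈ E.states) (ha : (s, a) ∉ E.staying) :
      IsCopy M (.rep E) (.exit s a) s a

/-- Every pair outside the zero-reward MECs has a copy. -/
lemma exists_isCopy (hcs : M.ConstantSupport) (s : S) (a : A)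
    (h : ∀ E : M.ZeroMEC, (s, a) ∉ E.staying) : ∃ α, M.IsCopy (M.proj s) α s a := by
  by_cases hs : ∃ E : M.ZeroMEC, s ∈ E.states
  · obtain ⟨E, hs⟩ := hs
    rw [proj_eq_rep hcs hs]
    exact ⟨_, .exit E s a hs (h E)⟩
  · rw [not_exists] at hs
    rw [proj_eq_keep hs]
    exact ⟨_, .keep s hs a⟩

lemma IsCopy.proj_eq (hcs : M.ConstantSupport) {x : M.CState} {α : CAction S A} {s : S} {a : A}
    (h : M.IsCopy x α s a) : M.proj s = x := by
  cases h with
  | keep _ hs => exact proj_eq_keep hs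
  | exit E _ _ hs ha => exact proj_eq_rep hcs hs

variable [Finite A]

lemma IsCopy.unc_eq {x : M.CState} {α : CAction S A} {s : S} {a : A} (h : M.IsCopy x α s a) :
    M.collapse.unc x α = stdSimplex.map M.proj '' M.unc s a := by
  cases h with
  | keep _ hs => rfl
  | exit E _ _ hs ha =>
    change {q | _ ∧ _ ∧ _} = _
    ext q
    simp only [Set.mem_ofPred_eq, hs, ha, not_false_eq_true, true_and]

lemma IsCopy.reward_eq {x : M.CState} {α : CAction S A} {s : S} {a : A} (h : M.IsCopy x α s a) :
    M.collapse.reward x α = M.reward s a := by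
  cases h <;> rfl

lemma IsCopy.mem_avail_iff {x : M.CState} {α : CAction S A} {s : S} {a : A}
    (h : M.IsCopy x α s a) : α ∈ M.collapse.avail x ↔ a ∈ M.avail s := by
  unfold avail
  rw [Set.mem_ofPred_eq, h.unc_eq, Set.image_nonempty]
  rfl

lemma IsCopy.succ_eq {x : M.CState} {α : CAction S A} {s : S} {a : A} (h : M.IsCopy x α s a) :
    M.collapse.succ x α = M.proj '' M.succ s a := by
  unfold succ
  rw [h.unc_eq]
  ext y
  simp only [Set.mem_ofPred_eq, Set.mem_image, exists_exists_and_eq_and, distSupport_map]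
  constructor
  · rintro ⟨p, hp, t, ht, rfl⟩
    exact ⟨t, ⟨p, hp, ht⟩, rfl⟩
  · rintro ⟨t, ⟨p, hp, ht⟩, rfl⟩
    exact ⟨p, hp, t, ht, rfl⟩

/-- The available pairs of the collapsed RMDP are copies or staying pairs. -/
lemma collapse_avail_cases {x : M.CState} {α : CAction S A} (h : α ∈ M.collapse.avail x) :
    (∃ s a, M.IsCopy x α s a) ∨ ((x = .sink ∨ ∃ E, x = .rep E) ∧ α = .stay) := by
  match x, α, h with
  | .keep s hs, .orig a, _ => exact .inl ⟨s, a, .keep s hs a⟩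
  | .rep E, .exit s a, ⟨_, hs, ha, _⟩ => exact .inl ⟨s, a, .exit E s a hs ha⟩
  | .rep E, .stay, _ => exact .inr ⟨.inr ⟨E, rfl⟩, rfl⟩
  | .sink, .stay, _ => exact .inr ⟨.inl rfl, rfl⟩

lemma collapse_unc_stay {x : M.CState} (hx : x = .sink ∨ ∃ E, x = .rep E) :
    M.collapse.unc x .stay = {q | q .sink = 1} := by
  rcases hx with rfl | ⟨E, rfl⟩ <;> rfl

lemma stay_mem_avail {x : M.CState} (hx : x = .sink ∨ ∃ E, x = .rep E) :
    .stay ∈ M.collapse.avail x := by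
  classical
  unfold avail
  rw [Set.mem_ofPred_eq, collapse_unc_stay hx]
  exact ⟨stdSimplex.vertex .sink, by simp⟩

lemma collapse_reward_stay (x : M.CState) : M.collapse.reward x .stay = 0 := by
  cases x <;> rfl

lemma collapse_succ_stay {x : M.CState} (hx : x = .sink ∨ ∃ E, x = .rep E) :
    M.collapse.succ x .stay = {.sink} := by
  obtain ⟨q, hq⟩ := stay_mem_avail hx
  unfold succ
  rw [collapse_unc_stay hx] at hq ⊢
  ext y
  constructor
  · rintro ⟨p, hp, hy⟩
    rwa [distSupport_of_eq_one hp] at hy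
  · intro hy
    exact ⟨q, hq, by rwa [distSupport_of_eq_one hq]⟩

lemma collapse_unc_cases (x : M.CState) (α : CAction S A) :
    M.collapse.unc x α = ∅ ∨ (∃ s a, M.IsCopy x α s a) ∨
      ((x = .sink ∨ ∃ E, x = .rep E) ∧ α = .stay) := by
  by_cases h : α ∈ M.collapse.avail x
  · exact .inr (collapse_avail_cases h)
  · exact .inl (Set.not_nonempty_iff_eq_empty.1 h)

lemma collapse_constantSupport (hcs : M.ConstantSupport) : M.collapse.ConstantSupport := by
  intro x α p hp q hq
  rcases collapse_unc_cases x α with h | ⟨s, a, h⟩ | ⟨h, rfl⟩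
  · rw [h] at hp
    exact absurd hp (Set.notMem_empty _)
  · rw [h.unc_eq] at hp hq
    obtain ⟨p, hp, rfl⟩ := hp
    obtain ⟨q, hq, rfl⟩ := hq
    rw [distSupport_map, distSupport_map, hcs s a p hp q hq]
  · rw [collapse_unc_stay h] at hp hq
    rw [distSupport_of_eq_one hp, distSupport_of_eq_one hq]

lemma continuous_stdSimplex_apply {X : Type*} [Fintype X] (x : X) :
    Continuous fun p : stdSimplex ℝ X => p x :=
  (continuous_apply x).comp continuous_subtype_val

lemma collapse_isClosed (hM : M.IsClosedRMDP) : M.collapse.IsClosedRMDP := by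
  intro x α
  rcases collapse_unc_cases x α with h | ⟨s, a, h⟩ | ⟨h, rfl⟩
  · rw [h]
    exact isClosed_empty
  · rw [h.unc_eq]
    exact ((hM s a).isCompact.image (stdSimplex.continuous_map _)).isClosed
  · rw [collapse_unc_stay h]
    exact isClosed_eq (continuous_stdSimplex_apply _) continuous_const

/-- The states and pairs of `M` that a zero-reward end component of the collapsed RMDP stands for,
including all of the collapsed MECs in it, form a zero-reward end component of `M`. By maximality
it adds nothing to a zero-reward MEC, so it can only come from the sink. -/
theorem sink_mem_of_isZeroEC (hcs : M.ConstantSupport)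
    {E : Set M.CState × Set (M.CState × CAction S A)} (hE : M.collapse.IsZeroEC E) :
    .sink ∈ E.1 := by
  by_contra hsink
  obtain ⟨hE, hE0⟩ := hE
  have hE' := (isEndComponent_iff (collapse_constantSupport hcs) _).1 hE
  obtain ⟨⟨x₀, hx₀⟩, ⟨⟨x₁, α₁⟩, hx₁⟩, hpair, hconn⟩ := hE'
  have hcopy : ∀ x α, (x, α) ∈ E.2 → ∃ s a, M.IsCopy x α s a := by
    intro x α h
    obtain ⟨_, h2, h3⟩ := hpair x α h
    rcases collapse_avail_cases h2 with h' | ⟨h', rfl⟩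
    · exact h'
    · rw [collapse_succ_stay h'] at h3
      exact absurd (h3 rfl) hsink
  let T : Set S := {s | M.proj s ∈ E.1}
  let R : Set (S × A) := {x | (∃ y α, (y, α) ∈ E.2 ∧ M.IsCopy y α x.1 x.2) ∨
    ∃ F : M.ZeroMEC, .rep F ∈ E.1 ∧ x ∈ F.staying}
  -- states represented by the same collapsed state are connected
  have hclass : ∀ s t, M.proj s ∈ E.1 → M.proj s = M.proj t →
      Relation.ReflTransGen (M.edge R) s t := by
    intro s t hs hst
    by_cases h : ∃ F : M.ZeroMEC, s ∈ F.states
    · obtain ⟨F, hF⟩ := h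
      have hp := proj_eq_rep hcs hF
      have ht : t ∈ F.states := mem_of_proj_eq_rep (hst.symm.trans hp)
      rw [hp] at hs
      exact reflTransGen_mono (fun _ _ => edge_mono fun x hx => .inr ⟨F, hs, hx⟩)
        (F.connected hcs hF ht)
    · rw [not_exists] at h
      rw [proj_eq_keep h] at hst
      rw [eq_of_proj_eq_keep hst.symm]
  have hpath : ∀ x y, Relation.ReflTransGen (M.collapse.edge E.2) x y →
      ∀ s t, M.proj s = x → M.proj t = y → M.proj s ∈ E.1 →
        Relation.ReflTransGen (M.edge R) s t := by
    intro x y hxy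
    induction hxy with
    | refl => exact fun s t hs ht hsE => hclass s t hsE (hs.trans ht.symm)
    | tail _ hyz ih =>
      intro s t hs ht hsE
      obtain ⟨α, hα, hz⟩ := hyz
      obtain ⟨u, a, hua⟩ := hcopy _ _ hα
      rw [hua.succ_eq] at hz
      obtain ⟨v, hv, hvz⟩ := hz
      refine (ih s u hs (hua.proj_eq hcs) hsE).trans (.head ⟨a, .inl ⟨_, _, hα, hua⟩, hv⟩ ?_)
      refine hclass v t ?_ (hvz.trans ht.symm)
      refine (hpair _ _ hα).2.2 ?_
      rw [hua.succ_eq]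
      exact ⟨v, hv, rfl⟩
  obtain ⟨s₁, a₁, h₁⟩ := hcopy _ _ hx₁
  have hs₁ : M.proj s₁ ∈ E.1 := by rw [h₁.proj_eq hcs]; exact (hpair _ _ hx₁).1
  have hzero : M.IsZeroEC (T, R) := by
    refine ⟨(isEndComponent_iff hcs _).2 ⟨⟨s₁, hs₁⟩, ⟨(s₁, a₁), .inl ⟨_, _, hx₁, h₁⟩⟩, ?_, ?_⟩, ?_⟩
    · rintro s a (⟨y, α, hα, h⟩ | ⟨F, hF, h⟩)
      · obtain ⟨p1, p2, p3⟩ := hpair _ _ hα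
        refine ⟨?_, h.mem_avail_iff.1 p2, ?_⟩
        · change M.proj s ∈ E.1
          rw [h.proj_eq hcs]; exact p1
        · intro t ht
          refine p3 ?_
          rw [h.succ_eq]
          exact ⟨t, ht, rfl⟩
      · refine ⟨?_, F.mem_avail h, fun t ht => ?_⟩
        · change M.proj s ∈ E.1
          rw [proj_eq_rep hcs (F.mem_states h)]; exact hF
        · change M.proj t ∈ E.1
          rw [proj_eq_rep hcs (F.succ_subset hcs h ht)]; exact hF
    · exact fun s hs t ht => hpath _ _ (hconn _ hs _ ht) s t rfl rfl hs
    · rintro s a (⟨y, α, hα, h⟩ | ⟨F, hF, h⟩)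
      · rw [← h.reward_eq]
        exact hE0 _ _ hα
      · exact F.reward_eq_zero h
  obtain ⟨F, hF⟩ := hzero.exists_zeroMEC
  have hsF : s₁ ∈ F.states := hF.1 hs₁
  have haF : (s₁, a₁) ∈ F.staying := hF.2 (.inl ⟨_, _, hx₁, h₁⟩)
  cases h₁ with
  | keep _ hs => exact hs F hsF
  | exit G _ _ hs ha =>
    rw [ZeroMEC.eq_of_mem hcs hs hsF] at ha
    exact ha haF

end RMDP

/-! ### Collapsing preserves the values -/

lemma distAvg_eq_of_le {S : Type*} [Fintype S] {p : stdSimplex ℝ S} {f : S → ℝ≥0∞} {m : ℝ≥0∞}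
    (hm : m ≠ ⊤) (hf : ∀ t ∈ distSupport p, m ≤ f t) (h : distAvg p f ≤ m) :
    ∀ t ∈ distSupport p, f t = m := by
  have h1 : distAvg p f = distAvg p (fun _ => m) + distAvg p (fun t => f t - m) := by
    unfold distAvg
    rw [← Finset.sum_add_distrib]
    refine Finset.sum_congr rfl fun t _ => ?_
    rw [← mul_add]
    by_cases ht : 0 < p t
    · rw [add_tsub_cancel_of_le (hf t ht)]
    · rw [ENNReal.ofReal_of_nonpos (not_lt.1 ht), zero_mul, zero_mul]
  rw [h1, distAvg_const] at h
  have h2 : distAvg p (fun t => f t - m) = 0 := by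
    have h3 : m + distAvg p (fun t => f t - m) ≤ m + 0 := by rwa [add_zero]
    exact le_antisymm ((ENNReal.add_le_add_iff_left hm).1 h3) zero_le
  intro t ht
  have h4 := (Finset.sum_eq_zero_iff.1 h2) t (Finset.mem_univ t)
  rcases mul_eq_zero.1 h4 with h5 | h5
  · exact absurd h5 (ENNReal.ofReal_pos.2 ht).ne'
  · exact le_antisymm (tsub_eq_zero_iff_le.1 h5) (hf t ht)

namespace RMDP

variable {S A : Type*} [Fintype S] {M : RMDP S A} {opt : Opt}

lemma UpdateLe.mono {W W' : S → ℝ≥0∞} {s : S} {v : ℝ≥0∞} (h : M.UpdateLe opt W s v)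
    (hW : ∀ t, W' t ≤ W t) : M.UpdateLe opt W' s v := by
  cases opt
  · intro a ha
    obtain ⟨p, hp, h⟩ := h a ha
    exact ⟨p, hp, (add_le_add_right (distAvg_mono p hW) _).trans h⟩
  · obtain ⟨a, ha, h⟩ := h
    exact ⟨a, ha, fun p hp => (add_le_add_right (distAvg_mono p hW) _).trans (h p hp)⟩

lemma proj_surjective_of_ne_sink (hcs : M.ConstantSupport) {x : M.CState} (hx : x ≠ .sink) :
    ∃ s, M.proj s = x := by
  match x, hx with
  | .keep s hs, _ => exact ⟨s, proj_eq_keep hs⟩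
  | .rep E, _ => exact ⟨E.nonempty.some, proj_eq_rep hcs E.nonempty.some_mem⟩

variable [Finite A]

lemma value_terminal (hM : M.IsClosedRMDP) (hcs : M.ConstantSupport) {s : S}
    (hs : M.IsTerminal s) : M.value opt s = 0 := by
  classical
  have key : ∀ t, M.UpdateLe opt (Function.update (M.value opt) s 0) t
      (Function.update (M.value opt) s 0 t) := by
    intro t
    by_cases ht : t = s
    · subst ht
      have h0 : ∀ a ∈ M.avail t, ∀ p ∈ M.unc t a, (M.reward t a : ℝ≥0∞) +
          distAvg p (Function.update (M.value opt) t 0) ≤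
            Function.update (M.value opt) t 0 t := by
        intro a ha p hp
        rw [(hs a ha).1, distAvg_of_eq_one ((hs a ha).2 p hp)]
        simp
      cases opt
      · intro a ha
        exact ⟨ha.some, ha.some_mem, h0 a ha _ ha.some_mem⟩
      · obtain ⟨a, ha⟩ := M.exists_avail t
        exact ⟨a, ha, h0 a ha⟩
    · rw [Function.update_of_ne ht]
      refine (value_fixpoint hM hcs opt t).2.mono fun u => ?_
      by_cases hu : u = s
      · rw [hu, Function.update_self]; exact zero_le
      · rw [Function.update_of_ne hu]
  have h := value_le_of_updateLe key s
  rw [Function.update_self] at h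
  exact le_antisymm h zero_le

lemma isTerminal_sink : M.collapse.IsTerminal .sink := by
  intro α hα
  rcases collapse_avail_cases hα with ⟨s, a, h⟩ | ⟨h, rfl⟩
  · cases h
  · refine ⟨collapse_reward_stay _, fun p hp => ?_⟩
    rwa [collapse_unc_stay h] at hp

/-- When maximizing, the value is constant on a zero-reward MEC: the states of minimal value
are closed under the staying pairs. -/
lemma value_max_eq_on_zeroMEC (hM : M.IsClosedRMDP) (hcs : M.ConstantSupport) (E : M.ZeroMEC)
    {s t : S} (hs : s ∈ E.states) (ht : t ∈ E.states) : M.value .max s = M.value .max t := by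
  obtain ⟨u, hu, hmin⟩ := Set.exists_min_image E.states (M.value .max) (Set.toFinite _) E.nonempty
  by_cases htop : M.value .max u = ⊤
  · have h : ∀ w ∈ E.states, M.value .max w = ⊤ := fun w hw => top_le_iff.1 (htop ▸ hmin w hw)
    rw [h s hs, h t ht]
  · have key : ∀ w, Relation.ReflTransGen (M.edge E.staying) u w →
        M.value .max w = M.value .max u := by
      intro w hw
      induction hw with
      | refl => rfl
      | tail _ hxy ih =>
        obtain ⟨a, ha, hy⟩ := hxy
        obtain ⟨p, hp, h⟩ := (value_fixpoint hM hcs .max _).2 a (E.mem_avail ha)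
        rw [E.reward_eq_zero ha, Nat.cast_zero, zero_add, ih] at h
        rw [hcs.succ_eq hp] at hy
        refine distAvg_eq_of_le htop (fun x hx => hmin x ?_) h _ hy
        rw [← hcs.succ_eq hp] at hx
        exact E.succ_subset hcs ha hx
    rw [key s (E.connected hcs hu hs), key t (E.connected hcs hu ht)]

/-- When minimizing, the value is zero on a zero-reward MEC: replacing it by zero there leaves it
above its Bellman update. -/
lemma value_min_eq_zero_on_zeroMEC (hM : M.IsClosedRMDP) (hcs : M.ConstantSupport)
    (E : M.ZeroMEC) {s : S} (hs : s ∈ E.states) : M.value .min s = 0 := by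
  classical
  have key : ∀ t, M.UpdateLe .min (fun t => if t ∈ E.states then 0 else M.value .min t) t
      (if t ∈ E.states then 0 else M.value .min t) := by
    intro t
    by_cases ht : t ∈ E.states
    · obtain ⟨a, ha⟩ := E.exists_staying ht
      refine ⟨a, E.mem_avail ha, fun p hp => ?_⟩
      rw [if_pos ht, E.reward_eq_zero ha, distAvg_congr p (g := fun _ => 0), distAvg_const]
      · simp
      · intro u hu
        rw [← hcs.succ_eq hp] at hu
        exact if_pos (E.succ_subset hcs ha hu)
    · rw [if_neg ht]
      refine (value_fixpoint hM hcs .min t).2.mono fun u => ?_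
      split_ifs
      · exact zero_le
      · exact le_rfl
  have h := value_le_of_updateLe key s
  rw [if_pos hs] at h
  exact le_antisymm h zero_le

lemma value_eq_of_proj_eq (hM : M.IsClosedRMDP) (hcs : M.ConstantSupport) (opt : Opt) {s t : S}
    (h : M.proj s = M.proj t) : M.value opt s = M.value opt t := by
  by_cases hs : ∃ E : M.ZeroMEC, s ∈ E.states
  · obtain ⟨E, hs⟩ := hs
    have ht : t ∈ E.states := mem_of_proj_eq_rep (h.symm.trans (proj_eq_rep hcs hs))
    cases opt
    · exact value_max_eq_on_zeroMEC hM hcs E hs ht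
    · rw [value_min_eq_zero_on_zeroMEC hM hcs E hs, value_min_eq_zero_on_zeroMEC hM hcs E ht]
  · rw [not_exists] at hs
    rw [proj_eq_keep hs] at h
    rw [eq_of_proj_eq_keep h.symm]

/-- The value of the collapsed RMDP, as a function on the original states, is at least its Bellman
update: staying pairs only average equal values, and all other pairs have a copy. -/
lemma value_le_value_collapse (hM : M.IsClosedRMDP) (hcs : M.ConstantSupport) (opt : Opt)
    (s : S) : M.value opt s ≤ M.collapse.value opt (M.proj s) := by
  refine value_le_of_updateLe (W := fun s => M.collapse.value opt (M.proj s)) (fun s => ?_) s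
  have hfix := (value_fixpoint (collapse_isClosed hM) (collapse_constantSupport hcs) opt
    (M.proj s)).2
  have hstay : ∀ (E : M.ZeroMEC) a, (s, a) ∈ E.staying → ∀ p ∈ M.unc s a,
      (M.reward s a : ℝ≥0∞) + distAvg p (fun s => M.collapse.value opt (M.proj s)) ≤
        M.collapse.value opt (M.proj s) := by
    intro E a ha p hp
    rw [E.reward_eq_zero ha, proj_eq_rep hcs (E.mem_states ha),
      distAvg_congr p (g := fun _ => M.collapse.value opt (.rep E)), distAvg_const]
    · simp
    · intro u hu
      rw [← hcs.succ_eq hp] at hu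
      rw [proj_eq_rep hcs (E.succ_subset hcs ha hu)]
  cases opt
  · intro a ha
    by_cases h : ∃ E : M.ZeroMEC, (s, a) ∈ E.staying
    · obtain ⟨E, h⟩ := h
      exact ⟨ha.some, ha.some_mem, hstay E a h _ ha.some_mem⟩
    · rw [not_exists] at h
      obtain ⟨α, hα⟩ := exists_isCopy hcs s a h
      obtain ⟨q, hq, h'⟩ := hfix α (hα.mem_avail_iff.2 ha)
      rw [hα.unc_eq] at hq
      obtain ⟨p, hp, rfl⟩ := hq
      rw [hα.reward_eq, distAvg_map] at h'
      exact ⟨p, hp, h'⟩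
  · by_cases h : ∃ E : M.ZeroMEC, s ∈ E.states
    · obtain ⟨E, h⟩ := h
      obtain ⟨a, ha⟩ := E.exists_staying h
      exact ⟨a, E.mem_avail ha, hstay E a ha⟩
    · rw [not_exists] at h
      obtain ⟨α, hα, h'⟩ := hfix
      rw [proj_eq_keep h] at hα h'
      rcases collapse_avail_cases hα with ⟨t, a, hc⟩ | ⟨h1 | ⟨E, h1⟩, rfl⟩
      · have hts := hc.proj_eq hcs
        rw [eq_of_proj_eq_keep hts] at hc
        refine ⟨a, hc.mem_avail_iff.1 hα, fun p hp => ?_⟩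
        have h2 := h' (stdSimplex.map M.proj p) (by rw [hc.unc_eq]; exact ⟨p, hp, rfl⟩)
        rw [hc.reward_eq, distAvg_map] at h2
        rwa [proj_eq_keep h]
      · cases h1
      · cases h1

/-- The value, which is constant on the collapsed classes, becomes a function on the collapsed
states that is at least its Bellman update if it is extended by zero to the sink. -/
lemma value_collapse_le_value (hM : M.IsClosedRMDP) (hcs : M.ConstantSupport) (opt : Opt)
    (s : S) : M.collapse.value opt (M.proj s) ≤ M.value opt s := by
  have hW : ∃ W : M.CState → ℝ≥0∞, W .sink = 0 ∧ ∀ s, W (M.proj s) = M.value opt s := by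
    classical
    refine ⟨fun x => if h : ∃ s, M.proj s = x then M.value opt h.choose else 0, ?_, fun s => ?_⟩
    · exact dif_neg fun ⟨s, hs⟩ => proj_ne_sink s hs
    · have h : ∃ t, M.proj t = M.proj s := ⟨s, rfl⟩
      change dite _ _ _ = _
      rw [dif_pos h]
      exact value_eq_of_proj_eq hM hcs opt h.choose_spec
  obtain ⟨W, hW0, hW⟩ := hW
  have havg : ∀ p : stdSimplex ℝ S, distAvg (stdSimplex.map M.proj p) W =
      distAvg p (M.value opt) := fun p => by
    rw [distAvg_map]
    simp only [hW]
  rw [← hW]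
  refine value_le_of_updateLe (fun x => ?_) _
  have hstay : (x = .sink ∨ ∃ E, x = .rep E) → ∀ q ∈ M.collapse.unc x .stay,
      (M.collapse.reward x .stay : ℝ≥0∞) + distAvg q W ≤ W x := by
    intro hx q hq
    rw [collapse_unc_stay hx] at hq
    rw [collapse_reward_stay, distAvg_of_eq_one hq, hW0]
    simp
  cases opt
  · intro α hα
    rcases collapse_avail_cases hα with ⟨t, a, hc⟩ | ⟨hx, rfl⟩
    · obtain ⟨p, hp, h⟩ := (value_fixpoint hM hcs .max t).2 a (hc.mem_avail_iff.1 hα)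
      refine ⟨stdSimplex.map M.proj p, by rw [hc.unc_eq]; exact ⟨p, hp, rfl⟩, ?_⟩
      rw [hc.reward_eq, havg, ← hc.proj_eq hcs, hW]
      exact h
    · exact ⟨hα.some, hα.some_mem, hstay hx _ hα.some_mem⟩
  · by_cases hx : x = .sink ∨ ∃ E, x = .rep E
    · exact ⟨.stay, stay_mem_avail hx, hstay hx⟩
    · match x, hx with
      | .keep t ht, _ =>
        obtain ⟨a, ha, h⟩ := (value_fixpoint hM hcs .min t).2
        have hc := IsCopy.keep (M := M) t ht a
        refine ⟨.orig a, hc.mem_avail_iff.2 ha, fun q hq => ?_⟩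
        rw [hc.unc_eq] at hq
        obtain ⟨p, hp, rfl⟩ := hq
        rw [hc.reward_eq, havg, ← hc.proj_eq hcs, hW]
        exact h p hp
      | .rep E, hx => exact absurd (.inr ⟨E, rfl⟩) hx
      | .sink, hx => exact absurd (.inl rfl) hx

/-- Collapsing preserves the values: both values are least fixpoints, and each yields a fixpoint
candidate on the other side. -/
theorem value_collapse_proj (hM : M.IsClosedRMDP) (hcs : M.ConstantSupport) (opt : Opt)
    (s : S) : M.collapse.value opt (M.proj s) = M.value opt s :=
  le_antisymm (value_collapse_le_value hM hcs opt s) (value_le_value_collapse hM hcs opt s)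

end RMDP

/-! ### Bellman updates of extended real valued functions -/

lemma EReal.coe_ennreal_sum {ι : Type*} (s : Finset ι) (f : ι → ℝ≥0∞) :
    ((∑ i ∈ s, f i : ℝ≥0∞) : EReal) = ∑ i ∈ s, (f i : EReal) := by
  classical
  induction s using Finset.induction_on with
  | empty => simp
  | insert i s hi ih => rw [Finset.sum_insert hi, Finset.sum_insert hi, EReal.coe_ennreal_add, ih]

lemma EReal.coe_real_sum {ι : Type*} (s : Finset ι) (f : ι → ℝ) :
    ((∑ i ∈ s, f i : ℝ) : EReal) = ∑ i ∈ s, (f i : EReal) := by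
  classical
  induction s using Finset.induction_on with
  | empty => simp
  | insert i s hi ih => rw [Finset.sum_insert hi, Finset.sum_insert hi, EReal.coe_add, ih]

lemma EReal.coe_ennreal_natCast (n : ℕ) : ((n : ℝ≥0∞) : EReal) = n := by
  induction n with
  | zero => simp
  | succ n ih => rw [Nat.cast_succ, Nat.cast_succ, EReal.coe_ennreal_add, ih]; rfl

lemma EReal.coe_add_coe_ennreal_inj {m : ℝ} {x y : ℝ≥0∞}
    (h : (m : EReal) + (x : EReal) = (m : EReal) + (y : EReal)) : x = y :=
  EReal.coe_ennreal_eq_coe_ennreal_iff.1 ((EReal.addLECancellable_coe m).inj.1 h)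

/-- The expectation of a function that is bounded below by a real number `m`. -/
lemma sum_mul_add_coe {S : Type*} [Fintype S] (p : stdSimplex ℝ S) (m : ℝ) (W : S → ℝ≥0∞) :
    ∑ t, ((p t : ℝ) : EReal) * ((m : EReal) + (W t : EReal)) = m + (distAvg p W : EReal) := by
  have h1 : ∑ t, p t = 1 := p.2.2
  have h2 : ∀ t, ((p t : ℝ) : EReal) * ((m : EReal) + (W t : EReal)) =
      ((p t * m : ℝ) : EReal) + ((ENNReal.ofReal (p t) * W t : ℝ≥0∞) : EReal) := by
    intro t
    have h0 : 0 ≤ p t := p.2.1 t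
    rw [EReal.left_distrib_of_nonneg_of_ne_top (EReal.coe_nonneg.2 h0) (EReal.coe_ne_top _),
      EReal.coe_ennreal_mul, EReal.coe_mul,
      EReal.coe_ennreal_ofReal, max_eq_left h0]
  simp only [h2]
  rw [Finset.sum_add_distrib, ← EReal.coe_ennreal_sum, ← EReal.coe_real_sum, ← Finset.sum_mul, h1,
    one_mul]
  rfl

lemma coe_le_add_iInf {ι : Type*} {K : Set ι} (r : ℕ) (x : EReal) (f : ι → EReal)
    (h : ∀ i ∈ K, x ≤ (r : EReal) + f i) : x ≤ (r : EReal) + ⨅ i ∈ K, f i := by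
  have hr : (r : EReal) = ((r : ℝ) : EReal) := rfl
  rw [hr] at h ⊢
  rw [add_comm, ← EReal.sub_le_iff_le_add (.inl (EReal.coe_ne_bot _)) (.inl (EReal.coe_ne_top _))]
  refine le_iInf₂ fun i hi => ?_
  rw [EReal.sub_le_iff_le_add (.inl (EReal.coe_ne_bot _)) (.inl (EReal.coe_ne_top _)), add_comm]
  exact h i hi

lemma add_iSup_le_coe {ι : Type*} {K : Set ι} (r : ℕ) (x : EReal) (f : ι → EReal)
    (h : ∀ i ∈ K, (r : EReal) + f i ≤ x) : (r : EReal) + ⨆ i ∈ K, f i ≤ x := by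
  have hr : (r : EReal) = ((r : ℝ) : EReal) := rfl
  rw [hr] at h ⊢
  rw [add_comm, ← EReal.le_sub_iff_add_le (.inl (EReal.coe_ne_bot _)) (.inl (EReal.coe_ne_top _))]
  refine iSup₂_le fun i hi => ?_
  rw [EReal.le_sub_iff_add_le (.inl (EReal.coe_ne_bot _)) (.inl (EReal.coe_ne_top _)), add_comm]
  exact h i hi

lemma exists_eq_coe_add {S : Type*} {m : ℝ} {V : S → EReal} (h : ∀ s, (m : EReal) ≤ V s) :
    ∃ W : S → ℝ≥0∞, V = fun s => (m : EReal) + (W s : EReal) := by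
  refine ⟨fun s => (V s - m).toENNReal, funext fun s => ?_⟩
  have h1 : (0 : EReal) ≤ V s - m := by
    rw [EReal.sub_nonneg (.inr (EReal.coe_ne_top _)) (.inr (EReal.coe_ne_bot _))]
    exact h s
  rw [EReal.coe_toENNReal h1, add_comm, EReal.sub_add_cancel]

lemma exists_coe_le {S : Type*} [Finite S] {V : S → EReal} (h : ∀ s, V s ≠ ⊥) :
    ∃ m : ℝ, ∀ s, (m : EReal) ≤ V s := by
  have h1 : ∀ s, ∃ m : ℝ, (m : EReal) ≤ V s := by
    intro s
    have h2 := h s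
    induction hV : V s with
    | bot => exact absurd hV h2
    | coe x => exact ⟨x, le_rfl⟩
    | top => exact ⟨0, le_top⟩
  choose m hm using h1
  cases isEmpty_or_nonempty S
  · exact ⟨0, fun s => isEmptyElim s⟩
  · obtain ⟨s₀, hs₀⟩ := Finite.exists_min m
    exact ⟨m s₀, fun s => (EReal.coe_le_coe_iff.2 (hs₀ s)).trans (hm s)⟩

namespace RMDP

variable {S A : Type*} [Fintype S] {M : RMDP S A} {opt : Opt}

/-- The Bellman operator on extended real valued functions bounded below by `m`, in terms of the
updates of nonnegative functions. -/
lemma bellman_add_coe (m : ℝ) {W : S → ℝ≥0∞} {s : S} {v : ℝ≥0∞} (h1 : M.LeUpdate opt W s v)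
    (h2 : M.UpdateLe opt W s v) :
    M.bellman opt (fun t => (m : EReal) + (W t : EReal)) s = (m : EReal) + (v : EReal) := by
  have key : ∀ a (p : stdSimplex ℝ S), (M.reward s a : EReal) +
      ∑ t, ((p t : ℝ) : EReal) * ((m : EReal) + (W t : EReal)) =
        (m : EReal) + (((M.reward s a : ℝ≥0∞) + distAvg p W : ℝ≥0∞) : EReal) := by
    intro a p
    rw [sum_mul_add_coe, EReal.coe_ennreal_add, EReal.coe_ennreal_natCast]
    exact add_left_comm _ _ _
  have hmono : ∀ {x y : ℝ≥0∞}, x ≤ y → (m : EReal) + (x : EReal) ≤ (m : EReal) + (y : EReal) :=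
    fun h => add_le_add_right (EReal.coe_ennreal_le_coe_ennreal_iff.2 h) _
  cases opt
  · refine le_antisymm (iSup₂_le fun a ha => ?_) ?_
    · obtain ⟨p, hp, h⟩ := h2 a ha
      refine (add_le_add_right (iInf₂_le p hp) _).trans ?_
      rw [key]
      exact hmono h
    · obtain ⟨a, ha, h⟩ := h1
      refine le_iSup₂_of_le a ha (coe_le_add_iInf _ _ _ fun p hp => ?_)
      rw [key]
      exact hmono (h p hp)
  · refine le_antisymm ?_ (le_iInf₂ fun a ha => ?_)
    · obtain ⟨a, ha, h⟩ := h2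
      refine iInf₂_le_of_le a ha (add_iSup_le_coe _ _ _ fun p hp => ?_)
      rw [key]
      exact hmono (h p hp)
    · obtain ⟨p, hp, h⟩ := h1 a ha
      refine le_trans ?_ (add_le_add_right (le_iSup₂ (f := fun (p : stdSimplex ℝ S)
        (_ : p ∈ M.unc s a) => ∑ t, ((p t : ℝ) : EReal) * ((m : EReal) + (W t : EReal))) p hp) _)
      rw [key]
      exact hmono h

/-! ### Uniqueness of the fixpoint -/

lemma LeUpdate.exists_pair {W v : S → ℝ≥0∞} {s : S} {x y : ℝ≥0∞} (h : M.LeUpdate opt W s x)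
    (h' : M.UpdateLe opt v s y) : ∃ a ∈ M.avail s, ∃ p ∈ M.unc s a,
      x ≤ (M.reward s a : ℝ≥0∞) + distAvg p W ∧ (M.reward s a : ℝ≥0∞) + distAvg p v ≤ y := by
  cases opt
  · obtain ⟨a, ha, h⟩ := h
    obtain ⟨p, hp, h'⟩ := h' a ha
    exact ⟨a, ha, p, hp, h p hp, h'⟩
  · obtain ⟨a, ha, h'⟩ := h'
    obtain ⟨p, hp, h⟩ := h a ha
    exact ⟨a, ha, p, hp, h, h' p hp⟩

lemma UpdateLe.exists_pair {v : S → ℝ≥0∞} {s : S} {y : ℝ≥0∞} (h' : M.UpdateLe opt v s y) :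
    ∃ a ∈ M.avail s, ∃ p ∈ M.unc s a, (M.reward s a : ℝ≥0∞) + distAvg p v ≤ y := by
  cases opt
  · obtain ⟨a, ha⟩ := M.exists_avail s
    obtain ⟨p, hp, h'⟩ := h' a ha
    exact ⟨a, ha, p, hp, h'⟩
  · obtain ⟨a, ha, h'⟩ := h'
    obtain ⟨p, hp⟩ := ha
    exact ⟨a, ⟨p, hp⟩, p, hp, h' p hp⟩

/-- If every zero-reward end component contains `z`, then so does every set in which the agent can
remain without collecting a reward. -/
lemma mem_of_trap (hcs : M.ConstantSupport) {z : S} (hz : ∀ E, M.IsZeroEC E → z ∈ E.1)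
    {Z : Set S} (hZ : Z.Nonempty)
    (h : ∀ s ∈ Z, ∃ a ∈ M.avail s, M.reward s a = 0 ∧ M.succ s a ⊆ Z) : z ∈ Z := by
  obtain ⟨T, hT, hE⟩ := exists_isEndComponent_subset hcs hZ
    (R := {x | x.2 ∈ M.avail x.1 ∧ M.reward x.1 x.2 = 0 ∧ M.succ x.1 x.2 ⊆ Z})
    (fun s _ a h => ⟨h.1, h.2.2⟩) h
  exact hT (hz _ ⟨hE, fun s a h => h.1.2.1⟩)

/-- If every zero-reward end component contains `z`, then so does every set in which the agent can
remain while a function `f`, finite on the set, does not increase by the reward collected: on the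
states of minimal `f`-value no reward is collected. -/
lemma mem_of_finite_trap (hcs : M.ConstantSupport) {z : S} (hz : ∀ E, M.IsZeroEC E → z ∈ E.1)
    {Z : Set S} (hZ : Z.Nonempty) {f : S → ℝ≥0∞} (hf : ∀ s ∈ Z, f s ≠ ⊤)
    (h : ∀ s ∈ Z, ∃ a ∈ M.avail s, ∃ p ∈ M.unc s a, distSupport p ⊆ Z ∧
      (M.reward s a : ℝ≥0∞) + distAvg p f ≤ f s) : z ∈ Z := by
  obtain ⟨s₀, hs₀, hmin⟩ := Set.exists_min_image Z f (Set.toFinite _) hZ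
  refine (mem_of_trap hcs hz (Z := {s ∈ Z | f s = f s₀}) ⟨s₀, hs₀, rfl⟩ ?_).1
  rintro s ⟨hs, hfs⟩
  obtain ⟨a, ha, p, hp, hpZ, hle⟩ := h s hs
  rw [hfs] at hle
  have h1 := distAvg_eq_of_le (hf s₀ hs₀) (fun t ht => hmin t (hpZ ht)) (le_add_self.trans hle)
  have h2 : distAvg p f = f s₀ := by
    rw [distAvg_congr p h1, distAvg_const]
  refine ⟨a, ha, ?_, ?_⟩
  · rw [h2] at hle
    have h3 : (M.reward s a : ℝ≥0∞) + f s₀ ≤ 0 + f s₀ := by rwa [zero_add]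
    exact_mod_cast le_antisymm ((ENNReal.add_le_add_iff_right (hf s₀ hs₀)).1 h3) zero_le
  · intro t ht
    rw [hcs.succ_eq hp] at ht
    exact ⟨hpZ ht, h1 t ht⟩

variable [Finite A]

/-- A fixpoint that vanishes at `z` is nonnegative: the agent can remain in the set of states where
it is minimal, without collecting a reward. -/
lemma exists_eq_coe_of_fixpoint (hM : M.IsClosedRMDP) (hcs : M.ConstantSupport) {z : S}
    (hz : ∀ E, M.IsZeroEC E → z ∈ E.1) {V : S → EReal} (hbot : ∀ s, V s ≠ ⊥) (hVz : V z = 0)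
    (hV : M.bellman opt V = V) :
    ∃ W : S → ℝ≥0∞, V = (fun s => (W s : EReal)) ∧
      ∀ s, M.LeUpdate opt W s (W s) ∧ M.UpdateLe opt W s (W s) := by
  have : Nonempty S := ⟨z⟩
  obtain ⟨s₀, hs₀⟩ := Finite.exists_min V
  have hm : ∃ m : ℝ, V s₀ = m := by
    have h1 := hbot s₀
    have h2 := hs₀ z
    rw [hVz] at h2
    induction h : V s₀ with
    | bot => exact absurd h h1
    | coe x => exact ⟨x, rfl⟩
    | top => rw [h] at h2; exact absurd (top_le_iff.1 h2) EReal.zero_ne_top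
  obtain ⟨m, hm⟩ := hm
  obtain ⟨W, rfl⟩ := exists_eq_coe_add (m := m) (V := V) fun s => hm ▸ hs₀ s
  have hW : ∀ s, M.LeUpdate opt W s (W s) ∧ M.UpdateLe opt W s (W s) := by
    intro s
    obtain ⟨v, h1, h2⟩ := M.exists_update hM hcs opt W s
    have h3 := (bellman_add_coe m h1 h2).symm.trans (congrFun hV s)
    have h4 : v = W s := EReal.coe_add_coe_ennreal_inj h3
    rw [← h4]
    exact ⟨h1, h2⟩
  have hW0 : W s₀ = 0 := by
    have h3 : (m : EReal) + (W s₀ : EReal) = (m : EReal) + ((0 : ℝ≥0∞) : EReal) := by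
      rw [EReal.coe_ennreal_zero, add_zero]; exact hm
    exact EReal.coe_add_coe_ennreal_inj h3
  have hWz : W z = 0 := by
    refine mem_of_trap hcs hz (Z := {s | W s = 0}) ⟨s₀, hW0⟩ fun s hs => ?_
    obtain ⟨a, ha, p, hp, h⟩ := (hW s).2.exists_pair
    change W s = 0 at hs
    rw [hs] at h
    have h0 := le_antisymm h zero_le
    rw [add_eq_zero] at h0
    refine ⟨a, ha, by exact_mod_cast h0.1, fun t ht => ?_⟩
    rw [hcs.succ_eq hp] at ht
    exact distAvg_eq_of_le ENNReal.zero_ne_top (fun _ _ => zero_le) h0.2.le t ht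
  have hm0 : (m : EReal) = 0 := by
    simpa only [hWz, EReal.coe_ennreal_zero, add_zero] using hVz
  exact ⟨W, by simp only [hm0, zero_add], hW⟩

lemma value_bellman (hM : M.IsClosedRMDP) (hcs : M.ConstantSupport) (opt : Opt) :
    M.bellman opt (fun s => (M.value opt s : EReal)) = fun s => (M.value opt s : EReal) := by
  funext s
  have h := value_fixpoint hM hcs opt s
  simpa using bellman_add_coe 0 h.1 h.2

lemma value_isEstimate (hM : M.IsClosedRMDP) (hcs : M.ConstantSupport) (opt : Opt) :
    M.IsEstimate opt fun s => (M.value opt s : EReal) := by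
  refine ⟨fun s => EReal.coe_ennreal_ne_bot _, fun s hs => ?_, fun s hs => ?_⟩
  · simp only [value_terminal hM hcs hs, EReal.coe_ennreal_zero]
  · simpa only [Ne, EReal.coe_ennreal_eq_top_iff] using hs

/-- If every zero-reward end component contains the terminal state `z`, the value is the only
fixpoint. Where another fixpoint exceeds the value by the largest amount, the agent can remain in
the set of such states with actions that are optimal for the value, which is finite there. -/
theorem eq_value_of_fixpoint (hM : M.IsClosedRMDP) (hcs : M.ConstantSupport) {z : S}
    (hz : ∀ E, M.IsZeroEC E → z ∈ E.1) (hzt : M.IsTerminal z) {V : S → EReal}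
    (hest : M.IsEstimate opt V) (hV : M.bellman opt V = V) :
    V = fun s => (M.value opt s : EReal) := by
  obtain ⟨hbot, hterm, hfin⟩ := hest
  obtain ⟨W, rfl, hW⟩ := exists_eq_coe_of_fixpoint hM hcs hz hbot (hterm z hzt) hV
  have hfin' : ∀ s, M.value opt s ≠ ⊤ → W s ≠ ⊤ := fun s hs h =>
    hfin s hs (by simp only [h, EReal.coe_ennreal_top])
  set v := M.value opt with hv
  have hle : ∀ s, v s ≤ W s := value_le_of_updateLe fun s => (hW s).2
  have hfix := value_fixpoint hM hcs opt
  rw [← hv] at hfix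
  suffices h : ∀ s, v s ≠ ⊤ → W s = v s by
    funext s
    by_cases hs : v s = ⊤
    · have h1 := hle s
      rw [hs, top_le_iff] at h1
      rw [hs, h1]
    · rw [h s hs]
  have hvz : v z = 0 := value_terminal hM hcs hzt
  have hWz : W z = 0 := EReal.coe_ennreal_eq_coe_ennreal_iff.1 (hterm z hzt)
  obtain ⟨s₀, hs₀, hmax⟩ := Set.exists_max_image {s | v s ≠ ⊤} (fun s => W s - v s)
    (Set.toFinite _) ⟨z, by change v z ≠ ⊤; rw [hvz]; exact ENNReal.zero_ne_top⟩
  set d := W s₀ - v s₀ with hd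
  have hdtop : d ≠ ⊤ := ENNReal.sub_ne_top (hfin' s₀ hs₀)
  have hsum : ∀ s, W s = v s + (W s - v s) := fun s => (add_tsub_cancel_of_le (hle s)).symm
  have hZ := mem_of_finite_trap hcs hz (Z := {s | v s ≠ ⊤ ∧ W s - v s = d}) ⟨s₀, hs₀, rfl⟩
    (f := v) (fun s hs => hs.1) ?_
  · have hd0 : d = 0 := by rw [← hZ.2, hWz, hvz, tsub_zero]
    intro s hs
    have := hmax s hs
    rw [hd0] at this
    exact le_antisymm (tsub_eq_zero_iff_le.1 (le_antisymm this zero_le)) (hle s)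
  · rintro s ⟨hs, hsd⟩
    obtain ⟨a, ha, p, hp, h1, h2⟩ := (hW s).1.exists_pair (hfix s).2
    have hpF : ∀ t ∈ distSupport p, v t ≠ ⊤ := by
      intro t ht htop
      rw [distAvg_eq_top p ht htop, add_top] at h2
      exact hs (top_le_iff.1 h2)
    have h3 : distAvg p W = distAvg p v + distAvg p fun t => W t - v t := by
      unfold distAvg
      rw [← Finset.sum_add_distrib]
      refine Finset.sum_congr rfl fun t _ => ?_
      rw [← mul_add, ← hsum t]
    -- `a` and `p` are optimal for `W` and `v` at once, so `W - v` does not increase on average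
    have h4 : d ≤ distAvg p fun t => W t - v t := by
      have h5 : v s + d ≤ v s + distAvg p fun t => W t - v t := by
        rw [← hsd, ← hsum s]
        refine h1.trans ?_
        rw [h3, ← add_assoc]
        exact add_le_add_left h2 _
      exact (ENNReal.add_le_add_iff_left hs).1 h5
    -- the average of `W - v` is its maximum `d`, so it equals `d` on the whole support
    have h5 : distAvg p (fun t => d - (W t - v t)) ≤ 0 := by
      have h6 : distAvg p (fun t => d - (W t - v t)) + distAvg p (fun t => W t - v t) = d := by
        rw [← distAvg_const p d]
        unfold distAvg
        rw [← Finset.sum_add_distrib]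
        refine Finset.sum_congr rfl fun t _ => ?_
        by_cases ht : 0 < p t
        · rw [← mul_add]
          congr 1
          exact tsub_add_cancel_of_le ((hmax t (hpF t ht)).trans_eq (distAvg_const p d).symm)
            |>.trans (distAvg_const p d)
        · rw [ENNReal.ofReal_of_nonpos (not_lt.1 ht), zero_mul, zero_mul, zero_mul, zero_add]
      have h7 : distAvg p (fun t => d - (W t - v t)) + d ≤ 0 + d := by
        rw [zero_add]
        exact (add_le_add_right h4 _).trans h6.le
      exact (ENNReal.add_le_add_iff_right hdtop).1 h7
    refine ⟨a, ha, p, hp, fun t ht => ⟨hpF t ht, ?_⟩, h2⟩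
    have h8 := distAvg_eq_of_le ENNReal.zero_ne_top (fun _ _ => zero_le) h5 t ht
    exact le_antisymm (hmax t (hpF t ht)) (tsub_eq_zero_iff_le.1 h8)

end RMDP

/-! ### Contraction for maximization -/

section Expectations

variable {S : Type*} [Fintype S]

lemma sum_mul_one_sub_pow_le {p : stdSimplex ℝ S} {rank : S → ℕ} {δ : ℝ}
    (hδ0 : 0 < δ) (hδ1 : δ ≤ 1) {k : ℕ} {t₀ : S} (ht₀ : δ ≤ p t₀) (hk : rank t₀ < k) :
    ∑ t, p t * (1 - (δ / 2) ^ rank t) ≤ 1 - 2 * (δ / 2) ^ k := by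
  have h1 : ∑ t, p t = 1 := p.2.2
  have h0 : ∀ t, 0 ≤ p t := p.2.1
  have h2 : p t₀ * (δ / 2) ^ rank t₀ ≤ ∑ t, p t * (δ / 2) ^ rank t :=
    Finset.single_le_sum (f := fun t => p t * (δ / 2) ^ rank t)
      (fun t _ => mul_nonneg (h0 t) (by positivity)) (Finset.mem_univ t₀)
  have h3 : (δ / 2) ^ (k - 1) ≤ (δ / 2) ^ rank t₀ :=
    pow_le_pow_of_le_one (by positivity) (by linarith) (by omega)
  have h4 : 2 * (δ / 2) ^ k ≤ p t₀ * (δ / 2) ^ rank t₀ := by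
    calc 2 * (δ / 2) ^ k = δ * (δ / 2) ^ (k - 1) := by
          obtain ⟨j, rfl⟩ : ∃ j, k = j + 1 := ⟨k - 1, by omega⟩
          rw [Nat.add_sub_cancel, pow_succ]
          ring
      _ ≤ p t₀ * (δ / 2) ^ rank t₀ := mul_le_mul ht₀ h3 (by positivity) (h0 t₀)
  simp only [mul_sub, mul_one, Finset.sum_sub_distrib, h1]
  linarith

lemma distAvg_ofReal (p : stdSimplex ℝ S) {f : S → ℝ}
    (hf : ∀ t, 0 ≤ f t) :
    distAvg p (fun t => ENNReal.ofReal (f t)) = ENNReal.ofReal (∑ t, p t * f t) := by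
  have h0 : ∀ t, 0 ≤ p t := p.2.1
  rw [ENNReal.ofReal_sum_of_nonneg fun t _ => mul_nonneg (h0 t) (hf t)]
  refine Finset.sum_congr rfl fun t _ => ?_
  rw [ENNReal.ofReal_mul (h0 t)]

lemma distAvg_add (p : stdSimplex ℝ S) (f g : S → ℝ≥0∞) :
    distAvg p (fun t => f t + g t) = distAvg p f + distAvg p g := by
  unfold distAvg
  rw [← Finset.sum_add_distrib]
  simp only [mul_add]

lemma distAvg_mono_support (p : stdSimplex ℝ S) {f g : S → ℝ≥0∞}
    (h : ∀ t ∈ distSupport p, f t ≤ g t) : distAvg p f ≤ distAvg p g := by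
  refine Finset.sum_le_sum fun t _ => ?_
  by_cases ht : 0 < p t
  · exact mul_le_mul_right (h t ht) _
  · rw [ENNReal.ofReal_of_nonpos (not_lt.1 ht), zero_mul, zero_mul]

end Expectations

namespace RMDP

variable {S A : Type*} [Fintype S] {M : RMDP S A}

/-- By compactness, positive transition probabilities are bounded away from zero. -/
lemma exists_prob_lower_bound [Finite A] (hM : M.IsClosedRMDP) (hcs : M.ConstantSupport) :
    ∃ δ : ℝ, 0 < δ ∧ δ ≤ 1 ∧ ∀ s a, ∀ p ∈ M.unc s a, ∀ t ∈ distSupport p, δ ≤ p t := by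
  have h1 : ∀ x : S × A × S, ∃ δ : ℝ, 0 < δ ∧
      ∀ p ∈ M.unc x.1 x.2.1, x.2.2 ∈ distSupport p → δ ≤ p x.2.2 := by
    rintro ⟨s, a, t⟩
    by_cases ht : t ∈ M.succ s a
    · obtain ⟨p₀, hp₀, ht₀⟩ := ht
      obtain ⟨p, hp, hmin⟩ := (hM s a).isCompact.exists_isMinOn ⟨p₀, hp₀⟩
        (continuous_stdSimplex_apply t).continuousOn
      refine ⟨p t, ?_, fun q hq _ => hmin hq⟩
      change t ∈ distSupport p
      rwa [hcs s a p hp p₀ hp₀]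
    · exact ⟨1, one_pos, fun p hp h => absurd ⟨p, hp, h⟩ ht⟩
  choose δ hδ0 hδ using h1
  cases isEmpty_or_nonempty (S × A × S) with
  | inl h =>
    refine ⟨1, one_pos, le_rfl, fun s a p hp t _ => ?_⟩
    exact h.elim (s, a, t)
  | inr h =>
    obtain ⟨x, hx⟩ := Finite.exists_min δ
    exact ⟨min (δ x) 1, lt_min (hδ0 x) one_pos, min_le_right _ _, fun s a p hp t ht =>
      (min_le_left _ _).trans ((hx (s, a, t)).trans (hδ (s, a, t) p hp ht))⟩

/-- The states from which `z` is reached within `k` steps with positive probability, whatever the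
agent does. -/
def level (M : RMDP S A) (z : S) : ℕ → Set S
  | 0 => {z}
  | k + 1 => level M z k ∪ {s | ∀ a ∈ M.avail s, ∃ t ∈ M.succ s a, t ∈ level M z k}

lemma level_mono (z : S) : Monotone (M.level z) :=
  monotone_nat_of_le_succ fun _ => Set.subset_union_left

variable [Finite A]

lemma value_max_succ_ne_top (hM : M.IsClosedRMDP) (hcs : M.ConstantSupport) {s : S}
    (hs : M.value .max s ≠ ⊤) {a : A} {p : stdSimplex ℝ S} (hp : p ∈ M.unc s a) {t : S}
    (ht : t ∈ distSupport p) : M.value .max t ≠ ⊤ := by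
  intro htop
  obtain ⟨q, hq, h⟩ := (value_fixpoint hM hcs .max s).2 a ⟨p, hp⟩
  rw [hcs s a p hp q hq] at ht
  rw [distAvg_eq_top q ht htop, add_top] at h
  exact hs (top_le_iff.1 h)

/-- From every state of finite value, every action makes progress towards `z` with positive
probability: otherwise the agent could avoid `z` forever at a finite value. -/
lemma exists_rank (hM : M.IsClosedRMDP) (hcs : M.ConstantSupport) {z : S}
    (hz : ∀ E, M.IsZeroEC E → z ∈ E.1) : ∃ rank : S → ℕ,
      ∀ s, M.value .max s ≠ ⊤ → s ≠ z → ∀ a ∈ M.avail s, ∃ t ∈ M.succ s a, rank t < rank s := by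
  classical
  have hcov : ∀ s, M.value .max s ≠ ⊤ → ∃ k, s ∈ M.level z k := by
    -- outside all levels, the agent has an action that avoids all levels
    by_contra! hcon
    obtain ⟨s₀, hs₀, hs₀'⟩ := hcon
    have hZ := mem_of_finite_trap hcs hz
      (Z := {s | M.value .max s ≠ ⊤ ∧ ∀ k, s ∉ M.level z k}) ⟨s₀, hs₀, hs₀'⟩
      (f := M.value .max) (fun s hs => hs.1) ?_
    · exact hZ.2 0 rfl
    · rintro s ⟨hs, hs'⟩
      have h1 : ∃ a, ∀ k, a ∈ M.avail s ∧ ∀ t ∈ M.succ s a, t ∉ M.level z k := by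
        refine exists_forall_of_antitone _ (fun n m a hnm h => ⟨h.1, fun t ht ht' =>
          h.2 t ht (level_mono z hnm ht')⟩) fun k => ?_
        by_contra! hcon
        exact hs' (k + 1) (.inr hcon)
      obtain ⟨a, ha⟩ := h1
      obtain ⟨p, hp, h⟩ := (value_fixpoint hM hcs .max s).2 a (ha 0).1
      refine ⟨a, (ha 0).1, p, hp, fun t ht => ⟨value_max_succ_ne_top hM hcs hs hp ht, fun k => ?_⟩,
        h⟩
      exact (ha k).2 t ⟨p, hp, ht⟩
  refine ⟨fun s => if h : ∃ k, s ∈ M.level z k then Nat.find h else 0, fun s hs hsz a ha => ?_⟩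
  have h := hcov s hs
  simp only [dif_pos h]
  obtain ⟨k, hk⟩ : ∃ k, Nat.find h = k := ⟨_, rfl⟩
  cases k with
  | zero => exact absurd ((Nat.find_eq_zero h).1 hk) hsz
  | succ k =>
    have h1 := Nat.find_spec h
    rw [hk] at h1
    rcases h1 with h1 | h1
    · exact absurd h1 (Nat.find_min h (by omega))
    · obtain ⟨t, ht, htk⟩ := h1 a ha
      refine ⟨t, ht, ?_⟩
      have h' : ∃ k, t ∈ M.level z k := ⟨k, htk⟩
      rw [dif_pos h', hk]
      exact Nat.lt_succ_of_le (Nat.find_min' h' htk)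

/-- Functions that differ by at most `u` on the states of finite value have Bellman updates that
differ by at most the largest expectation of `u`. -/
lemma update_le_add (hM : M.IsClosedRMDP) (hcs : M.ConstantSupport) {W₁ W₂ : S → ℝ≥0∞} {s : S}
    (hs : M.value .max s ≠ ⊤) {v₁ v₂ : ℝ≥0∞} (h1 : M.LeUpdate .max W₁ s v₁)
    (h2 : M.UpdateLe .max W₂ s v₂) {u : S → ℝ} (hu : ∀ t, 0 ≤ u t)
    (hW : ∀ t, M.value .max t ≠ ⊤ → W₁ t ≤ W₂ t + ENNReal.ofReal (u t)) {c : ℝ}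
    (hc : ∀ a, ∀ p ∈ M.unc s a, ∑ t, p t * u t ≤ c) : v₁ ≤ v₂ + ENNReal.ofReal c := by
  obtain ⟨a, ha, p, hp, h3, h4⟩ := h1.exists_pair h2
  refine h3.trans ?_
  have h5 : distAvg p W₁ ≤ distAvg p W₂ + ENNReal.ofReal c := by
    calc distAvg p W₁ ≤ distAvg p fun t => W₂ t + ENNReal.ofReal (u t) :=
          distAvg_mono_support p fun t ht => hW t (value_max_succ_ne_top hM hcs hs hp ht)
      _ = distAvg p W₂ + ENNReal.ofReal (∑ t, p t * u t) := by
          rw [distAvg_add, distAvg_ofReal p hu]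
      _ ≤ _ := add_le_add_right (ENNReal.ofReal_le_ofReal (hc a p hp)) _
  refine (add_le_add_right h5 _).trans ?_
  rw [← add_assoc]
  exact add_le_add_left h4 _

lemma bellman_isEstimate (hM : M.IsClosedRMDP) (hcs : M.ConstantSupport) {V : S → EReal}
    (hV : M.IsEstimate .max V) : M.IsEstimate .max (M.bellman .max V) := by
  obtain ⟨hbot, hterm, hfin⟩ := hV
  obtain ⟨m, hm⟩ := exists_coe_le hbot
  obtain ⟨W, rfl⟩ := exists_eq_coe_add hm
  have hWfin : ∀ t, M.value .max t ≠ ⊤ → W t ≠ ⊤ := by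
    intro t ht h
    refine hfin t ht ?_
    simp only [h, EReal.coe_ennreal_top]
    exact EReal.coe_add_top m
  have hne : ∀ v : ℝ≥0∞, v ≠ ⊤ → (m : EReal) + (v : EReal) ≠ ⊤ := by
    intro v hv
    exact EReal.add_ne_top (EReal.coe_ne_top m) (by rwa [Ne, EReal.coe_ennreal_eq_top_iff])
  refine ⟨fun s => ?_, fun s hs => ?_, fun s hs => ?_⟩
  all_goals
    obtain ⟨v, h1, h2⟩ := M.exists_update hM hcs .max W s
    rw [bellman_add_coe m h1 h2]
  · exact EReal.add_ne_bot_iff.2 ⟨EReal.coe_ne_bot m, EReal.coe_ennreal_ne_bot v⟩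
  · have h3 : v = W s := by
      obtain ⟨a, ha, p, hp, h3, _⟩ := h1.exists_pair h2
      obtain ⟨b, hb, q, hq, h4⟩ := h2.exists_pair
      rw [(hs a ha).1, distAvg_of_eq_one ((hs a ha).2 p hp), Nat.cast_zero, zero_add] at h3
      rw [(hs b hb).1, distAvg_of_eq_one ((hs b hb).2 q hq), Nat.cast_zero, zero_add] at h4
      exact le_antisymm h3 h4
    rw [h3]
    exact hterm s hs
  · obtain ⟨a, ha, p, hp, h3, _⟩ := h1.exists_pair h2
    refine hne v (ne_top_of_le_ne_top (ENNReal.add_ne_top.2 ⟨ENNReal.natCast_ne_top _, ?_⟩) h3)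
    exact distAvg_ne_top p fun t ht => hWfin t (value_max_succ_ne_top hM hcs hs hp ht)

/-- If every zero-reward end component contains the terminal state `z`, the Bellman operator for
maximization contracts a weighted supremum distance. The weights `1 - ε ^ k` grow with the number
`k` of steps needed to make progress towards `z`; the gain `δ` in probability of each step
outweighs the growth if `ε < δ`. -/
theorem bellmanContraction_max (hM : M.IsClosedRMDP) (hcs : M.ConstantSupport) {z : S}
    (hz : ∀ E, M.IsZeroEC E → z ∈ E.1) (hzt : M.IsTerminal z) :
    M.BellmanContraction .max := by
  classical
  obtain ⟨δ, hδ0, hδ1, hδ⟩ := exists_prob_lower_bound hM hcs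
  obtain ⟨rank, hrank⟩ := exists_rank hM hcs hz
  have hε0 : 0 < δ / 2 := by positivity
  have hε1 : δ / 2 < 1 := by linarith
  have : Nonempty S := ⟨z⟩
  obtain ⟨x, hx⟩ := Finite.exists_max rank
  set K := rank x
  -- the case distinction only makes the weight positive where the rank is zero, as it is at `z`
  let w : S → ℝ := fun s => if rank s = 0 then 1 else 1 - (δ / 2) ^ rank s
  have hw : ∀ s, 0 < w s := by
    intro s
    change 0 < if rank s = 0 then (1 : ℝ) else _
    split_ifs with h
    · exact one_pos
    · exact sub_pos.2 (pow_lt_one₀ hε0.le hε1 h)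
  have hK0 : 0 < (δ / 2) ^ K := by positivity
  have hK1 : (δ / 2) ^ K ≤ 1 := pow_le_one₀ hε0.le hε1.le
  refine ⟨w, 1 - (δ / 2) ^ K, hw, by linarith, by linarith, fun V W hV hW =>
    ⟨bellman_isEstimate hM hcs hV, fun D hD s hs => ?_⟩⟩
  have hvz : M.value .max z ≠ ⊤ := by
    rw [value_terminal hM hcs hzt]; exact ENNReal.zero_ne_top
  have hD0 : 0 ≤ D := by
    have := (abs_nonneg _).trans (hD z hvz)
    exact nonneg_of_mul_nonneg_left this (hw z)
  by_cases hsz : s = z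
  · subst hsz
    rw [(bellman_isEstimate hM hcs hV).2.1 s hzt, (bellman_isEstimate hM hcs hW).2.1 s hzt]
    simp only [EReal.toReal_zero, sub_self, abs_zero]
    exact mul_nonneg (mul_nonneg (by linarith) hD0) (hw s).le
  -- the weighted distance, with weight zero at `z`, where all estimates agree
  let u : S → ℝ := fun t => if t = z then 0 else D * w t
  have hu : ∀ t, 0 ≤ u t := by
    intro t
    change 0 ≤ if t = z then (0 : ℝ) else _
    split_ifs
    · exact le_rfl
    · exact mul_nonneg hD0 (hw t).le
  -- the expected distance after one step is smaller than the distance by the factor `γ`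
  have hexp : ∀ a, ∀ p ∈ M.unc s a, ∑ t, p t * u t ≤ (1 - (δ / 2) ^ K) * D * w s := by
    intro a p hp
    obtain ⟨t₀, ht₀, hlt⟩ := hrank s hs hsz a ⟨p, hp⟩
    rw [hcs.succ_eq hp] at ht₀
    have h1 : ∑ t, p t * u t ≤ ∑ t, D * (p t * (1 - (δ / 2) ^ rank t)) := by
      refine Finset.sum_le_sum fun t _ => ?_
      have hp0 : 0 ≤ p t := p.2.1 t
      by_cases ht : 0 < p t
      · have h2 : u t ≤ D * (1 - (δ / 2) ^ rank t) := by
          change (if t = z then (0 : ℝ) else _) ≤ _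
          split_ifs with htz
          · exact mul_nonneg hD0 (sub_nonneg.2 (pow_le_one₀ hε0.le hε1.le))
          · obtain ⟨b, hb⟩ := M.exists_avail t
            obtain ⟨t', _, hlt'⟩ := hrank t (value_max_succ_ne_top hM hcs hs hp ht) htz b hb
            change D * (if rank t = 0 then (1 : ℝ) else _) ≤ _
            rw [if_neg (by omega)]
        calc p t * u t ≤ p t * (D * (1 - (δ / 2) ^ rank t)) := mul_le_mul_of_nonneg_left h2 hp0
          _ = _ := by ring
      · rw [le_antisymm (not_lt.1 ht) hp0, zero_mul, zero_mul, mul_zero]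
    rw [← Finset.mul_sum] at h1
    have h2 := sum_mul_one_sub_pow_le (p := p) (rank := rank) hδ0 hδ1 (hδ s a p hp t₀ ht₀) hlt
    have h3 : w s = 1 - (δ / 2) ^ rank s := if_neg (by omega)
    have h4 : (δ / 2) ^ K ≤ (δ / 2) ^ rank s := pow_le_pow_of_le_one hε0.le hε1.le (hx s)
    have h5 : 1 - 2 * (δ / 2) ^ rank s ≤ (1 - (δ / 2) ^ K) * w s := by
      rw [h3]
      have : 0 < (δ / 2) ^ rank s * (δ / 2) ^ K := by positivity
      linarith
    calc ∑ t, p t * u t ≤ D * ((1 - (δ / 2) ^ K) * w s) :=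
          h1.trans (mul_le_mul_of_nonneg_left (h2.trans h5) hD0)
      _ = _ := by ring
  -- shift the functions by a common lower bound to make them nonnegative
  obtain ⟨m₁, hm₁⟩ := exists_coe_le hV.1
  obtain ⟨m₂, hm₂⟩ := exists_coe_le hW.1
  obtain ⟨V', hV'⟩ := exists_eq_coe_add (m := min m₁ m₂) fun s =>
    (EReal.coe_le_coe_iff.2 (min_le_left _ _)).trans (hm₁ s)
  obtain ⟨W', hW'⟩ := exists_eq_coe_add (m := min m₁ m₂) fun s =>
    (EReal.coe_le_coe_iff.2 (min_le_right _ _)).trans (hm₂ s)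
  generalize min m₁ m₂ = m at hV' hW'
  have hfin : ∀ {X : S → EReal} {X' : S → ℝ≥0∞}, M.IsEstimate .max X →
      X = (fun s => (m : EReal) + (X' s : EReal)) → ∀ t, M.value .max t ≠ ⊤ → X' t ≠ ⊤ := by
    intro X X' hX hX' t ht h
    refine hX.2.2 t ht ?_
    simp only [hX', h, EReal.coe_ennreal_top]
    exact EReal.coe_add_top m
  have htoReal : ∀ v : ℝ≥0∞, v ≠ ⊤ → ((m : EReal) + (v : EReal)).toReal = m + v.toReal := by
    intro v hv
    rw [EReal.toReal_add (EReal.coe_ne_top m) (EReal.coe_ne_bot m)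
      (by rwa [Ne, EReal.coe_ennreal_eq_top_iff]) (EReal.coe_ennreal_ne_bot v), EReal.toReal_coe,
      EReal.toReal_coe_ennreal]
  have hclose : ∀ {x y : ℝ≥0∞} {c : ℝ}, x ≠ ⊤ → y ≠ ⊤ → 0 ≤ c →
      (x ≤ y + ENNReal.ofReal c ↔ x.toReal ≤ y.toReal + c) := by
    intro x y c hx hy hc
    rw [← ENNReal.toReal_le_toReal hx (ENNReal.add_ne_top.2 ⟨hy, ENNReal.ofReal_ne_top⟩),
      ENNReal.toReal_add hy ENNReal.ofReal_ne_top, ENNReal.toReal_ofReal hc]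
  have hdist : ∀ t, M.value .max t ≠ ⊤ → |(V' t).toReal - (W' t).toReal| ≤ u t := by
    intro t ht
    change _ ≤ if t = z then (0 : ℝ) else _
    split_ifs with htz
    · have h1 := (hV.2.1 z hzt).trans (hW.2.1 z hzt).symm
      rw [hV', hW'] at h1
      rw [htz, EReal.coe_add_coe_ennreal_inj h1, sub_self, abs_zero]
    · have h1 := hD t ht
      simp only [hV', hW', htoReal _ (hfin hV hV' t ht), htoReal _ (hfin hW hW' t ht)] at h1
      rwa [add_sub_add_left_eq_sub] at h1
  obtain ⟨v₁, h1, h1'⟩ := M.exists_update hM hcs .max V' s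
  obtain ⟨v₂, h2, h2'⟩ := M.exists_update hM hcs .max W' s
  have e1 := bellman_add_coe m h1 h1'
  have e2 := bellman_add_coe m h2 h2'
  rw [← hV'] at e1
  rw [← hW'] at e2
  have f1 : v₁ ≠ ⊤ := by
    intro h
    refine (bellman_isEstimate hM hcs hV).2.2 s hs ?_
    rw [e1, h, EReal.coe_ennreal_top, EReal.coe_add_top]
  have f2 : v₂ ≠ ⊤ := by
    intro h
    refine (bellman_isEstimate hM hcs hW).2.2 s hs ?_
    rw [e2, h, EReal.coe_ennreal_top, EReal.coe_add_top]
  have hc0 : 0 ≤ (1 - (δ / 2) ^ K) * D * w s :=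
    mul_nonneg (mul_nonneg (by linarith) hD0) (hw s).le
  have g1 := update_le_add hM hcs hs h1 h2' hu (fun t ht => (hclose (hfin hV hV' t ht)
    (hfin hW hW' t ht) (hu t)).2 (by have := (abs_le.1 (hdist t ht)).2; linarith)) hexp
  have g2 := update_le_add hM hcs hs h2 h1' hu (fun t ht => (hclose (hfin hW hW' t ht)
    (hfin hV hV' t ht) (hu t)).2 (by have := (abs_le.1 (hdist t ht)).1; linarith)) hexp
  rw [hclose f1 f2 hc0] at g1
  rw [hclose f2 f1 hc0] at g2
  rw [e1, e2, htoReal _ f1, htoReal _ f2, add_sub_add_left_eq_sub, abs_le]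
  constructor <;> linarith

end RMDP

/-! ### The size of the collapsed RMDP -/

lemma Set.ncard_le_ncard_of_rel {α β : Type*} {s : Set α} {t : Set β} (ht : t.Finite)
    (r : α → β → Prop) (hr : ∀ x ∈ s, ∃ y ∈ t, r x y) (hinj : ∀ x x' y, r x y → r x' y → x = x') :
    s.ncard ≤ t.ncard := by
  rcases s.eq_empty_or_nonempty with rfl | ⟨x₀, hx₀⟩
  · simp
  have : Nonempty β := ⟨(hr x₀ hx₀).choose⟩
  choose! f hf hrf using hr
  refine Set.ncard_le_ncard_of_injOn f hf (fun x hx x' hx' h => ?_) ht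
  exact hinj x x' (f x) (hrf x hx) (h ▸ hrf x' hx')

lemma Set.ncard_insert_none_image {α : Type*} {s : Set α} (hs : s.Finite) :
    (insert none (some '' s)).ncard = s.ncard + 1 := by
  rw [Set.ncard_insert_of_notMem (by simp) (hs.image _),
    Set.ncard_image_of_injective _ (Option.some_injective _)]

namespace RMDP

variable {S A : Type*} [Fintype S] {M : RMDP S A}

/-- A relation that charges the pairs of the collapsed RMDP to original pairs: a copy to its
original, staying in a MEC to a staying pair, and staying in the sink to nothing. -/
inductive ChargedTo (M : RMDP S A) : M.CState × CAction S A → Option (S × A) → Prop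
  | copy {x : M.CState} {α : CAction S A} {s : S} {a : A} (h : M.IsCopy x α s a) :
      ChargedTo M (x, α) (some (s, a))
  | stay {E : M.ZeroMEC} {s : S} {a : A} (h : (s, a) ∈ E.staying) :
      ChargedTo M (.rep E, .stay) (some (s, a))
  | sink : ChargedTo M (.sink, .stay) none

lemma IsCopy.action_eq {x : M.CState} {α β : CAction S A} {s : S} {a : A}
    (h : M.IsCopy x α s a) (h' : M.IsCopy x β s a) : α = β := by
  cases h <;> cases h' <;> rfl

lemma IsCopy.notMem_staying (hcs : M.ConstantSupport) {x : M.CState} {α : CAction S A} {s : S}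
    {a : A} (h : M.IsCopy x α s a) (E : M.ZeroMEC) : (s, a) ∉ E.staying := by
  intro hE
  cases h with
  | keep _ hs => exact hs E (E.mem_states hE)
  | exit F _ _ hs ha =>
    rw [ZeroMEC.eq_of_mem hcs hs (E.mem_states hE)] at ha
    exact ha hE

lemma ChargedTo.inj (hcs : M.ConstantSupport) (y y' : M.CState × CAction S A)
    (b : Option (S × A)) (h : M.ChargedTo y b) (h' : M.ChargedTo y' b) : y = y' := by
  cases h with
  | copy h =>
    cases h' with
    | copy h' =>
      have h1 := (h.proj_eq hcs).symm.trans (h'.proj_eq hcs)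
      subst h1
      rw [h.action_eq h']
    | stay h' => exact absurd h' (h.notMem_staying hcs _)
  | stay h =>
    cases h' with
    | copy h' => exact absurd h (h'.notMem_staying hcs _)
    | stay h' => rw [ZeroMEC.eq_of_mem hcs (ZeroMEC.mem_states _ h) (ZeroMEC.mem_states _ h')]
  | sink =>
    cases h'
    rfl

lemma card_cState_le (hcs : M.ConstantSupport) : Nat.card M.CState ≤ Nat.card S + 1 := by
  have h := Set.ncard_le_ncard_of_rel (s := (Set.univ : Set M.CState))
    (t := (Set.univ : Set (Option S))) (Set.toFinite _)
    (fun x b => match b with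
      | some s => M.proj s = x
      | none => x = .sink)
    (fun x _ => by
      by_cases hx : x = .sink
      · exact ⟨none, trivial, hx⟩
      · obtain ⟨s, hs⟩ := proj_surjective_of_ne_sink hcs hx
        exact ⟨some s, trivial, hs⟩)
    (fun x x' b h h' => by
      cases b
      · exact h.trans h'.symm
      · exact h.symm.trans h')
  rwa [Set.ncard_univ, Set.ncard_univ, Finite.card_option] at h

variable [Finite A]

lemma ChargedTo.exists {y : M.CState × CAction S A} (hy : y ∈ M.collapse.pairs) :
    ∃ b ∈ insert none (some '' M.pairs), M.ChargedTo y b := by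
  obtain ⟨x, α⟩ := y
  rcases collapse_avail_cases hy with ⟨s, a, h⟩ | ⟨hx | ⟨E, hx⟩, hα⟩
  · exact ⟨some (s, a), .inr ⟨_, h.mem_avail_iff.1 hy, rfl⟩, .copy h⟩
  · cases hx; cases hα
    exact ⟨none, .inl rfl, .sink⟩
  · cases hx; cases hα
    obtain ⟨a, ha⟩ := E.exists_staying E.nonempty.some_mem
    exact ⟨some (_, a), .inr ⟨_, E.mem_avail ha, rfl⟩, .stay ha⟩

lemma ncard_pairs_collapse_le (hcs : M.ConstantSupport) :
    M.collapse.pairs.ncard ≤ M.pairs.ncard + 1 := by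
  rw [← Set.ncard_insert_none_image (Set.toFinite M.pairs)]
  exact Set.ncard_le_ncard_of_rel (Set.toFinite _) M.ChargedTo
    (fun _ hy => ChargedTo.exists hy) (ChargedTo.inj hcs)

/-- A transition of the collapsed RMDP is charged to one of `M` whose pair its pair is charged to;
the transition to the sink of a staying action is charged to any transition of a staying pair. -/
lemma ncard_transitions_collapse_le (hcs : M.ConstantSupport) :
    M.collapse.transitions.ncard ≤ M.transitions.ncard + 1 := by
  rw [← Set.ncard_insert_none_image (Set.toFinite M.transitions)]
  refine Set.ncard_le_ncard_of_rel (Set.toFinite _)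
    (fun y b => M.ChargedTo (y.1, y.2.1) (b.map fun c => (c.1, c.2.1)) ∧
      (y.2.1 = .stay → y.2.2 = .sink) ∧
        (y.2.1 ≠ .stay → ∀ c ∈ b, y.2.2 = M.proj c.2.2)) ?_ ?_
  · rintro ⟨x, α, y⟩ hy
    have hα : α ∈ M.collapse.avail x := ⟨_, hy.choose_spec.1⟩
    rcases collapse_avail_cases hα with ⟨s, a, h⟩ | ⟨hx, rfl⟩
    · change y ∈ M.collapse.succ x α at hy
      rw [h.succ_eq] at hy
      obtain ⟨t, ht, rfl⟩ := hy
      refine ⟨some (s, a, t), .inr ⟨_, ht, rfl⟩, .copy h, ?_, ?_⟩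
      · rintro rfl
        cases h
      · rintro _ c hc
        cases hc
        rfl
    · change y ∈ M.collapse.succ x .stay at hy
      rw [collapse_succ_stay hx] at hy
      have hpart : (CAction.stay : CAction S A) = .stay → y = .sink := fun _ => hy
      rcases hx with rfl | ⟨E, rfl⟩
      · exact ⟨none, .inl rfl, .sink, hpart, fun h => absurd rfl h⟩
      · obtain ⟨a, ha⟩ := E.exists_staying E.nonempty.some_mem
        obtain ⟨t, ht⟩ := succ_nonempty (E.mem_avail ha)
        exact ⟨some (_, a, t), .inr ⟨_, ht, rfl⟩, .stay ha, hpart, fun h => absurd rfl h⟩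
  · rintro ⟨x, α, y⟩ ⟨x', α', y'⟩ b ⟨h1, h2, h3⟩ ⟨h1', h2', h3'⟩
    have h := ChargedTo.inj hcs _ _ _ h1 h1'
    obtain ⟨rfl, rfl⟩ := Prod.mk.inj h
    by_cases hα : α = .stay
    · exact Prod.ext rfl (Prod.ext rfl ((h2 hα).trans (h2' hα).symm))
    · cases b with
      | none => cases h1; exact absurd rfl hα
      | some c => exact Prod.ext rfl (Prod.ext rfl ((h3 hα c rfl).trans (h3' hα c rfl).symm))

lemma sum_size_reward_collapse_le (hcs : M.ConstantSupport) :
    ∑ᶠ y ∈ M.collapse.pairs, Nat.size (M.collapse.reward y.1 y.2) ≤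
      ∑ᶠ x ∈ M.pairs, Nat.size (M.reward x.1 x.2) := by
  classical
  choose! f hf hrf using fun (y : M.CState × CAction S A) (hy : y ∈ M.collapse.pairs) =>
    ChargedTo.exists hy
  let g : Option (S × A) → ℕ := fun b => b.elim 0 fun x => Nat.size (M.reward x.1 x.2)
  have hg : ∀ y ∈ M.collapse.pairs, Nat.size (M.collapse.reward y.1 y.2) ≤ g (f y) := by
    intro y hy
    have h := hrf y hy
    generalize f y = b at h
    cases h with
    | copy h => rw [h.reward_eq]; exact le_rfl
    | stay h => exact Nat.zero_le _
    | sink => exact Nat.zero_le _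
  rw [finsum_mem_eq_finite_toFinset_sum _ (Set.toFinite M.collapse.pairs),
    finsum_mem_eq_finite_toFinset_sum _ (Set.toFinite M.pairs)]
  calc ∑ y ∈ (Set.toFinite M.collapse.pairs).toFinset, Nat.size (M.collapse.reward y.1 y.2)
      ≤ ∑ y ∈ (Set.toFinite M.collapse.pairs).toFinset, g (f y) :=
        Finset.sum_le_sum fun y hy => hg y ((Set.Finite.mem_toFinset _).1 hy)
    _ = ∑ b ∈ (Set.toFinite M.collapse.pairs).toFinset.image f, g b := by
        rw [Finset.sum_image]
        intro y hy y' hy' h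
        have hy := hrf y ((Set.Finite.mem_toFinset _).1 hy)
        have hy' := hrf y' ((Set.Finite.mem_toFinset _).1 hy')
        rw [h] at hy
        exact ChargedTo.inj hcs _ _ _ hy hy'
    _ ≤ ∑ b ∈ insert none ((Set.toFinite M.pairs).toFinset.image some), g b := by
        refine Finset.sum_le_sum_of_subset fun b hb => ?_
        obtain ⟨y, hy, rfl⟩ := Finset.mem_image.1 hb
        rcases hf y ((Set.Finite.mem_toFinset _).1 hy) with h | ⟨x, hx, h⟩
        · rw [h]; exact Finset.mem_insert_self _ _
        · exact Finset.mem_insert_of_mem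
            (Finset.mem_image.2 ⟨x, (Set.Finite.mem_toFinset _).2 hx, h⟩)
    _ = ∑ x ∈ (Set.toFinite M.pairs).toFinset, Nat.size (M.reward x.1 x.2) := by
        rw [Finset.sum_insert (by simp), Finset.sum_image fun x _ y _ h => Option.some.inj h]
        exact zero_add _

lemma size_collapse_le (hcs : M.ConstantSupport) : M.collapse.size ≤ M.size + 3 := by
  have h1 := card_cState_le hcs
  have h2 := ncard_pairs_collapse_le hcs
  have h3 := ncard_transitions_collapse_le hcs
  have h4 := sum_size_reward_collapse_le hcs
  unfold size
  omega

end RMDP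

/-! ### Computing the zero-reward maximal end components by pruning -/

/-- A map that strictly decreases a measure until it reaches a fixpoint does so in as many steps as
the measure says. -/
lemma iterate_fixed_of_measure {X : Type*} (f : X → X) (μ : X → ℕ)
    (h : ∀ x, f x = x ∨ μ (f x) < μ x) (x : X) {N : ℕ} (hN : μ x ≤ N) :
    f (f^[N] x) = f^[N] x := by
  have key : ∀ k, f (f^[k] x) = f^[k] x ∨ μ (f^[k] x) + k ≤ μ x := by
    intro k
    induction k with
    | zero => exact .inr le_rfl
    | succ k ih =>
      rw [Function.iterate_succ_apply']
      rcases ih with ih | ih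
      · exact .inl (by rw [ih, ih])
      · rcases h (f^[k] x) with h | h
        · exact .inl (by rw [h, h])
        · exact .inr (by omega)
  rcases key N with h1 | h1
  · exact h1
  · rcases h (f^[N] x) with h2 | h2
    · exact h2
    · omega

/-- The set `U` together with the successors of its elements. -/
def expand {S : Type*} (r : S → S → Prop) (U : Set S) : Set S := {t | t ∈ U ∨ ∃ u ∈ U, r u t}

/-- In a graph with at most `n` vertices, all reachable vertices are found after `n` rounds. -/
lemma mem_iterate_expand_iff {S : Type*} [Finite S] (r : S → S → Prop) (s t : S) {n : ℕ}
    (hn : Nat.card S ≤ n) : t ∈ (expand r)^[n] {s} ↔ Relation.ReflTransGen r s t := by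
  constructor
  · have key : ∀ k t, t ∈ (expand r)^[k] {s} → Relation.ReflTransGen r s t := by
      intro k
      induction k with
      | zero => rintro t rfl; exact .refl
      | succ k ih =>
        intro t ht
        rw [Function.iterate_succ_apply'] at ht
        rcases ht with ht | ⟨u, hu, hut⟩
        · exact ih t ht
        · exact (ih u hu).tail hut
    exact key n t
  · have hfix : expand r ((expand r)^[n] {s}) = (expand r)^[n] {s} := by
      refine iterate_fixed_of_measure (expand r) (fun U => Uᶜ.ncard) (fun U => ?_) _
        ((Set.ncard_le_card _).trans hn)
      by_cases h : expand r U = U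
      · exact .inl h
      · refine .inr (Set.ncard_lt_ncard ?_ (Set.toFinite _))
        refine compl_lt_compl_iff_lt.2 ?_
        exact Set.ssubset_iff_subset_ne.2 ⟨fun x hx => .inl hx, fun h' => h h'.symm⟩
    have hs : s ∈ (expand r)^[n] {s} := by
      have : ∀ k, s ∈ (expand r)^[k] {s} := by
        intro k
        induction k with
        | zero => rfl
        | succ k ih => rw [Function.iterate_succ_apply']; exact .inl ih
      exact this n
    intro h
    induction h with
    | refl => exact hs
    | tail _ huv ih => rw [← hfix]; exact .inr ⟨_, ih, huv⟩

namespace RMDP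

variable {S A : Type*} [Fintype S]

/-- The available pairs with reward zero. -/
def zeroPairs (M : RMDP S A) : Set (S × A) := {x | x.2 ∈ M.avail x.1 ∧ M.reward x.1 x.2 = 0}

/-- The pairs of `R` all of whose successors can return to the state of the pair along `R`. -/
def prune (M : RMDP S A) (R : Set (S × A)) : Set (S × A) :=
  {x | x ∈ R ∧ ∀ t ∈ M.succ x.1 x.2, Relation.ReflTransGen (M.edge R) t x.1}

/-- The largest set of zero-reward pairs along which every transition can be undone. It is the
union of the staying pairs of all zero-reward MECs. -/
def core (M : RMDP S A) : Set (S × A) := M.prune^[Nat.card S * Nat.card A] M.zeroPairs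

variable {M : RMDP S A}

lemma prune_core [Finite A] : M.prune M.core = M.core := by
  refine iterate_fixed_of_measure M.prune Set.ncard (fun R => ?_) _ ?_
  · by_cases h : M.prune R = R
    · exact .inl h
    · exact .inr (Set.ncard_lt_ncard
        (Set.ssubset_iff_subset_ne.2 ⟨fun x hx => hx.1, h⟩) (Set.toFinite _))
  · rw [← Nat.card_prod]
    exact Set.ncard_le_card _

lemma iterate_prune_subset (k : ℕ) : M.prune^[k] M.zeroPairs ⊆ M.zeroPairs := by
  induction k with
  | zero => exact subset_rfl
  | succ k ih =>
    rw [Function.iterate_succ_apply']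
    exact fun x hx => ih hx.1

/-- Pruning never removes a pair of a zero-reward end component. -/
lemma IsZeroEC.subset_core (hcs : M.ConstantSupport) {E : Set S × Set (S × A)}
    (hE : M.IsZeroEC E) : E.2 ⊆ M.core := by
  have key : ∀ k, E.2 ⊆ M.prune^[k] M.zeroPairs := by
    obtain ⟨hE, hE0⟩ := hE
    obtain ⟨_, _, h3, h4⟩ := (isEndComponent_iff hcs _).1 hE
    intro k
    induction k with
    | zero => exact fun ⟨s, a⟩ h => ⟨(h3 s a h).2.1, hE0 s a h⟩
    | succ k ih =>
      rw [Function.iterate_succ_apply']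
      rintro ⟨s, a⟩ h
      exact ⟨ih h, fun t ht => reflTransGen_mono (fun _ _ => edge_mono ih)
        (h4 t ((h3 s a h).2.2 ht) s (h3 s a h).1)⟩
  exact key _

variable [Finite A]

lemma reflTransGen_core_symm {s t : S} (h : Relation.ReflTransGen (M.edge M.core) s t) :
    Relation.ReflTransGen (M.edge M.core) t s := by
  induction h with
  | refl => exact .refl
  | tail _ huv ih =>
    obtain ⟨a, ha, hv⟩ := huv
    rw [← prune_core] at ha
    exact (ha.2 _ hv).trans ih

/-- The pairs of the core that are reachable along the core from one of its states form a
zero-reward end component, because every transition of the core can be undone. -/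
lemma exists_mem_staying_iff (hcs : M.ConstantSupport) (s : S) (a : A) :
    (∃ E : M.ZeroMEC, (s, a) ∈ E.staying) ↔ (s, a) ∈ M.core := by
  constructor
  · rintro ⟨E, h⟩
    exact IsZeroEC.subset_core hcs E.2.prop h
  · intro h
    have hE : M.IsZeroEC ({t | Relation.ReflTransGen (M.edge M.core) s t},
        {x ∈ M.core | Relation.ReflTransGen (M.edge M.core) s x.1}) := by
      refine ⟨(isEndComponent_iff hcs _).2 ⟨⟨s, .refl⟩, ⟨(s, a), h, .refl⟩, ?_, ?_⟩, ?_⟩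
      · rintro u b ⟨hb, hu⟩
        exact ⟨hu, (iterate_prune_subset _ hb).1, fun v hv => hu.tail ⟨b, hb, hv⟩⟩
      · intro u hu v hv
        have huv := (reflTransGen_core_symm hu).trans hv
        change Relation.ReflTransGen (M.edge M.core) s u at hu
        clear hv
        induction huv with
        | refl => exact .refl
        | tail huw hwx ih =>
          obtain ⟨b, hb, hx⟩ := hwx
          exact ih.tail ⟨b, ⟨hb, hu.trans huw⟩, hx⟩
      · rintro u b ⟨hb, _⟩
        exact (iterate_prune_subset _ hb).2
    obtain ⟨F, hF⟩ := hE.exists_zeroMEC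
    exact ⟨F, hF.2 ⟨h, .refl⟩⟩

lemma exists_mem_states_iff (hcs : M.ConstantSupport) (s : S) :
    (∃ E : M.ZeroMEC, s ∈ E.states) ↔ ∃ a, (s, a) ∈ M.core := by
  constructor
  · rintro ⟨E, h⟩
    obtain ⟨a, ha⟩ := E.exists_staying h
    exact ⟨a, (exists_mem_staying_iff hcs s a).1 ⟨E, ha⟩⟩
  · rintro ⟨a, ha⟩
    obtain ⟨E, hE⟩ := (exists_mem_staying_iff hcs s a).2 ha
    exact ⟨E, E.mem_states hE⟩

/-- Two states are represented by the same state of the collapsed RMDP if and only if they are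
connected by the pairs of the core. -/
lemma proj_eq_iff (hcs : M.ConstantSupport) (s t : S) :
    M.proj s = M.proj t ↔ Relation.ReflTransGen (M.edge M.core) s t := by
  constructor
  · intro h
    by_cases hs : ∃ E : M.ZeroMEC, s ∈ E.states
    · obtain ⟨E, hs⟩ := hs
      have ht : t ∈ E.states := mem_of_proj_eq_rep (h.symm.trans (proj_eq_rep hcs hs))
      exact reflTransGen_mono (fun _ _ => edge_mono (IsZeroEC.subset_core hcs E.2.prop))
        (E.connected hcs hs ht)
    · rw [not_exists] at hs
      rw [proj_eq_keep hs] at h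
      rw [eq_of_proj_eq_keep h.symm]
  · intro h
    induction h with
    | refl => rfl
    | tail _ huv ih =>
      obtain ⟨a, ha, hv⟩ := huv
      obtain ⟨E, hE⟩ := (exists_mem_staying_iff hcs _ a).2 ha
      rw [ih, proj_eq_rep hcs (E.mem_states hE), proj_eq_rep hcs (E.succ_subset hcs hE hv)]

end RMDP

/-! ### Reasoning about programs -/

/-- The loop invariant rule. -/
lemma Prog.run_loop_induction (x : ℕ) (e : Expr) (p : Prog) (μ : Memory) (I : ℕ → Memory → Prop)
    (h0 : I 0 μ)
    (hs : ∀ i < e.eval μ, ∀ ν, I i ν → I (i + 1) (p.run (ν.setReg x i)).1) :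
    I (e.eval μ) ((Prog.loop x e p).run μ).1 := by
  rw [Prog.run]
  have key : ∀ N ≤ e.eval μ, I N ((List.range N).foldl
      (fun r i => ((p.run (r.1.setReg x i)).1, r.2 + 1 + (p.run (r.1.setReg x i)).2))
      (μ, 1 + e.cost)).1 := by
    intro N
    induction N with
    | zero => exact fun _ => h0
    | succ N ih =>
      intro hN
      rw [List.range_succ, List.foldl_append]
      exact hs N (by omega) _ (ih (by omega))
  exact key _ le_rfl

/-- The memory `ν` agrees with `μ` on the registers below `d` and on the cells outside `B`. -/
structure Memory.Frame (d : ℕ) (B : ℕ → ℕ → ℕ → ℕ → Prop) (μ ν : Memory) : Prop where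
  reg : ∀ x < d, ν.reg x = μ.reg x
  cell : ∀ b i j k, ¬ B b i j k → ν.cell b i j k = μ.cell b i j k

/-- The memory `ν` arises from `μ` by the writes in `W`, where `W b i j k v` says that `v` may be
written to the cell `i j k` of the array `b`; the registers below `d` are unchanged. A loop that
counts in the register `d` has a body that leaves the registers up to `d` unchanged. -/
structure Memory.Does (d : ℕ) (W : ℕ → ℕ → ℕ → ℕ → ℕ → Prop) (μ ν : Memory) : Prop where
  reg : ∀ x < d, ν.reg x = μ.reg x
  cell : ∀ b i j k, W b i j k (ν.cell b i j k) ∨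
    (∀ v, ¬ W b i j k v) ∧ ν.cell b i j k = μ.cell b i j k

/-- A single write. -/
def writeAt (b i j k v : ℕ) : ℕ → ℕ → ℕ → ℕ → ℕ → Prop :=
  fun b' i' j' k' v' => b' = b ∧ i' = i ∧ j' = j ∧ k' = k ∧ v' = v

namespace Memory

variable {d : ℕ} {B B' : ℕ → ℕ → ℕ → ℕ → Prop} {W W' : ℕ → ℕ → ℕ → ℕ → ℕ → Prop}
  {μ ν ξ : Memory}

lemma Frame.refl (d : ℕ) (B : ℕ → ℕ → ℕ → ℕ → Prop) (μ : Memory) : Frame d B μ μ :=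
  ⟨fun _ _ => rfl, fun _ _ _ _ _ => rfl⟩

lemma Frame.trans (h : Frame d B μ ν) (h' : Frame d B ν ξ) : Frame d B μ ξ :=
  ⟨fun x hx => (h'.reg x hx).trans (h.reg x hx),
    fun b i j k hb => (h'.cell b i j k hb).trans (h.cell b i j k hb)⟩

lemma Frame.weaken {d' : ℕ} (h : Frame d' B' μ ν) (hd : d ≤ d')
    (hB : ∀ b i j k, B' b i j k → B b i j k) : Frame d B μ ν :=
  ⟨fun x hx => h.reg x (by omega), fun b i j k hb => h.cell b i j k fun h' => hb (hB _ _ _ _ h')⟩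

lemma Frame.setReg (h : Frame d B μ ν) {x : ℕ} (hx : d ≤ x) (v : ℕ) :
    Frame d B μ (ν.setReg x v) := by
  refine ⟨fun y hy => ?_, h.cell⟩
  rw [← h.reg y hy]
  exact Function.update_of_ne (by omega) _ _

lemma Does.frame (h : Does d W μ ν) (hB : ∀ b i j k v, W b i j k v → B b i j k) :
    Frame d B μ ν := by
  refine ⟨h.reg, fun b i j k hb => ?_⟩
  rcases h.cell b i j k with h' | h'
  · exact absurd (hB _ _ _ _ _ h') hb
  · exact h'.2

/-- A cell to which only one value can be written holds this value. -/
lemma Does.eq_of_unique (h : Does d W μ ν) {b i j k v : ℕ} (hW : W b i j k v)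
    (hu : ∀ v', W b i j k v' → v' = v) : ν.cell b i j k = v := by
  rcases h.cell b i j k with h' | h'
  · exact hu _ h'
  · exact absurd hW (h'.1 v)

lemma Does.eq_of_not (h : Does d W μ ν) {b i j k : ℕ} (hW : ∀ v, ¬ W b i j k v) :
    ν.cell b i j k = μ.cell b i j k := by
  rcases h.cell b i j k with h' | h'
  · exact absurd h' (hW _)
  · exact h'.2

lemma Does.weaken {d' : ℕ} (h : Does d' W μ ν) (hd : d ≤ d') : Does d W μ ν :=
  ⟨fun x hx => h.reg x (by omega), h.cell⟩

lemma Does.congr (h : Does d W μ ν) (hW : ∀ b i j k v, W b i j k v ↔ W' b i j k v) :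
    Does d W' μ ν := by
  refine ⟨h.reg, fun b i j k => ?_⟩
  simp only [← hW]
  exact h.cell b i j k

lemma Does.refl (d : ℕ) (μ : Memory) : Does d (fun _ _ _ _ _ => False) μ μ :=
  ⟨fun _ _ => rfl, fun _ _ _ _ => .inr ⟨fun _ => id, rfl⟩⟩

lemma Does.trans (h : Does d W μ ν) (h' : Does d W' ν ξ) :
    Does d (fun b i j k v => W b i j k v ∨ W' b i j k v) μ ξ := by
  refine ⟨fun x hx => (h'.reg x hx).trans (h.reg x hx), fun b i j k => ?_⟩
  rcases h'.cell b i j k with h2 | ⟨h2, h3⟩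
  · exact .inl (.inr h2)
  · rw [h3]
    rcases h.cell b i j k with h4 | ⟨h4, h5⟩
    · exact .inl (.inl h4)
    · exact .inr ⟨fun v hv => hv.elim (h4 v) (h2 v), h5⟩

lemma Does.setReg_right (h : Does d W μ ν) {x : ℕ} (hx : d ≤ x) (v : ℕ) :
    Does d W μ (ν.setReg x v) := by
  refine ⟨fun y hy => ?_, h.cell⟩
  rw [← h.reg y hy]
  exact Function.update_of_ne (by omega) _ _

end Memory

open Memory

namespace Prog

variable {d : ℕ} {B : ℕ → ℕ → ℕ → ℕ → Prop} {W W' : ℕ → ℕ → ℕ → ℕ → ℕ → Prop}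
  {p q : Prog} {μ : Memory}

lemma does_write (d : ℕ) (μ : Memory) (b : ℕ) (i j k e : Expr) :
    Does d (writeAt b (i.eval μ) (j.eval μ) (k.eval μ) (e.eval μ)) μ
      ((Prog.write b i j k e).run μ).1 := by
  refine ⟨fun _ _ => rfl, fun b' i' j' k' => ?_⟩
  by_cases h : b' = b ∧ i' = i.eval μ ∧ j' = j.eval μ ∧ k' = k.eval μ
  · exact .inl ⟨h.1, h.2.1, h.2.2.1, h.2.2.2, if_pos h⟩
  · exact .inr ⟨fun v hv => h ⟨hv.1, hv.2.1, hv.2.2.1, hv.2.2.2.1⟩, if_neg h⟩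

lemma does_write' {b : ℕ} {i j k e : Expr} {i' j' k' e' : ℕ} (hi : i.eval μ = i')
    (hj : j.eval μ = j') (hk : k.eval μ = k') (he : e.eval μ = e') :
    Does d (writeAt b i' j' k' e') μ ((Prog.write b i j k e).run μ).1 := by
  subst hi hj hk he
  exact does_write d μ b i j k e

lemma does_seq (hp : Does d W μ (p.run μ).1) (hq : Does d W' (p.run μ).1 (q.run (p.run μ).1).1) :
    Does d (fun b i j k v => W b i j k v ∨ W' b i j k v) μ ((Prog.seq p q).run μ).1 :=
  hp.trans hq

lemma does_when {e : Expr} {P : Prop} (he : e.eval μ ≠ 0 ↔ P) (hp : P → Does d W μ (p.run μ).1) :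
    Does d (fun b i j k v => P ∧ W b i j k v) μ ((Prog.ite e p .skip).run μ).1 := by
  rw [Prog.run]
  by_cases h : P
  · rw [if_pos (he.2 h)]
    exact (hp h).congr fun b i j k v => by simp [h]
  · rw [if_neg (fun h' => h (he.1 h'))]
    exact (Does.refl d μ).congr fun b i j k v => by simp [h]

lemma does_unless {e : Expr} {P : Prop} (he : e.eval μ = 0 ↔ P)
    (hp : P → Does d W μ (p.run μ).1) :
    Does d (fun b i j k v => P ∧ W b i j k v) μ ((Prog.ite e .skip p).run μ).1 := by
  rw [Prog.run]
  by_cases h : P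
  · rw [if_neg (not_not.2 (he.2 h))]
    exact (hp h).congr fun b i j k v => by simp [h]
  · rw [if_pos (fun h' => h (he.1 h'))]
    exact (Does.refl d μ).congr fun b i j k v => by simp [h]

/-- The loop rule. The body may rely on the writes of the previous rounds. -/
lemma does_loop_of_prev {ι : Type*} {N : ℕ} (f : ι ≃ Fin N) {y : ℕ} (hN : μ.reg y = N)
    {W : ι → ℕ → ℕ → ℕ → ℕ → ℕ → Prop}
    (hbody : ∀ s ν, Does d (fun b i j k v => ∃ s', f s' < f s ∧ W s' b i j k v) μ ν →
      ν.reg d = f s → Does (d + 1) (W s) ν (p.run ν).1) :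
    Does d (fun b i j k v => ∃ s, W s b i j k v) μ ((Prog.loop d (.reg y) p).run μ).1 := by
  have h := run_loop_induction d (.reg y) p μ
    (fun i ν => Does d (fun b i' j k v => ∃ s', (f s' : ℕ) < i ∧ W s' b i' j k v) μ ν)
    ((Does.refl d μ).congr fun b i j k v => by simp) ?_
  · refine h.congr fun b i j k v => exists_congr fun s => ?_
    have : (f s : ℕ) < (Expr.reg y).eval μ := by
      change _ < μ.reg y
      rw [hN]; exact (f s).2
    simp [this]
  · intro i hi ν hν
    change i < μ.reg y at hi
    rw [hN] at hi
    have hs : (f (f.symm ⟨i, hi⟩) : ℕ) = i := by simp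
    generalize f.symm ⟨i, hi⟩ = s at hs
    have hd : (ν.setReg d i).reg d = f s := by
      rw [hs]; exact Function.update_self _ _ _
    have hν' := hν.setReg_right le_rfl i
    have h2 := hbody s (ν.setReg d i) (hν'.congr fun b i' j k v => exists_congr fun s' => by
      rw [← hs, Fin.val_fin_lt]) hd
    refine (hν'.trans (h2.weaken (Nat.le_succ d))).congr fun b i' j k v => ?_
    constructor
    · rintro (⟨s', h3, h4⟩ | h3)
      · exact ⟨s', by omega, h4⟩
      · exact ⟨s, by omega, h3⟩
    · rintro ⟨s', h3, h4⟩
      by_cases h5 : s' = s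
      · exact .inr (h5 ▸ h4)
      · refine .inl ⟨s', ?_, h4⟩
        have : (f s' : ℕ) ≠ f s := fun h6 => h5 (f.injective (Fin.ext h6))
        omega

/-- The loop rule. The body may rely on the cells that the loop does not write. -/
lemma does_loop {ι : Type*} {N : ℕ} (f : ι ≃ Fin N) {y : ℕ} (hN : μ.reg y = N)
    {W : ι → ℕ → ℕ → ℕ → ℕ → ℕ → Prop} (hB : ∀ s b i j k v, W s b i j k v → B b i j k)
    (hbody : ∀ s ν, Frame d B μ ν → ν.reg d = f s → Does (d + 1) (W s) ν (p.run ν).1) :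
    Does d (fun b i j k v => ∃ s, W s b i j k v) μ ((Prog.loop d (.reg y) p).run μ).1 :=
  does_loop_of_prev f hN fun s ν hν => hbody s ν
    (hν.frame fun b i j k v ⟨s', _, h⟩ => hB s' b i j k v h)

lemma does_loop₂ {ι κ : Type*} {N K : ℕ} (f : ι ≃ Fin N) (g : κ ≃ Fin K) {y z : ℕ}
    (hN : μ.reg y = N) (hK : μ.reg z = K) (hz : z < d)
    {W : ι → κ → ℕ → ℕ → ℕ → ℕ → ℕ → Prop} (hB : ∀ s t b i j k v, W s t b i j k v → B b i j k)
    (hbody : ∀ s t ν, Frame d B μ ν → ν.reg d = f s → ν.reg (d + 1) = g t →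
      Does (d + 2) (W s t) ν (p.run ν).1) :
    Does d (fun b i j k v => ∃ s t, W s t b i j k v) μ
      ((Prog.loop d (.reg y) (.loop (d + 1) (.reg z) p)).run μ).1 := by
  refine does_loop f hN (B := B) (W := fun s b i j k v => ∃ t, W s t b i j k v)
    (fun s b i j k v ⟨t, h⟩ => hB s t b i j k v h) fun s ν hν hs => ?_
  refine does_loop g ((hν.reg z hz).trans hK) (B := B) (hB s) fun t ξ hξ ht => ?_
  exact hbody s t ξ (hν.trans (hξ.weaken (Nat.le_succ d) fun _ _ _ _ => id))
    ((hξ.reg d (Nat.lt_succ_self d)).trans hs) ht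

lemma does_loop₃ {ι κ l : Type*} {N K L : ℕ} (f : ι ≃ Fin N) (g : κ ≃ Fin K) (h : l ≃ Fin L)
    {x y z : ℕ} (hN : μ.reg x = N) (hK : μ.reg y = K) (hL : μ.reg z = L) (hy : y < d)
    (hz : z < d) {W : ι → κ → l → ℕ → ℕ → ℕ → ℕ → ℕ → Prop}
    (hB : ∀ s t u b i j k v, W s t u b i j k v → B b i j k)
    (hbody : ∀ s t u ν, Frame d B μ ν → ν.reg d = f s → ν.reg (d + 1) = g t →
      ν.reg (d + 2) = h u → Does (d + 3) (W s t u) ν (p.run ν).1) :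
    Does d (fun b i j k v => ∃ s t u, W s t u b i j k v) μ
      ((Prog.loop d (.reg x) (.loop (d + 1) (.reg y) (.loop (d + 2) (.reg z) p))).run μ).1 := by
  refine does_loop f hN (B := B) (W := fun s b i j k v => ∃ t u, W s t u b i j k v)
    (fun s b i j k v ⟨t, u, h⟩ => hB s t u b i j k v h) fun s ν hν hs => ?_
  refine does_loop₂ g h ((hν.reg y hy).trans hK) ((hν.reg z hz).trans hL) (by omega) (B := B)
    (hB s) fun t u ξ hξ ht hu => ?_
  exact hbody s t u ξ (hν.trans (hξ.weaken (Nat.le_succ d) fun _ _ _ _ => id))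
    ((hξ.reg d (Nat.lt_succ_self d)).trans hs) ht hu

lemma does_loop₄ {ι κ l o : Type*} {N K L O : ℕ} (f : ι ≃ Fin N) (g : κ ≃ Fin K) (h : l ≃ Fin L)
    (f' : o ≃ Fin O) {w x y z : ℕ} (hN : μ.reg w = N) (hK : μ.reg x = K) (hL : μ.reg y = L)
    (hO : μ.reg z = O) (hx : x < d) (hy : y < d) (hz : z < d)
    {W : ι → κ → l → o → ℕ → ℕ → ℕ → ℕ → ℕ → Prop}
    (hB : ∀ s t u r b i j k v, W s t u r b i j k v → B b i j k)
    (hbody : ∀ s t u r ν, Frame d B μ ν → ν.reg d = f s → ν.reg (d + 1) = g t →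
      ν.reg (d + 2) = h u → ν.reg (d + 3) = f' r → Does (d + 4) (W s t u r) ν (p.run ν).1) :
    Does d (fun b i j k v => ∃ s t u r, W s t u r b i j k v) μ
      ((Prog.loop d (.reg w) (.loop (d + 1) (.reg x) (.loop (d + 2) (.reg y)
        (.loop (d + 3) (.reg z) p)))).run μ).1 := by
  refine does_loop f hN (B := B) (W := fun s b i j k v => ∃ t u r, W s t u r b i j k v)
    (fun s b i j k v ⟨t, u, r, h⟩ => hB s t u r b i j k v h) fun s ν hν hs => ?_
  refine does_loop₃ g h f' ((hν.reg x hx).trans hK) ((hν.reg y hy).trans hL)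
    ((hν.reg z hz).trans hO) (by omega) (by omega) (B := B) (hB s) fun t u r ξ hξ ht hu hr => ?_
  exact hbody s t u r ξ (hν.trans (hξ.weaken (Nat.le_succ d) fun _ _ _ _ => id))
    ((hξ.reg d (Nat.lt_succ_self d)).trans hs) ht hu hr

/-! ### Running time -/

/-- The number of rounds of every loop is the value of the register `0` or `1`, and these registers
are never changed. -/
def IsSimple : Prog → Bool
  | .skip => true
  | .set x _ => decide (2 ≤ x)
  | .write _ _ _ _ _ => true
  | .seq p q => p.IsSimple && q.IsSimple
  | .ite _ p q => p.IsSimple && q.IsSimple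
  | .loop x (.reg y) p => decide (2 ≤ x) && decide (y < 2) && p.IsSimple
  | .loop _ _ _ => false

/-- A polynomial bound for the number of steps, in terms of a bound for the registers `0`
and `1`. -/
def timeBound : Prog → Polynomial ℕ
  | .skip => 1
  | .set _ e => Polynomial.C (1 + e.cost)
  | .write _ i j k e => Polynomial.C (1 + i.cost + j.cost + k.cost + e.cost)
  | .seq p q => p.timeBound + q.timeBound
  | .ite e p q => Polynomial.C (1 + e.cost) + p.timeBound + q.timeBound
  | .loop _ e p => Polynomial.C (1 + e.cost) + Polynomial.X * (1 + p.timeBound)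

lemma run_le_timeBound (p : Prog) (hp : p.IsSimple = true) (μ : Memory) (N : ℕ)
    (h0 : μ.reg 0 ≤ N) (h1 : μ.reg 1 ≤ N) :
    (p.run μ).2 ≤ p.timeBound.eval N ∧ (p.run μ).1.reg 0 = μ.reg 0 ∧
      (p.run μ).1.reg 1 = μ.reg 1 := by
  induction p generalizing μ with
  | skip => simp [Prog.run, timeBound]
  | set x e =>
    have hx : 2 ≤ x := of_decide_eq_true hp
    refine ⟨by simp [Prog.run, timeBound], ?_, ?_⟩ <;>
      exact Function.update_of_ne (by omega) _ _
  | write b i j k e => simp [Prog.run, timeBound, Memory.setCell]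
  | seq p q ihp ihq =>
    rw [IsSimple, Bool.and_eq_true] at hp
    obtain ⟨p1, p2, p3⟩ := ihp hp.1 μ h0 h1
    obtain ⟨q1, q2, q3⟩ := ihq hp.2 (p.run μ).1 (p2 ▸ h0) (p3 ▸ h1)
    refine ⟨?_, q2.trans p2, q3.trans p3⟩
    rw [timeBound, Polynomial.eval_add]
    exact add_le_add p1 q1
  | ite e p q ihp ihq =>
    rw [IsSimple, Bool.and_eq_true] at hp
    obtain ⟨p1, p2, p3⟩ := ihp hp.1 μ h0 h1
    obtain ⟨q1, q2, q3⟩ := ihq hp.2 μ h0 h1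
    rw [timeBound, Polynomial.eval_add, Polynomial.eval_add, Polynomial.eval_C, Prog.run]
    split_ifs
    · exact ⟨by simp only; omega, p2, p3⟩
    · exact ⟨by simp only; omega, q2, q3⟩
  | loop x e p ih =>
    cases e with
    | reg y =>
      rw [IsSimple, Bool.and_eq_true, Bool.and_eq_true, decide_eq_true_eq, decide_eq_true_eq] at hp
      obtain ⟨⟨hx, hy⟩, hp⟩ := hp
      have hyN : μ.reg y ≤ N := by
        interval_cases y
        · exact h0
        · exact h1
      rw [timeBound, Polynomial.eval_add, Polynomial.eval_mul, Polynomial.eval_C,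
        Polynomial.eval_X, Polynomial.eval_add, Polynomial.eval_one, Prog.run]
      have key : ∀ k, ((List.range k).foldl
          (fun r i => ((p.run (r.1.setReg x i)).1, r.2 + 1 + (p.run (r.1.setReg x i)).2))
          (μ, 1 + (Expr.reg y).cost)).2 ≤
            1 + (Expr.reg y).cost + k * (1 + p.timeBound.eval N) ∧
          ((List.range k).foldl
          (fun r i => ((p.run (r.1.setReg x i)).1, r.2 + 1 + (p.run (r.1.setReg x i)).2))
          (μ, 1 + (Expr.reg y).cost)).1.reg 0 = μ.reg 0 ∧
          ((List.range k).foldl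
          (fun r i => ((p.run (r.1.setReg x i)).1, r.2 + 1 + (p.run (r.1.setReg x i)).2))
          (μ, 1 + (Expr.reg y).cost)).1.reg 1 = μ.reg 1 := by
        intro k
        induction k with
        | zero => simp
        | succ k ihk =>
          rw [List.range_succ, List.foldl_append]
          generalize (List.range k).foldl _ _ = r at ihk
          obtain ⟨k1, k2, k3⟩ := ihk
          have e0 : (r.1.setReg x k).reg 0 = μ.reg 0 :=
            (Function.update_of_ne (by omega) _ _).trans k2
          have e1 : (r.1.setReg x k).reg 1 = μ.reg 1 :=
            (Function.update_of_ne (by omega) _ _).trans k3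
          obtain ⟨b1, b2, b3⟩ := ih hp (r.1.setReg x k) (e0 ▸ h0) (e1 ▸ h1)
          refine ⟨?_, b2.trans e0, b3.trans e1⟩
          simp only [List.foldl_cons, List.foldl_nil]
          rw [Nat.succ_mul]
          omega
      obtain ⟨k1, k2, k3⟩ := key (μ.reg y)
      exact ⟨k1.trans (add_le_add_right (Nat.mul_le_mul_right _ hyN) _), k2, k3⟩
    | _ => simp [IsSimple] at hp

end Prog

open Classical in
lemma Memory.Does.cell_eq_ite {d : ℕ} {W : ℕ → ℕ → ℕ → ℕ → ℕ → Prop} {μ ν : Memory}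
    (h : Does d W μ ν) {b i j k x : ℕ} {P : Prop} (hW : ∀ v, W b i j k v ↔ P ∧ v = x) :
    ν.cell b i j k = if P then x else μ.cell b i j k := by
  split_ifs with hP
  · exact h.eq_of_unique ((hW x).2 ⟨hP, rfl⟩) fun v hv => ((hW v).1 hv).2
  · exact h.eq_of_not fun v hv => hP ((hW v).1 hv).1

/-! ### A program that computes the core -/

/-- Initialize the array `10` with the available pairs with reward zero. -/
def initProg : Prog :=
  .loop 13 (.reg 0) <| .loop 14 (.reg 1) <|
    .ite (.cell 0 (.reg 13) (.reg 14) (.lit 0))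
      (.ite (.cell 1 (.reg 13) (.reg 14) (.lit 0)) .skip
        (.write 10 (.reg 13) (.reg 14) (.lit 0) (.lit 1)))
      .skip

/-- Initialize the array `11`, whose cell `i j r` tells whether the state `j` is found from the
state `i` in `r` rounds: only the state itself is found in `0` rounds. -/
def clearProg : Prog :=
  .seq
    (.loop 13 (.reg 0) <| .loop 14 (.reg 0) <|
      .write 11 (.reg 13) (.reg 14) (.lit 0) (.eq (.reg 13) (.reg 14)))
    (.loop 13 (.reg 0) <| .loop 14 (.reg 0) <| .loop 15 (.reg 0) <|
      .write 11 (.reg 13) (.reg 14) (.add (.reg 15) (.lit 1)) (.lit 0))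

/-- One round of the search along the pairs in the array `10`. The register `12` contains the
number of the round. -/
def roundProg : Prog :=
  .seq
    (.loop 13 (.reg 0) <| .loop 14 (.reg 0) <|
      .ite (.cell 11 (.reg 13) (.reg 14) (.reg 12))
        (.write 11 (.reg 13) (.reg 14) (.add (.reg 12) (.lit 1)) (.lit 1)) .skip)
    (.loop 13 (.reg 0) <| .loop 14 (.reg 0) <| .loop 15 (.reg 1) <| .loop 16 (.reg 0) <|
      .ite (.cell 11 (.reg 13) (.reg 14) (.reg 12))
        (.ite (.cell 10 (.reg 14) (.reg 15) (.lit 0))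
          (.ite (.cell 2 (.reg 14) (.reg 15) (.reg 16))
            (.write 11 (.reg 13) (.reg 16) (.add (.reg 12) (.lit 1)) (.lit 1)) .skip) .skip) .skip)

/-- Reachability along the pairs in the array `10`; the result is in the cells `i j n` of the
array `11`. -/
def reachProg : Prog := .seq clearProg (.loop 12 (.reg 0) roundProg)

/-- Remove from the array `10` the pairs with a successor that cannot return. -/
def pruneProg : Prog :=
  .loop 13 (.reg 0) <| .loop 14 (.reg 1) <| .loop 15 (.reg 0) <|
    .ite (.cell 0 (.reg 13) (.reg 14) (.lit 0))
      (.ite (.cell 2 (.reg 13) (.reg 14) (.reg 15))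
        (.ite (.cell 11 (.reg 15) (.reg 13) (.reg 0)) .skip
          (.write 10 (.reg 13) (.reg 14) (.lit 0) (.lit 0))) .skip) .skip

/-- Compute the core and reachability along its pairs. -/
def coreProg : Prog :=
  .seq initProg <| .seq (.loop 10 (.reg 0) <| .loop 11 (.reg 1) <| .seq reachProg pruneProg)
    reachProg

namespace RMDP

variable {S A : Type*} [Fintype S]

/-- The memory `μ` contains the input `M`. -/
structure HasInput (M : RMDP S A) {n m : ℕ} (eS : S ≃ Fin n) (eA : A ≃ Fin m)
    (μ : Memory) : Prop where
  states : μ.reg 0 = n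
  actions : μ.reg 1 = m
  avail : ∀ s a, μ.cell 0 (eS s) (eA a) 0 ≠ 0 ↔ a ∈ M.avail s
  reward : ∀ s a, a ∈ M.avail s → μ.cell 1 (eS s) (eA a) 0 = M.reward s a
  supp : ∀ s a, a ∈ M.avail s → ∀ t, μ.cell 2 (eS s) (eA a) (eS t) ≠ 0 ↔ t ∈ M.succ s a

/-- The array `10` contains the set `R` of pairs. -/
def HasPairs {S A : Type*} {n m : ℕ} (eS : S ≃ Fin n) (eA : A ≃ Fin m) (R : Set (S × A))
    (μ : Memory) : Prop :=
  ∀ s a, μ.cell 10 (eS s) (eA a) 0 ≠ 0 ↔ (s, a) ∈ R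

variable {M : RMDP S A} {n m : ℕ} {eS : S ≃ Fin n} {eA : A ≃ Fin m} {μ ν : Memory}
  {R : Set (S × A)}

lemma IsInput.hasInput (h : IsInput μ M eS eA) : M.HasInput eS eA μ := by
  obtain ⟨⟨h0, h1, h2⟩, _⟩ := h
  refine ⟨h0, h1, fun s a => ?_, fun s a ha => ((h2 s a).2 ha).1, fun s a ha t => ?_⟩
  · rw [(h2 s a).1]; simp
  · have := ((h2 s a).2 ha).2 t
    rw [zero_add] at this
    rw [this]; simp

lemma HasInput.of_frame (h : M.HasInput eS eA μ) {d : ℕ} {B : ℕ → ℕ → ℕ → ℕ → Prop}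
    (hF : Memory.Frame d B μ ν) (hd : 2 ≤ d) (hB : ∀ b i j k, B b i j k → 3 ≤ b) :
    M.HasInput eS eA ν := by
  have hc : ∀ b < 3, ∀ i j k, ν.cell b i j k = μ.cell b i j k := fun b hb i j k =>
    hF.cell b i j k fun h' => by have := hB _ _ _ _ h'; omega
  refine ⟨(hF.reg 0 (by omega)).trans h.states, (hF.reg 1 (by omega)).trans h.actions, ?_, ?_, ?_⟩
  · intro s a
    rw [hc 0 (by omega)]; exact h.avail s a
  · intro s a ha
    rw [hc 1 (by omega)]; exact h.reward s a ha
  · intro s a ha t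
    rw [hc 2 (by omega)]; exact h.supp s a ha t

lemma HasPairs.of_frame {S A : Type*} {n m : ℕ} {eS : S ≃ Fin n} {eA : A ≃ Fin m}
    {R : Set (S × A)} (h : HasPairs eS eA R μ) {d : ℕ} {B : ℕ → ℕ → ℕ → ℕ → Prop}
    (hF : Memory.Frame d B μ ν) (hB : ∀ i j k, ¬ B 10 i j k) : HasPairs eS eA R ν := by
  intro s a
  rw [hF.cell _ _ _ _ (hB _ _ _)]
  exact h s a

lemma val_equiv_inj {ι : Type*} {N : ℕ} (e : ι ≃ Fin N) {s t : ι} :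
    (e s : ℕ) = e t ↔ s = t := by
  rw [Fin.val_inj, e.apply_eq_iff_eq]

lemma initProg_spec (h : M.HasInput eS eA μ) (h0 : ∀ s a, μ.cell 10 (eS s) (eA a) 0 = 0) :
    Memory.Frame 10 (fun b _ _ _ => b = 10) μ (initProg.run μ).1 ∧
      HasPairs eS eA M.zeroPairs (initProg.run μ).1 := by
  have key : Memory.Does 13 (fun b i j k v => ∃ s a, a ∈ M.avail s ∧ M.reward s a = 0 ∧
      writeAt 10 (eS s) (eA a) 0 1 b i j k v) μ (initProg.run μ).1 := by
    refine Prog.does_loop₂ eS eA h.states h.actions (by omega) (B := fun b _ _ _ => b = 10)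
      (fun s a b i j k v hW => hW.2.2.1) fun s a ν hν hs ha => ?_
    have hin := h.of_frame hν (by omega) (by omega)
    refine Prog.does_when ?_ fun hav => Prog.does_unless ?_ fun _ => ?_
    · simp only [Expr.eval, hs, ha]; exact hin.avail s a
    · simp only [Expr.eval, hs, ha]; rw [hin.reward s a hav]
    · exact Prog.does_write' hs ha rfl rfl
  refine ⟨(key.weaken (by omega)).frame fun b i j k v ⟨s, a, _, _, hW⟩ => hW.1, fun s a => ?_⟩
  rw [key.cell_eq_ite (P := (s, a) ∈ M.zeroPairs) (x := 1), h0]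
  · simp
  · intro v
    simp only [writeAt, val_equiv_inj, zeroPairs, Set.mem_ofPred_eq]
    grind

lemma clearProg_spec (h : M.HasInput eS eA μ) :
    Memory.Frame 12 (fun b _ _ _ => b = 11) μ (clearProg.run μ).1 ∧
      (∀ s t, (clearProg.run μ).1.cell 11 (eS s) (eS t) 0 ≠ 0 ↔ t = s) ∧
      ∀ s t, ∀ r < n, (clearProg.run μ).1.cell 11 (eS s) (eS t) (r + 1) = 0 := by
  classical
  have key1 : Memory.Does 13 (fun b i j k v => ∃ s t,
      writeAt 11 (eS s) (eS t) 0 (if t = s then 1 else 0) b i j k v) μ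
      ((Prog.loop 13 (.reg 0) <| .loop 14 (.reg 0) <|
        .write 11 (.reg 13) (.reg 14) (.lit 0) (.eq (.reg 13) (.reg 14))).run μ).1 := by
    refine Prog.does_loop₂ eS eS h.states h.states (by omega) (B := fun b _ _ _ => b = 11)
      (fun s t b i j k v hW => hW.1) fun s t ν hν hs ht => ?_
    refine Prog.does_write' hs ht rfl ?_
    simp only [Expr.eval, hs, ht, val_equiv_inj, eq_comm]
  have hF1 := key1.frame (B := fun b _ _ _ => b = 11) fun b i j k v ⟨s, t, hW⟩ => hW.1
  have key2 := h.of_frame hF1 (by omega) (by omega)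
  have key3 := Prog.does_loop₃ eS eS (Equiv.refl (Fin n)) key2.states key2.states key2.states
    (d := 13) (by omega) (by omega) (B := fun b _ _ _ => b = 11)
    (p := .write 11 (.reg 13) (.reg 14) (.add (.reg 15) (.lit 1)) (.lit 0))
    (W := fun s t r => writeAt 11 (eS s) (eS t) (r + 1) 0)
    (fun s t r b i j k v hW => hW.1) fun s t r ν hν hs ht hr =>
      Prog.does_write' hs ht (congrArg (· + 1) hr) rfl
  have key : Memory.Does 13 _ μ (clearProg.run μ).1 := Prog.does_seq key1 key3
  refine ⟨(key.weaken (by omega)).frame ?_, fun s t => ?_, fun s t r hr => ?_⟩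
  · rintro b i j k v (⟨s, t, hW⟩ | ⟨s, t, r, hW⟩) <;> exact hW.1
  · rw [key.cell_eq_ite (P := True) (x := if t = s then 1 else 0)]
    · simp
    · intro v
      simp only [writeAt, val_equiv_inj]
      constructor
      · rintro (⟨s', t', _, rfl, rfl, _, hv⟩ | ⟨s', t', r, _, _, _, hr, _⟩)
        · exact ⟨trivial, hv⟩
        · omega
      · exact fun hv => .inl ⟨s, t, trivial, rfl, rfl, trivial, hv.2⟩
  · rw [key.cell_eq_ite (P := True) (x := 0)]
    · simp
    · intro v
      simp only [writeAt, val_equiv_inj]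
      constructor
      · rintro (⟨s', t', _, rfl, rfl, _, hv⟩ | ⟨s', t', r, _, _, _, hr, hv⟩)
        · omega
        · exact ⟨trivial, hv⟩
      · exact fun hv => .inr ⟨s, t, ⟨r, hr⟩, trivial, rfl, rfl, rfl, hv.2⟩

lemma roundProg_spec (h : M.HasInput eS eA μ) (hR : HasPairs eS eA R μ)
    (hRav : ∀ s a, (s, a) ∈ R → a ∈ M.avail s) {r : ℕ} (hr : μ.reg 12 = r) {F : S → Set S}
    (hF : ∀ s t, μ.cell 11 (eS s) (eS t) r ≠ 0 ↔ t ∈ F s)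
    (h0 : ∀ s t, μ.cell 11 (eS s) (eS t) (r + 1) = 0) :
    Memory.Frame 13 (fun b _ _ k => b = 11 ∧ k = r + 1) μ (roundProg.run μ).1 ∧
      ∀ s t, (roundProg.run μ).1.cell 11 (eS s) (eS t) (r + 1) ≠ 0 ↔
        t ∈ expand (M.edge R) (F s) := by
  classical
  have hcell : ∀ {d ν}, Memory.Frame d (fun b _ _ k => b = 11 ∧ k = r + 1) μ ν → ∀ s t,
      ν.cell 11 (eS s) (eS t) r ≠ 0 ↔ t ∈ F s := by
    intro d ν hν s t
    rw [hν.cell _ _ _ _ (by omega)]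
    exact hF s t
  have key1 : Memory.Does 13 (fun b i j k v => ∃ s t, t ∈ F s ∧
      writeAt 11 (eS s) (eS t) (r + 1) 1 b i j k v) μ
      ((Prog.loop 13 (.reg 0) <| .loop 14 (.reg 0) <|
      .ite (.cell 11 (.reg 13) (.reg 14) (.reg 12))
        (.write 11 (.reg 13) (.reg 14) (.add (.reg 12) (.lit 1)) (.lit 1)) .skip).run μ).1 := by
    refine Prog.does_loop₂ eS eS h.states h.states (by omega)
      (B := fun b _ _ k => b = 11 ∧ k = r + 1)
      (fun s t b i j k v hW => ⟨hW.2.1, hW.2.2.2.2.1⟩) fun s t ν hν hs ht => ?_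
    have h12 : ν.reg 12 = r := (hν.reg 12 (by omega)).trans hr
    refine Prog.does_when ?_ fun _ => Prog.does_write' hs ht (congrArg (· + 1) h12) rfl
    simp only [Expr.eval, hs, ht, h12]
    exact hcell hν s t
  have hF1 := key1.frame (B := fun b _ _ k => b = 11 ∧ k = r + 1)
    fun b i j k v ⟨s, t, _, hW⟩ => ⟨hW.1, hW.2.2.2.1⟩
  have h' := h.of_frame hF1 (by omega) (by omega)
  have key2 := Prog.does_loop₄ eS eS eA eS h'.states h'.states h'.actions h'.states
    (d := 13) (by omega) (by omega) (by omega) (B := fun b _ _ k => b = 11 ∧ k = r + 1)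
    (p := .ite (.cell 11 (.reg 13) (.reg 14) (.reg 12))
        (.ite (.cell 10 (.reg 14) (.reg 15) (.lit 0))
          (.ite (.cell 2 (.reg 14) (.reg 15) (.reg 16))
            (.write 11 (.reg 13) (.reg 16) (.add (.reg 12) (.lit 1)) (.lit 1)) .skip) .skip) .skip)
    (W := fun s u a t b i j k v => u ∈ F s ∧ (u, a) ∈ R ∧ t ∈ M.succ u a ∧
      writeAt 11 (eS s) (eS t) (r + 1) 1 b i j k v)
    (fun s u a t b i j k v hW => ⟨hW.2.2.2.1, hW.2.2.2.2.2.2.1⟩) fun s u a t ν hν hs hu ha ht => by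
      have hν' := (hF1.trans hν)
      have hin := h.of_frame hν' (by omega) (by omega)
      have h12 : ν.reg 12 = r := (hν'.reg 12 (by omega)).trans hr
      refine Prog.does_when ?_ fun _ => Prog.does_when ?_ fun hua => Prog.does_when ?_ fun _ =>
        Prog.does_write' hs ht (congrArg (· + 1) h12) rfl
      · simp only [Expr.eval, hs, hu, h12]
        exact hcell hν' s u
      · simp only [Expr.eval, hu, ha]
        exact hR.of_frame hν' (by omega) u a
      · simp only [Expr.eval, hu, ha, ht]
        exact hin.supp u a (hRav u a hua) t
  have key : Memory.Does 13 _ μ (roundProg.run μ).1 := Prog.does_seq key1 key2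
  refine ⟨key.frame ?_, fun s t => ?_⟩
  · rintro b i j k v (⟨s, t, _, hW⟩ | ⟨s, u, a, t, _, _, _, hW⟩) <;>
      exact ⟨hW.1, hW.2.2.2.1⟩
  · rw [key.cell_eq_ite (P := t ∈ expand (M.edge R) (F s)) (x := 1), h0]
    · simp
    · intro v
      simp only [writeAt, val_equiv_inj]
      constructor
      · rintro (⟨s', t', h1, _, rfl, rfl, _, hv⟩ | ⟨s', u, a, t', h1, h2, h3, _, rfl, rfl, _, hv⟩)
        · exact ⟨.inl h1, hv⟩
        · exact ⟨.inr ⟨u, h1, a, h2, h3⟩, hv⟩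
      · rintro ⟨h1 | ⟨u, h1, a, h2, h3⟩, hv⟩
        · exact .inl ⟨s, t, h1, trivial, rfl, rfl, trivial, hv⟩
        · exact .inr ⟨s, u, a, t, h1, h2, h3, trivial, rfl, rfl, trivial, hv⟩

/-- The array `11` contains reachability along the pairs of `R`. -/
def HasReach (M : RMDP S A) {n : ℕ} (eS : S ≃ Fin n) (R : Set (S × A)) (μ : Memory) : Prop :=
  ∀ s t, μ.cell 11 (eS s) (eS t) n ≠ 0 ↔ Relation.ReflTransGen (M.edge R) s t

lemma reachProg_spec (h : M.HasInput eS eA μ) (hR : HasPairs eS eA R μ)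
    (hRav : ∀ s a, (s, a) ∈ R → a ∈ M.avail s) :
    Memory.Frame 12 (fun b _ _ _ => b = 11) μ (reachProg.run μ).1 ∧
      M.HasReach eS R (reachProg.run μ).1 := by
  obtain ⟨c1, c2, c3⟩ := clearProg_spec h
  have hmain := Prog.run_loop_induction 12 (.reg 0) roundProg (clearProg.run μ).1
    (fun r ν => Memory.Frame 12 (fun b _ _ _ => b = 11) μ ν ∧
      (∀ s t, ν.cell 11 (eS s) (eS t) r ≠ 0 ↔ t ∈ (expand (M.edge R))^[r] {s}) ∧
      ∀ s t, ∀ q < n, r ≤ q → ν.cell 11 (eS s) (eS t) (q + 1) = 0)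
    ⟨c1, c2, fun s t q hq _ => c3 s t q hq⟩ ?_
  · have e : (Expr.reg 0).eval (clearProg.run μ).1 = n :=
      (c1.reg 0 (by omega)).trans h.states
    rw [e] at hmain
    refine ⟨hmain.1, fun s t => (hmain.2.1 s t).trans (mem_iterate_expand_iff _ s t ?_)⟩
    rw [Nat.card_congr eS, Nat.card_fin]
  · rintro r hr ν ⟨h1, h2, h3⟩
    have hr : r < n := by
      have e : (Expr.reg 0).eval (clearProg.run μ).1 = n :=
        (c1.reg 0 (by omega)).trans h.states
      rwa [e] at hr
    have hF : Memory.Frame 12 (fun b _ _ _ => b = 11) μ (ν.setReg 12 r) := h1.setReg le_rfl r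
    have h12 : (ν.setReg 12 r).reg 12 = r := by simp [Memory.setReg]
    obtain ⟨g1, g2⟩ := roundProg_spec (h.of_frame hF (by omega) (by omega))
      (hR.of_frame hF (by omega)) hRav h12 h2 (fun s t => h3 s t r hr le_rfl)
    refine ⟨hF.trans (g1.weaken (by omega) (by omega)), fun s t => ?_, fun s t q hq hrq => ?_⟩
    · rw [Function.iterate_succ_apply']
      exact g2 s t
    · rw [g1.cell _ _ _ _ (by omega)]
      exact h3 s t q hq (by omega)

lemma pruneProg_spec (h : M.HasInput eS eA μ) (hR : HasPairs eS eA R μ)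
    (hRav : ∀ s a, (s, a) ∈ R → a ∈ M.avail s) (hreach : M.HasReach eS R μ) :
    Memory.Frame 12 (fun b _ _ _ => b = 10) μ (pruneProg.run μ).1 ∧
      HasPairs eS eA (M.prune R) (pruneProg.run μ).1 := by
  have key : Memory.Does 13 (fun b i j k v => ∃ s a t, a ∈ M.avail s ∧ t ∈ M.succ s a ∧
      ¬ Relation.ReflTransGen (M.edge R) t s ∧
      writeAt 10 (eS s) (eA a) 0 0 b i j k v) μ (pruneProg.run μ).1 := by
    refine Prog.does_loop₃ eS eA eS h.states h.actions h.states (by omega) (by omega)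
      (B := fun b _ _ _ => b = 10)
      (fun s a t b i j k v hW => hW.2.2.2.1) fun s a t ν hν hs ha ht => ?_
    have hin := h.of_frame hν (by omega) (by omega)
    refine Prog.does_when ?_ fun hav => Prog.does_when ?_ fun _ => Prog.does_unless ?_ fun _ =>
      Prog.does_write' hs ha rfl rfl
    · simp only [Expr.eval, hs, ha]; exact hin.avail s a
    · simp only [Expr.eval, hs, ha, ht]; exact hin.supp s a hav t
    · simp only [Expr.eval, hs, ht, hin.states]
      rw [hν.cell _ _ _ _ (by omega)]
      exact (not_iff_not.2 (hreach t s)).symm.trans not_not |>.symm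
  refine ⟨(key.weaken (by omega)).frame fun b i j k v ⟨s, a, t, _, _, _, hW⟩ => hW.1,
    fun s a => ?_⟩
  classical
  rw [key.cell_eq_ite (P := a ∈ M.avail s ∧ ∃ t ∈ M.succ s a,
    ¬ Relation.ReflTransGen (M.edge R) t s) (x := 0)]
  · have h1 := hR s a
    have h2 := hRav s a
    simp only [prune, Set.mem_ofPred_eq]
    split_ifs with hP
    · obtain ⟨_, t, ht, hn⟩ := hP
      exact iff_of_false (by simp) fun hx => hn (hx.2 t ht)
    · rw [h1]
      refine ⟨fun hx => ⟨hx, fun t ht => ?_⟩, fun hx => hx.1⟩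
      by_contra hn
      exact hP ⟨h2 hx, t, ht, hn⟩
  · intro v
    simp only [writeAt, val_equiv_inj]
    constructor
    · rintro ⟨s', a', t, h1, h2, h3, _, rfl, rfl, _, hv⟩
      exact ⟨⟨h1, t, h2, h3⟩, hv⟩
    · rintro ⟨⟨h1, t, h2, h3⟩, hv⟩
      exact ⟨s, a, t, h1, h2, h3, trivial, rfl, rfl, trivial, hv⟩

lemma coreProg_spec (h : M.HasInput eS eA μ) (h0 : ∀ s a, μ.cell 10 (eS s) (eA a) 0 = 0) :
    Memory.Frame 10 (fun b _ _ _ => b = 10 ∨ b = 11) μ (coreProg.run μ).1 ∧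
      HasPairs eS eA M.core (coreProg.run μ).1 ∧ M.HasReach eS M.core (coreProg.run μ).1 := by
  have hav : ∀ k s a, (s, a) ∈ M.prune^[k] M.zeroPairs → a ∈ M.avail s := fun k s a hk =>
    (iterate_prune_subset k hk).1
  obtain ⟨a1, a2⟩ := initProg_spec h h0
  -- `I k` holds after `k` rounds of pruning; the two nested loops make `n * m` rounds
  let I : ℕ → Memory → Prop := fun k ν => Memory.Frame 10 (fun b _ _ _ => b = 10 ∨ b = 11) μ ν ∧
    HasPairs eS eA (M.prune^[k] M.zeroPairs) ν
  have hstep : ∀ k ν, I k ν → I (k + 1) ((Prog.seq reachProg pruneProg).run ν).1 := by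
    rintro k ν ⟨f, hp⟩
    obtain ⟨r1, r2⟩ := reachProg_spec (h.of_frame f (by omega) (by omega)) hp (hav k)
    have f1 := f.trans (r1.weaken (by omega) (by omega))
    obtain ⟨p1, p2⟩ := pruneProg_spec (h.of_frame f1 (by omega) (by omega))
      (hp.of_frame r1 (by omega)) (hav k) r2
    refine ⟨f1.trans (p1.weaken (by omega) (by omega)), ?_⟩
    rw [Function.iterate_succ_apply']
    exact p2
  have hset : ∀ k ν x v, 10 ≤ x → I k ν → I k (ν.setReg x v) := fun k ν x v hx hI =>
    ⟨hI.1.setReg hx v, hI.2⟩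
  have hinner : ∀ k ν, I k ν →
      I (k + m) ((Prog.loop 11 (.reg 1) (.seq reachProg pruneProg)).run ν).1 := by
    intro k ν hI
    have hm : (Expr.reg 1).eval ν = m := (hI.1.reg 1 (by omega)).trans h.actions
    have := Prog.run_loop_induction 11 (.reg 1) (.seq reachProg pruneProg) ν
      (fun i ν => I (k + i) ν) hI fun i _ ν hν => hstep (k + i) _ (hset _ _ 11 i (by omega) hν)
    rwa [hm] at this
  have houter := Prog.run_loop_induction 10 (.reg 0)
    (.loop 11 (.reg 1) (.seq reachProg pruneProg)) (initProg.run μ).1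
    (fun i ν => I (i * m) ν) (by
      rw [Nat.zero_mul]
      exact ⟨a1.weaken (by omega) (by omega), a2⟩) fun i _ ν hν => by
      rw [Nat.succ_mul]
      exact hinner _ _ (hset _ _ 10 i (by omega) hν)
  have hn : (Expr.reg 0).eval (initProg.run μ).1 = n := (a1.reg 0 (by omega)).trans h.states
  have hcard : M.prune^[n * m] M.zeroPairs = M.core := by
    unfold core
    rw [Nat.card_congr eS, Nat.card_congr eA, Nat.card_fin, Nat.card_fin]
  rw [hn] at houter
  have hrun : (coreProg.run μ).1 = (reachProg.run ((Prog.loop 10 (.reg 0)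
      (.loop 11 (.reg 1) (.seq reachProg pruneProg))).run (initProg.run μ).1).1).1 := by
    rw [coreProg, Prog.run, Prog.run]
  rw [hrun]
  obtain ⟨f, hp⟩ := houter
  generalize ((Prog.loop 10 (.reg 0) (.loop 11 (.reg 1) (.seq reachProg pruneProg))).run
    (initProg.run μ).1).1 = ξ at f hp ⊢
  obtain ⟨r1, r2⟩ := reachProg_spec (h.of_frame f (by omega) (by omega)) hp (hav _)
  rw [hcard] at hp r2
  exact ⟨f.trans (r1.weaken (by omega) (by omega)), hp.of_frame r1 (by omega), r2⟩

end RMDP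

/-! ### Numbering the states and actions of the collapsed RMDP -/

lemma exists_count_eq (p : ℕ → Prop) [DecidablePred p] (k i : ℕ) (hi : i < Nat.count p k) :
    ∃ j < k, p j ∧ Nat.count p j = i := by
  induction k with
  | zero => simp at hi
  | succ k ih =>
    rcases lt_or_ge i (Nat.count p k) with h | h
    · obtain ⟨j, hj, h'⟩ := ih h
      exact ⟨j, by omega, h'⟩
    · rw [Nat.count_succ] at hi
      split_ifs at hi with hp
      · exact ⟨k, by omega, hp, by omega⟩
      · omega

namespace RMDP

variable {S A : Type*} [Fintype S]

/-- The state `s` is the first one among the states with the same representing state. -/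
def IsFirst (M : RMDP S A) {n : ℕ} (eS : S ≃ Fin n) (s : S) : Prop :=
  ∀ t, (eS t : ℕ) < eS s → M.proj s ≠ M.proj t

/-- The number `i` belongs to a first state. -/
def IsFirstNumber (M : RMDP S A) {n : ℕ} (eS : S ≃ Fin n) (i : ℕ) : Prop :=
  ∃ s, (eS s : ℕ) = i ∧ M.IsFirst eS s

open Classical in
/-- The number of first states with a number below `k`. -/
def firstCount (M : RMDP S A) {n : ℕ} (eS : S ≃ Fin n) (k : ℕ) : ℕ :=
  Nat.count (M.IsFirstNumber eS) k

variable {M : RMDP S A} {n m : ℕ} {eS : S ≃ Fin n} {eA : A ≃ Fin m}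

lemma firstCount_zero : M.firstCount eS 0 = 0 := by simp [firstCount]

open Classical in
lemma firstCount_succ (s : S) : M.firstCount eS (eS s + 1) =
    M.firstCount eS (eS s) + if M.IsFirst eS s then 1 else 0 := by
  unfold firstCount
  rw [Nat.count_succ]
  congr 1
  refine if_congr ⟨?_, fun h => ⟨s, rfl, h⟩⟩ rfl rfl
  rintro ⟨t, ht, h⟩
  rw [val_equiv_inj] at ht
  rwa [← ht]

lemma exists_isFirst (eS : S ≃ Fin n) (s : S) : ∃ t, M.IsFirst eS t ∧ M.proj s = M.proj t := by
  obtain ⟨t, ht, hmin⟩ := Set.exists_min_image {t | M.proj s = M.proj t} (fun t => (eS t : ℕ))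
    (Set.toFinite _) ⟨s, rfl⟩
  refine ⟨t, fun u hu h => ?_, ht⟩
  exact absurd (hmin u (ht.trans h)) (not_le.2 hu)

lemma IsFirst.eq {s t : S} (hs : M.IsFirst eS s) (ht : M.IsFirst eS t) (h : M.proj s = M.proj t) :
    s = t := by
  rcases lt_trichotomy (eS s : ℕ) (eS t) with h' | h' | h'
  · exact absurd h.symm (ht s h')
  · exact (val_equiv_inj eS).1 h'
  · exact absurd h (hs t h')

/-- The states of the collapsed RMDP are numbered as follows: the sink has the number `0`, and the
other states follow in the order of the first states that they represent. -/
lemma exists_stateNumbering [Finite A] (hcs : M.ConstantSupport) (eS : S ≃ Fin n) :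
    ∃ e : M.CState ≃ Fin (M.firstCount eS n + 1), (e .sink : ℕ) = 0 ∧
      ∀ s, M.IsFirst eS s → (e (M.proj s) : ℕ) = M.firstCount eS (eS s) + 1 := by
  classical
  choose g hg hgs using fun s => exists_isFirst (M := M) eS s
  have hx : ∀ x : M.CState, x ≠ .sink → ∃ s, M.IsFirst eS s ∧ M.proj s = x := fun x hx => by
    obtain ⟨s, rfl⟩ := proj_surjective_of_ne_sink hcs hx
    exact ⟨g s, hg s, (hgs s).symm⟩
  choose r hr hrx using hx
  have hlt : ∀ s, M.IsFirst eS s → M.firstCount eS (eS s) < M.firstCount eS n := fun s hs =>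
    Nat.count_strict_mono ⟨s, rfl, hs⟩ (eS s).2
  have hinj : ∀ s t, M.IsFirst eS s → M.IsFirst eS t →
      M.firstCount eS (eS s) = M.firstCount eS (eS t) → s = t := fun s t hs ht h =>
    (val_equiv_inj eS).1 (Nat.count_injective ⟨s, rfl, hs⟩ ⟨t, rfl, ht⟩ h)
  let f : M.CState → Fin (M.firstCount eS n + 1) := fun x =>
    if h : x = .sink then 0
    else ⟨M.firstCount eS (eS (r x h)) + 1, Nat.succ_lt_succ (hlt _ (hr x h))⟩
  have hf0 : ((f .sink : Fin _) : ℕ) = 0 := by simp [f]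
  have hf : ∀ s, M.IsFirst eS s → (f (M.proj s) : ℕ) = M.firstCount eS (eS s) + 1 := by
    intro s hs
    have h : M.proj s ≠ .sink := proj_ne_sink s
    have : r _ h = s := (hr _ h).eq hs (hrx _ h)
    simp only [f, dif_neg h, this]
  have hinjf : Function.Injective f := by
    intro x y hxy
    have hxy : (f x : ℕ) = f y := congrArg _ hxy
    by_cases h1 : x = .sink <;> by_cases h2 : y = .sink
    · rw [h1, h2]
    · rw [h1, hf0, ← hrx y h2, hf _ (hr y h2)] at hxy; omega
    · rw [h2, hf0, ← hrx x h1, hf _ (hr x h1)] at hxy; omega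
    · rw [← hrx x h1, ← hrx y h2, hf _ (hr x h1), hf _ (hr y h2), Nat.add_right_cancel_iff] at hxy
      rw [← hrx x h1, ← hrx y h2, hinj _ _ (hr x h1) (hr y h2) hxy]
  have hsurj : Function.Surjective f := by
    intro i
    by_cases hi : (i : ℕ) = 0
    · exact ⟨.sink, Fin.ext (hf0.trans hi.symm)⟩
    · obtain ⟨k, -, ⟨s, rfl, hs⟩, hk⟩ := exists_count_eq (M.IsFirstNumber eS) n (i - 1) (by
        have h1 := i.2
        change _ < M.firstCount eS n
        omega)
      refine ⟨M.proj s, Fin.ext ?_⟩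
      rw [hf s hs]
      change M.firstCount eS (eS s) = i - 1 at hk
      omega
  exact ⟨Equiv.ofBijective f ⟨hinjf, hsurj⟩, hf0, hf⟩

/-- The actions of the collapsed RMDP are numbered as follows: first the staying action, then the
original actions, then the exit actions. -/
lemma exists_actionNumbering {S A : Type*} {n m : ℕ} (eS : S ≃ Fin n) (eA : A ≃ Fin m) :
    ∃ e : CAction S A ≃ Fin (1 + (m + n * m)), (e .stay : ℕ) = 0 ∧
      (∀ a, (e (.orig a) : ℕ) = 1 + eA a) ∧
      ∀ s a, (e (.exit s a) : ℕ) = 1 + (eA a + (m + eS s * m)) := by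
  let e₀ : CAction S A ≃ Fin 1 ⊕ A ⊕ S × A :=
    { toFun := fun α => match α with
        | .orig a => .inr (.inl a)
        | .exit s a => .inr (.inr (s, a))
        | .stay => .inl 0
      invFun := fun y => match y with
        | .inl _ => .stay
        | .inr (.inl a) => .orig a
        | .inr (.inr (s, a)) => .exit s a
      left_inv := by rintro (_ | _ | _) <;> rfl
      right_inv := by
        rintro (i | _ | _)
        · exact congrArg Sum.inl (Subsingleton.elim _ _)
        · rfl
        · rfl }
  let e := e₀.trans <| ((Equiv.refl _).sumCongr <|
    (eA.sumCongr ((eS.prodCongr eA).trans finProdFinEquiv)).trans finSumFinEquiv).trans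
      finSumFinEquiv
  refine ⟨e, by simp [e, e₀], fun a => by simp [e, e₀], fun s a => ?_⟩
  have : (e (.exit s a) : ℕ) = 1 + (m + (eA a + m * eS s)) := by simp [e, e₀]
  rw [this, mul_comm]
  omega

end RMDP

/-! ### A program that numbers the states and actions of the collapsed RMDP -/

/-- Compute the multiples `i * m`, for `i ≤ n`, in the array `13`. -/
def mulProg : Prog :=
  .loop 13 (.reg 0) <|
    .write 13 (.add (.reg 13) (.lit 1)) (.lit 0) (.lit 0)
      (.add (.cell 13 (.reg 13) (.lit 0) (.lit 0)) (.reg 1))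

/-- Mark in the array `15` the states that are not the first ones in their class. -/
def firstProg : Prog :=
  .loop 13 (.reg 0) <| .loop 14 (.reg 0) <|
    .ite (.lt (.reg 14) (.reg 13))
      (.ite (.cell 11 (.reg 13) (.reg 14) (.reg 0))
        (.write 15 (.reg 13) (.lit 0) (.lit 0) (.lit 1)) .skip) .skip

/-- Count the first states in the array `14`. -/
def countProg : Prog :=
  .loop 13 (.reg 0) <|
    .write 14 (.add (.reg 13) (.lit 1)) (.lit 0) (.lit 0)
      (.add (.cell 14 (.reg 13) (.lit 0) (.lit 0))
        (.sub (.lit 1) (.cell 15 (.reg 13) (.lit 0) (.lit 0))))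

/-- Compute in the array `6` the number of the representing state of each state. -/
def projProg : Prog :=
  .loop 13 (.reg 0) <| .loop 14 (.reg 0) <|
    .ite (.cell 11 (.reg 13) (.reg 14) (.reg 0))
      (.ite (.cell 15 (.reg 14) (.lit 0) (.lit 0)) .skip
        (.write 6 (.reg 13) (.lit 0) (.lit 0)
          (.add (.cell 14 (.reg 14) (.lit 0) (.lit 0)) (.lit 1)))) .skip

/-- Compute in the array `16` the number that is to be added to the number of an action, depending
on the state in which it is taken. -/
def offsetProg : Prog :=
  .loop 13 (.reg 0) <| .loop 14 (.reg 1) <|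
    .ite (.cell 10 (.reg 13) (.reg 14) (.lit 0))
      (.write 16 (.reg 13) (.lit 0) (.lit 0)
        (.add (.reg 1) (.cell 13 (.reg 13) (.lit 0) (.lit 0)))) .skip

/-- Number the states and actions of the collapsed RMDP. -/
def numberProg : Prog :=
  .seq mulProg <| .seq firstProg <| .seq countProg <| .seq projProg <| .seq offsetProg <|
    .seq (.set 3 (.add (.cell 14 (.reg 0) (.lit 0) (.lit 0)) (.lit 1)))
      (.set 4 (.add (.lit 1) (.add (.reg 1) (.cell 13 (.reg 0) (.lit 0) (.lit 0)))))

namespace RMDP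

variable {S A : Type*} [Fintype S] {M : RMDP S A} {n m : ℕ} {eS : S ≃ Fin n} {eA : A ≃ Fin m}
  {μ : Memory}

lemma mulProg_spec (h0 : μ.reg 0 = n) (h1 : μ.reg 1 = m) (hz : μ.cell 13 0 0 0 = 0) :
    Memory.Frame 13 (fun b _ _ _ => b = 13) μ (mulProg.run μ).1 ∧
      ∀ r ≤ n, (mulProg.run μ).1.cell 13 r 0 0 = r * m := by
  have h := Prog.run_loop_induction 13 (.reg 0)
    (.write 13 (.add (.reg 13) (.lit 1)) (.lit 0) (.lit 0)
      (.add (.cell 13 (.reg 13) (.lit 0) (.lit 0)) (.reg 1))) μ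
    (fun i ν => Memory.Frame 13 (fun b _ _ _ => b = 13) μ ν ∧
      ∀ r ≤ i, ν.cell 13 r 0 0 = r * m)
    ⟨.refl _ _ _, fun r hr => by rw [Nat.le_zero.1 hr, hz, Nat.zero_mul]⟩ ?_
  · change _ ∧ ∀ r ≤ μ.reg 0, _ at h
    rwa [h0] at h
  · rintro i - ν ⟨f, hν⟩
    have f' := f.setReg le_rfl i
    refine ⟨f'.trans ⟨fun _ _ => rfl, fun b i' j k hb => if_neg fun h => hb h.1⟩, fun r hr => ?_⟩
    have hm : ν.reg 1 = m := (f.reg 1 (by omega)).trans h1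
    rcases Nat.lt_or_ge i r with h | h
    · obtain rfl : r = i + 1 := by omega
      simp [Prog.run, Memory.setCell, Memory.setReg, Expr.eval, hν i le_rfl, hm, Nat.succ_mul]
    · have : r ≠ i + 1 := by omega
      simp [Prog.run, Memory.setCell, Memory.setReg, Expr.eval, hν r h, this]

/-- The array `11` contains the relation of being represented by the same state. -/
def HasClasses (M : RMDP S A) {n : ℕ} (eS : S ≃ Fin n) (μ : Memory) : Prop :=
  ∀ s t, μ.cell 11 (eS s) (eS t) n ≠ 0 ↔ M.proj s = M.proj t

/-- The array `15` marks the states that are not the first ones in their class. -/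
def HasFirst (M : RMDP S A) {n : ℕ} (eS : S ≃ Fin n) (μ : Memory) : Prop :=
  ∀ s, (M.IsFirst eS s → μ.cell 15 (eS s) 0 0 = 0) ∧ (¬ M.IsFirst eS s → μ.cell 15 (eS s) 0 0 = 1)

lemma firstProg_spec (h0 : μ.reg 0 = n) (hc : M.HasClasses eS μ)
    (hz : ∀ i, μ.cell 15 i 0 0 = 0) :
    Memory.Frame 13 (fun b _ _ _ => b = 15) μ (firstProg.run μ).1 ∧
      M.HasFirst eS (firstProg.run μ).1 := by
  have key : Memory.Does 13 (fun b i j k v => ∃ s t, (eS t : ℕ) < eS s ∧ M.proj s = M.proj t ∧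
      writeAt 15 (eS s) 0 0 1 b i j k v) μ (firstProg.run μ).1 := by
    refine Prog.does_loop₂ eS eS h0 h0 (by omega) (B := fun b _ _ _ => b = 15)
      (fun s t b i j k v hW => hW.2.2.1) fun s t ν hν hs ht => ?_
    refine Prog.does_when ?_ fun _ => Prog.does_when ?_ fun _ => Prog.does_write' hs rfl rfl rfl
    · simp [Expr.eval, hs, ht]
    · simp only [Expr.eval, hs, ht, hν.reg 0 (by omega : 0 < 13), h0]
      rw [hν.cell _ _ _ _ (by omega)]
      exact hc s t
  refine ⟨key.frame fun b i j k v ⟨s, t, _, _, hW⟩ => hW.1, fun s => ?_⟩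
  have h := key.cell_eq_ite (b := 15) (i := eS s) (j := 0) (k := 0) (x := 1)
    (P := ¬ M.IsFirst eS s) fun v => by
      simp only [writeAt, val_equiv_inj, IsFirst, not_forall, not_not]
      constructor
      · rintro ⟨s', t, h1, h2, -, rfl, -, -, hv⟩
        exact ⟨⟨t, h1, h2⟩, hv⟩
      · rintro ⟨⟨t, h1, h2⟩, hv⟩
        exact ⟨s, t, h1, h2, trivial, rfl, trivial, trivial, hv⟩
  rw [h, hz]
  exact ⟨fun hs => if_neg (not_not.2 hs), fun hs => if_pos hs⟩

lemma countProg_spec (h0 : μ.reg 0 = n) (hf : M.HasFirst eS μ) (hz : μ.cell 14 0 0 0 = 0) :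
    Memory.Frame 13 (fun b _ _ _ => b = 14) μ (countProg.run μ).1 ∧
      ∀ r ≤ n, (countProg.run μ).1.cell 14 r 0 0 = M.firstCount eS r := by
  have h := Prog.run_loop_induction 13 (.reg 0)
    (.write 14 (.add (.reg 13) (.lit 1)) (.lit 0) (.lit 0)
      (.add (.cell 14 (.reg 13) (.lit 0) (.lit 0))
        (.sub (.lit 1) (.cell 15 (.reg 13) (.lit 0) (.lit 0))))) μ
    (fun i ν => Memory.Frame 13 (fun b _ _ _ => b = 14) μ ν ∧
      ∀ r ≤ i, ν.cell 14 r 0 0 = M.firstCount eS r)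
    ⟨.refl _ _ _, fun r hr => by rw [Nat.le_zero.1 hr, hz, firstCount_zero]⟩ ?_
  · change _ ∧ ∀ r ≤ μ.reg 0, _ at h
    rwa [h0] at h
  · rintro i hi ν ⟨f, hν⟩
    change i < μ.reg 0 at hi
    rw [h0] at hi
    have f' := f.setReg le_rfl i
    refine ⟨f'.trans ⟨fun _ _ => rfl, fun b i' j k hb => if_neg fun h => hb h.1⟩, fun r hr => ?_⟩
    rcases Nat.lt_or_ge i r with h | h
    · obtain rfl : r = i + 1 := by omega
      have hs : (eS (eS.symm ⟨i, hi⟩) : ℕ) = i := by simp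
      generalize eS.symm ⟨i, hi⟩ = s at hs
      have h15 := f.cell 15 i 0 0 (by omega)
      have hfs := hf s
      subst hs
      rw [firstCount_succ, ← hν _ le_rfl]
      by_cases hF : M.IsFirst eS s
      · simp [Prog.run, Memory.setCell, Memory.setReg, Expr.eval, h15, hF, hfs.1 hF]
      · simp [Prog.run, Memory.setCell, Memory.setReg, Expr.eval, h15, hF, hfs.2 hF]
    · have : r ≠ i + 1 := by omega
      simp [Prog.run, Memory.setCell, Memory.setReg, Expr.eval, hν r h, this]

lemma projProg_spec [Finite A] (h0 : μ.reg 0 = n) (hc : M.HasClasses eS μ) (hf : M.HasFirst eS μ)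
    (hk : ∀ r ≤ n, μ.cell 14 r 0 0 = M.firstCount eS r) {n' : ℕ} {eS' : M.CState ≃ Fin n'}
    (he : ∀ s, M.IsFirst eS s → (eS' (M.proj s) : ℕ) = M.firstCount eS (eS s) + 1) :
    Memory.Frame 13 (fun b _ _ _ => b = 6) μ (projProg.run μ).1 ∧
      ∀ s, (projProg.run μ).1.cell 6 (eS s) 0 0 = eS' (M.proj s) := by
  have key : Memory.Does 13 (fun b i j k v => ∃ s t, M.proj s = M.proj t ∧ M.IsFirst eS t ∧
      writeAt 6 (eS s) 0 0 (eS' (M.proj s)) b i j k v) μ (projProg.run μ).1 := by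
    refine Prog.does_loop₂ eS eS h0 h0 (by omega) (B := fun b _ _ _ => b = 6)
      (fun s t b i j k v hW => hW.2.2.1) fun s t ν hν hs ht => ?_
    refine Prog.does_when ?_ fun hst => Prog.does_unless ?_ fun hft =>
      Prog.does_write' hs rfl rfl ?_
    · simp only [Expr.eval, hs, ht, hν.reg 0 (by omega : 0 < 13), h0]
      rw [hν.cell _ _ _ _ (by omega)]
      exact hc s t
    · simp only [Expr.eval, ht]
      rw [hν.cell _ _ _ _ (by omega)]
      refine ⟨fun h => ?_, (hf t).1⟩
      by_contra hn
      rw [(hf t).2 hn] at h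
      exact one_ne_zero h
    · simp only [Expr.eval, ht]
      rw [hν.cell _ _ _ _ (by omega), hk _ (eS t).2.le, hst, he t hft]
  refine ⟨key.frame fun b i j k v ⟨s, t, _, _, hW⟩ => hW.1, fun s => ?_⟩
  obtain ⟨t, ht, hst⟩ := exists_isFirst (M := M) eS s
  refine key.eq_of_unique ⟨s, t, hst, ht, rfl, rfl, rfl, rfl, rfl⟩ ?_
  rintro v ⟨s', t', -, -, -, h, -, -, hv⟩
  rw [val_equiv_inj] at h
  rw [hv, h]

open Classical in
lemma offsetProg_spec {S A : Type*} {n m : ℕ} {eS : S ≃ Fin n} {eA : A ≃ Fin m}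
    (h0 : μ.reg 0 = n) (h1 : μ.reg 1 = m) {R : Set (S × A)}
    (hR : HasPairs eS eA R μ) (hm : ∀ r ≤ n, μ.cell 13 r 0 0 = r * m)
    (hz : ∀ i, μ.cell 16 i 0 0 = 0) :
    Memory.Frame 13 (fun b _ _ _ => b = 16) μ (offsetProg.run μ).1 ∧
      ∀ s, (offsetProg.run μ).1.cell 16 (eS s) 0 0 =
        if ∃ a, (s, a) ∈ R then m + eS s * m else 0 := by
  have key : Memory.Does 13 (fun b i j k v => ∃ s a, (s, a) ∈ R ∧
      writeAt 16 (eS s) 0 0 (m + eS s * m) b i j k v) μ (offsetProg.run μ).1 := by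
    refine Prog.does_loop₂ eS eA h0 h1 (by omega) (B := fun b _ _ _ => b = 16)
      (fun s t b i j k v hW => hW.2.1) fun s a ν hν hs ha => ?_
    refine Prog.does_when ?_ fun _ => Prog.does_write' hs rfl rfl ?_
    · simp only [Expr.eval, hs, ha]
      exact hR.of_frame hν (by omega) s a
    · simp only [Expr.eval, hs, hν.reg 1 (by omega : 1 < 13), h1]
      rw [hν.cell _ _ _ _ (by omega), hm _ (eS s).2.le]
  refine ⟨key.frame fun b i j k v ⟨s, t, _, hW⟩ => hW.1, fun s => ?_⟩
  rw [key.cell_eq_ite (x := m + eS s * m) (P := ∃ a, (s, a) ∈ R), hz]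
  intro v
  constructor
  · rintro ⟨s', a, h, -, hs, -, -, hv⟩
    rw [val_equiv_inj] at hs
    subst hs
    exact ⟨⟨a, h⟩, hv⟩
  · rintro ⟨⟨a, h⟩, hv⟩
    exact ⟨s, a, h, rfl, rfl, rfl, rfl, hv⟩

/-- The memory contains the numbering of the collapsed RMDP: the array `6` contains the numbers of
the representing states, and the number of the copy of `(s, a)` is obtained from the number of `a`
by adding `1` and the entry of `s` in the array `16`. The sink and the staying action have the
number `0`. -/
structure HasNumbering [Finite A] (M : RMDP S A) {n m n' m' : ℕ} (eS : S ≃ Fin n)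
    (eA : A ≃ Fin m) (eS' : M.CState ≃ Fin n') (eA' : CAction S A ≃ Fin m') (μ : Memory) :
    Prop where
  sink : (eS' .sink : ℕ) = 0
  stay : (eA' .stay : ℕ) = 0
  proj : ∀ s, μ.cell 6 (eS s) 0 0 = eS' (M.proj s)
  copy : ∀ x α s a, M.IsCopy x α s a → 1 + eA a + μ.cell 16 (eS s) 0 0 = eA' α

lemma numberProg_spec [Finite A] (hcs : M.ConstantSupport) (h0 : μ.reg 0 = n) (h1 : μ.reg 1 = m)
    (hR : HasPairs eS eA M.core μ) (hc : M.HasReach eS M.core μ)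
    (hz : ∀ b i j k, 12 ≤ b → μ.cell b i j k = 0) :
    Memory.Frame 3 (fun b _ _ _ => b = 6 ∨ 12 ≤ b) μ (numberProg.run μ).1 ∧
      ∃ (n' m' : ℕ) (eS' : M.CState ≃ Fin n') (eA' : CAction S A ≃ Fin m'),
        (numberProg.run μ).1.reg 3 = n' ∧ (numberProg.run μ).1.reg 4 = m' ∧
        M.HasNumbering eS eA eS' eA' (numberProg.run μ).1 := by
  obtain ⟨eS', hs0, hs1⟩ := exists_stateNumbering hcs eS
  obtain ⟨eA', ha0, ha1, ha2⟩ := exists_actionNumbering eS eA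
  have hc : M.HasClasses eS μ := fun s t => (hc s t).trans (proj_eq_iff hcs s t).symm
  obtain ⟨f1, p1⟩ := mulProg_spec h0 h1 (hz _ _ _ _ (by omega))
  have hrun : (numberProg.run μ).1 =
      ((Prog.seq (.set 3 (.add (.cell 14 (.reg 0) (.lit 0) (.lit 0)) (.lit 1)))
        (.set 4 (.add (.lit 1) (.add (.reg 1) (.cell 13 (.reg 0) (.lit 0) (.lit 0)))))).run
      (offsetProg.run (projProg.run (countProg.run (firstProg.run
        (mulProg.run μ).1).1).1).1).1).1 := by
    simp only [numberProg, Prog.run]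
  rw [hrun]
  generalize (mulProg.run μ).1 = μ1 at *
  obtain ⟨f2, p2⟩ := firstProg_spec (M := M) (eS := eS) ((f1.reg 0 (by omega)).trans h0)
    (fun s t => by rw [f1.cell _ _ _ _ (by omega)]; exact hc s t)
    (fun i => by rw [f1.cell _ _ _ _ (by omega)]; exact hz _ _ _ _ (by omega))
  generalize (firstProg.run μ1).1 = μ2 at *
  have f12 := (f1.weaken (B := fun b _ _ _ => b = 6 ∨ 12 ≤ b) (d := 13) le_rfl (by omega)).trans
    (f2.weaken le_rfl (by omega))
  obtain ⟨f3, p3⟩ := countProg_spec (M := M) (eS := eS) ((f12.reg 0 (by omega)).trans h0) p2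
    (by rw [f2.cell _ _ _ _ (by omega), f1.cell _ _ _ _ (by omega)]; exact hz _ _ _ _ (by omega))
  generalize (countProg.run μ2).1 = μ3 at *
  have f13 := f12.trans (f3.weaken le_rfl (by omega))
  obtain ⟨f4, p4⟩ := projProg_spec (M := M) (eS := eS) ((f13.reg 0 (by omega)).trans h0)
    (fun s t => by rw [f13.cell _ _ _ _ (by omega)]; exact hc s t)
    (fun s => by rw [f3.cell _ _ _ _ (by omega)]; exact p2 s) p3 hs1
  generalize (projProg.run μ3).1 = μ4 at *
  have f14 := f13.trans (f4.weaken le_rfl (by omega))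
  have p1' : ∀ r ≤ n, μ4.cell 13 r 0 0 = r * m := fun r hr => by
    rw [f4.cell _ _ _ _ (by omega), f3.cell _ _ _ _ (by omega), f2.cell _ _ _ _ (by omega)]
    exact p1 r hr
  obtain ⟨f5, p5⟩ := offsetProg_spec ((f14.reg 0 (by omega)).trans h0)
    ((f14.reg 1 (by omega)).trans h1) (hR.of_frame f14 (by omega)) p1' fun i => by
      rw [f4.cell _ _ _ _ (by omega), f3.cell _ _ _ _ (by omega), f2.cell _ _ _ _ (by omega),
        f1.cell _ _ _ _ (by omega)]
      exact hz _ _ _ _ (by omega)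
  generalize (offsetProg.run μ4).1 = μ5 at *
  have f15 := f14.trans (f5.weaken le_rfl (by omega))
  have e0 : μ5.reg 0 = n := (f15.reg 0 (by omega)).trans h0
  have e1 : μ5.reg 1 = m := (f15.reg 1 (by omega)).trans h1
  have e14 : μ5.cell 14 n 0 0 = M.firstCount eS n := by
    rw [f5.cell _ _ _ _ (by omega), f4.cell _ _ _ _ (by omega)]
    exact p3 n le_rfl
  have e13 : μ5.cell 13 n 0 0 = n * m := by
    rw [f5.cell _ _ _ _ (by omega)]
    exact p1' n le_rfl
  refine ⟨((f15.weaken (by omega) fun _ _ _ _ => id).setReg le_rfl _).setReg (by omega) _,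
    _, _, eS', eA', ?_, ?_, hs0, ha0, fun s => ?_, fun x α s a h => ?_⟩
  · simp [Prog.run, Memory.setReg, Expr.eval, e0, e14]
  · simp [Prog.run, Memory.setReg, Expr.eval, e0, e1, e13]
  · change μ5.cell _ _ _ _ = _
    rw [f5.cell _ _ _ _ (by omega)]
    exact p4 s
  · change _ + μ5.cell _ _ _ _ = _
    rw [p5 s]
    cases h with
    | keep _ hs =>
      rw [if_neg, ha1, add_zero]
      rw [← exists_mem_states_iff hcs, not_exists]
      exact hs
    | exit E _ _ hs ha =>
      rw [if_pos ((exists_mem_states_iff hcs s).1 ⟨E, hs⟩), ha2, add_assoc]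

end RMDP

/-! ### A program that writes the tables of the collapsed RMDP -/

/-- Write the value of `e` to the array `b`, at all copies of available pairs. -/
def copyProg (b : ℕ) (e : Expr) : Prog :=
  .loop 13 (.reg 0) <| .loop 14 (.reg 1) <|
    .ite (.cell 0 (.reg 13) (.reg 14) (.lit 0))
      (.ite (.cell 10 (.reg 13) (.reg 14) (.lit 0)) .skip
        (.write b (.cell 6 (.reg 13) (.lit 0) (.lit 0))
          (.add (.add (.lit 1) (.reg 14)) (.cell 16 (.reg 13) (.lit 0) (.lit 0)))
          (.lit 0) e)) .skip

/-- Write the supports of the copies of available pairs to the array `5`. -/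
def copySuppProg : Prog :=
  .loop 13 (.reg 0) <| .loop 14 (.reg 1) <| .loop 15 (.reg 0) <|
    .ite (.cell 0 (.reg 13) (.reg 14) (.lit 0))
      (.ite (.cell 10 (.reg 13) (.reg 14) (.lit 0)) .skip
        (.ite (.cell 2 (.reg 13) (.reg 14) (.reg 15))
          (.write 5 (.cell 6 (.reg 13) (.lit 0) (.lit 0))
            (.add (.add (.lit 1) (.reg 14)) (.cell 16 (.reg 13) (.lit 0) (.lit 0)))
            (.cell 6 (.reg 15) (.lit 0) (.lit 0)) (.lit 1)) .skip)) .skip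

/-- Write the flag `1` to the array `b` for the staying actions. The staying action and the
sink, which is its successor, have the number `0`. -/
def stayProg (b : ℕ) : Prog :=
  .seq (.write b (.lit 0) (.lit 0) (.lit 0) (.lit 1))
    (.loop 13 (.reg 0) <| .loop 14 (.reg 1) <|
      .ite (.cell 10 (.reg 13) (.reg 14) (.lit 0))
        (.write b (.cell 6 (.reg 13) (.lit 0) (.lit 0)) (.lit 0) (.lit 0) (.lit 1)) .skip)

/-- Write the tables of the collapsed RMDP. -/
def outputProg : Prog :=
  .seq (stayProg 3) <| .seq (stayProg 5) <| .seq (copyProg 3 (.lit 1)) <|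
    .seq copySuppProg <| .seq (copyProg 4 (.cell 1 (.reg 13) (.reg 14) (.lit 0))) <|
    .seq (copyProg 7 (.lit 1)) <| .seq (copyProg 8 (.reg 13)) (copyProg 9 (.reg 14))

/-- Collapse all zero-reward MECs of an RMDP. The arrays `0`, `1`, `2` contain the input, `3` to `9`
the output, and `10` to `16` intermediate results. -/
def collapseProg : Prog := .seq coreProg (.seq numberProg outputProg)

namespace RMDP

variable {S A : Type*} [Fintype S] {M : RMDP S A}

lemma IsCopy.unique {x : M.CState} {α : CAction S A} {s t : S} {a b : A}
    (h : M.IsCopy x α s a) (h' : M.IsCopy x α t b) : s = t ∧ a = b := by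
  cases h <;> cases h' <;> exact ⟨rfl, rfl⟩

lemma IsCopy.notMem_core [Finite A] (hcs : M.ConstantSupport) {x : M.CState} {α : CAction S A}
    {s : S} {a : A} (h : M.IsCopy x α s a) : (s, a) ∉ M.core := by
  rw [← exists_mem_staying_iff hcs]
  exact fun ⟨E, hE⟩ => h.notMem_staying hcs E hE

lemma IsCopy.ne_stay {x : M.CState} {s : S} {a : A} : ¬ M.IsCopy x .stay s a := by
  intro h
  cases h

lemma exists_rep_iff [Finite A] (hcs : M.ConstantSupport) (s : S) :
    (∃ E, M.proj s = .rep E) ↔ ∃ a, (s, a) ∈ M.core := by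
  rw [← exists_mem_states_iff hcs]
  exact exists_congr fun E => ⟨mem_of_proj_eq_rep, proj_eq_rep hcs⟩

/-- The state `x` of the collapsed RMDP has a staying action. -/
def HasStay (M : RMDP S A) (x : M.CState) : Prop := x = .sink ∨ ∃ E, x = .rep E

variable [Finite A] {n m n' m' : ℕ} {eS : S ≃ Fin n} {eA : A ≃ Fin m} {eS' : M.CState ≃ Fin n'}
  {eA' : CAction S A ≃ Fin m'} {μ ν : Memory}

/-- The information from which the tables of the collapsed RMDP are written. -/
structure HasData (M : RMDP S A) (eS : S ≃ Fin n) (eA : A ≃ Fin m) (eS' : M.CState ≃ Fin n')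
    (eA' : CAction S A ≃ Fin m') (μ : Memory) : Prop where
  input : M.HasInput eS eA μ
  pairs : HasPairs eS eA M.core μ
  numbering : M.HasNumbering eS eA eS' eA' μ

/-- The arrays of the tables of the collapsed RMDP. -/
def IsTable (b : ℕ) : Prop := b = 3 ∨ b = 4 ∨ b = 5 ∨ b = 7 ∨ b = 8 ∨ b = 9

lemma HasData.of_frame (h : M.HasData eS eA eS' eA' μ)
    (hF : Memory.Frame 13 (fun b _ _ _ => IsTable b) μ ν) : M.HasData eS eA eS' eA' ν := by
  unfold IsTable at hF
  refine ⟨h.input.of_frame hF (by omega) (by omega), h.pairs.of_frame hF (by omega),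
    h.numbering.sink, h.numbering.stay, fun s => ?_, fun x α s a hc => ?_⟩
  · rw [hF.cell _ _ _ _ (by omega)]
    exact h.numbering.proj s
  · rw [hF.cell _ _ _ _ (by omega)]
    exact h.numbering.copy x α s a hc

lemma copyProg_spec (hcs : M.ConstantSupport) (h : M.HasData eS eA eS' eA' μ) {b : ℕ}
    (hb : IsTable b) {e : Expr} {f : S → A → ℕ}
    (he : ∀ s a ν, a ∈ M.avail s → M.HasInput eS eA ν → ν.reg 13 = eS s → ν.reg 14 = eA a →
      e.eval ν = f s a) :
    Memory.Does 13 (fun b' i j k v => ∃ x α s a, M.IsCopy x α s a ∧ a ∈ M.avail s ∧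
      writeAt b (eS' x) (eA' α) 0 (f s a) b' i j k v) μ ((copyProg b e).run μ).1 := by
  have key : Memory.Does 13 (fun b' i j k v => ∃ s a, a ∈ M.avail s ∧ (s, a) ∉ M.core ∧
      ∃ α, M.IsCopy (M.proj s) α s a ∧
      writeAt b (eS' (M.proj s)) (eA' α) 0 (f s a) b' i j k v) μ ((copyProg b e).run μ).1 := by
    refine Prog.does_loop₂ eS eA h.input.states h.input.actions (by omega)
      (B := fun b _ _ _ => IsTable b)
      (fun s a b' i j k v ⟨_, _, _, _, hW⟩ => hW.1 ▸ hb) fun s a ν hν hs ha => ?_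
    have hd := h.of_frame hν
    refine Prog.does_when ?_ fun hav => Prog.does_unless ?_ fun hsa => ?_
    · simp only [Expr.eval, hs, ha]; exact hd.input.avail s a
    · simp only [Expr.eval, hs, ha]; exact (not_iff_comm.1 (hd.pairs s a)).symm
    · obtain ⟨α, hα⟩ := exists_isCopy hcs s a
        (not_exists.1 (mt (exists_mem_staying_iff hcs s a).1 hsa))
      refine (Prog.does_write' (j' := eA' α) ?_ ?_ rfl (he s a ν hav hd.input hs ha)).congr
        fun b' i j k v => ⟨fun hW => ⟨α, hα, hW⟩, ?_⟩
      · simp only [Expr.eval, hs]; exact hd.numbering.proj s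
      · simp only [Expr.eval, hs, ha]; exact hd.numbering.copy _ _ _ _ hα
      · rintro ⟨β, hβ, hW⟩
        rwa [hα.action_eq hβ]
  refine key.congr fun b' i j k v => ⟨?_, ?_⟩
  · rintro ⟨s, a, hav, -, α, hα, hW⟩
    exact ⟨_, α, s, a, hα, hav, hW⟩
  · rintro ⟨x, α, s, a, hα, hav, hW⟩
    obtain rfl := hα.proj_eq hcs
    exact ⟨s, a, hav, hα.notMem_core hcs, α, hα, hW⟩

lemma copySuppProg_spec (hcs : M.ConstantSupport) (h : M.HasData eS eA eS' eA' μ) :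
    Memory.Does 13 (fun b' i j k v => ∃ x α s a t, M.IsCopy x α s a ∧ a ∈ M.avail s ∧
      t ∈ M.succ s a ∧ writeAt 5 (eS' x) (eA' α) (eS' (M.proj t)) 1 b' i j k v) μ
      (copySuppProg.run μ).1 := by
  have key : Memory.Does 13 (fun b' i j k v => ∃ s a t, a ∈ M.avail s ∧ (s, a) ∉ M.core ∧
      t ∈ M.succ s a ∧ ∃ α, M.IsCopy (M.proj s) α s a ∧
      writeAt 5 (eS' (M.proj s)) (eA' α) (eS' (M.proj t)) 1 b' i j k v) μ
      (copySuppProg.run μ).1 := by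
    refine Prog.does_loop₃ eS eA eS h.input.states h.input.actions h.input.states (by omega)
      (by omega) (B := fun b _ _ _ => IsTable b)
      (fun s a t b' i j k v ⟨_, _, _, _, _, hW⟩ => hW.1 ▸ .inr (.inr (.inl rfl)))
      fun s a t ν hν hs ha ht => ?_
    have hd := h.of_frame hν
    refine Prog.does_when ?_ fun hav => Prog.does_unless ?_ fun hsa => Prog.does_when ?_ fun _ => ?_
    · simp only [Expr.eval, hs, ha]; exact hd.input.avail s a
    · simp only [Expr.eval, hs, ha]; exact (not_iff_comm.1 (hd.pairs s a)).symm
    · simp only [Expr.eval, hs, ha, ht]; exact hd.input.supp s a hav t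
    · obtain ⟨α, hα⟩ := exists_isCopy hcs s a
        (not_exists.1 (mt (exists_mem_staying_iff hcs s a).1 hsa))
      refine (Prog.does_write' (j' := eA' α) (k' := eS' (M.proj t)) ?_ ?_ ?_ rfl).congr
        fun b' i j k v => ⟨fun hW => ⟨α, hα, hW⟩, ?_⟩
      · simp only [Expr.eval, hs]; exact hd.numbering.proj s
      · simp only [Expr.eval, hs, ha]; exact hd.numbering.copy _ _ _ _ hα
      · simp only [Expr.eval, ht]; exact hd.numbering.proj t
      · rintro ⟨β, hβ, hW⟩
        rwa [hα.action_eq hβ]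
  refine key.congr fun b' i j k v => ⟨?_, ?_⟩
  · rintro ⟨s, a, t, hav, -, ht, α, hα, hW⟩
    exact ⟨_, α, s, a, t, hα, hav, ht, hW⟩
  · rintro ⟨x, α, s, a, t, hα, hav, ht, hW⟩
    obtain rfl := hα.proj_eq hcs
    exact ⟨s, a, t, hav, hα.notMem_core hcs, ht, α, hα, hW⟩

lemma stayProg_spec (hcs : M.ConstantSupport) (h : M.HasData eS eA eS' eA' μ) {b : ℕ}
    (hb : IsTable b) :
    Memory.Does 13 (fun b' i j k v => ∃ x, M.HasStay x ∧
      writeAt b (eS' x) (eA' .stay) (eS' .sink) 1 b' i j k v) μ ((stayProg b).run μ).1 := by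
  have key1 : Memory.Does 13 (writeAt b (eS' .sink) (eA' .stay) (eS' .sink) 1) μ
      ((Prog.write b (.lit 0) (.lit 0) (.lit 0) (.lit 1)).run μ).1 :=
    Prog.does_write' h.numbering.sink.symm h.numbering.stay.symm h.numbering.sink.symm rfl
  have hd1 := h.of_frame (key1.frame fun b' i j k v hW => hW.1 ▸ hb)
  have key2 := Prog.does_loop₂ eS eA (d := 13)
    (p := .ite (.cell 10 (.reg 13) (.reg 14) (.lit 0))
      (.write b (.cell 6 (.reg 13) (.lit 0) (.lit 0)) (.lit 0) (.lit 0) (.lit 1)) .skip)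
    hd1.input.states hd1.input.actions (by omega) (B := fun b _ _ _ => IsTable b)
    (W := fun s a b' i j k v => (s, a) ∈ M.core ∧
      writeAt b (eS' (M.proj s)) (eA' .stay) (eS' .sink) 1 b' i j k v)
    (fun s a b' i j k v hW => hW.2.1 ▸ hb) fun s a ν hν hs ha => by
      have hd := hd1.of_frame hν
      refine Prog.does_when ?_ fun _ =>
        Prog.does_write' ?_ hd.numbering.stay.symm hd.numbering.sink.symm rfl
      · simp only [Expr.eval, hs, ha]; exact hd.pairs s a
      · simp only [Expr.eval, hs]; exact hd.numbering.proj s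
  refine Memory.Does.congr (Prog.does_seq key1 key2) fun b' i j k v => ⟨?_, ?_⟩
  · rintro (hW | ⟨s, a, hsa, hW⟩)
    · exact ⟨_, .inl rfl, hW⟩
    · exact ⟨_, .inr ((exists_rep_iff hcs s).2 ⟨a, hsa⟩), hW⟩
  · rintro ⟨x, rfl | ⟨E, rfl⟩, hW⟩
    · exact .inl hW
    · obtain ⟨s, hs⟩ := proj_surjective_of_ne_sink hcs (x := .rep E) nofun
      obtain ⟨a, ha⟩ := (exists_rep_iff hcs s).1 ⟨E, hs⟩
      exact .inr ⟨s, a, ha, hs ▸ hW⟩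

/-- All writes of the output phase: the tables consist of the staying pairs and the copies. -/
lemma outputProg_spec (hcs : M.ConstantSupport) (h : M.HasData eS eA eS' eA' μ) :
    Memory.Does 13 (fun b i j k v =>
      (∃ x, M.HasStay x ∧ writeAt 3 (eS' x) (eA' .stay) (eS' .sink) 1 b i j k v) ∨
      (∃ x, M.HasStay x ∧ writeAt 5 (eS' x) (eA' .stay) (eS' .sink) 1 b i j k v) ∨
      (∃ x α s a, M.IsCopy x α s a ∧ a ∈ M.avail s ∧
        writeAt 3 (eS' x) (eA' α) 0 1 b i j k v) ∨
      (∃ x α s a t, M.IsCopy x α s a ∧ a ∈ M.avail s ∧ t ∈ M.succ s a ∧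
        writeAt 5 (eS' x) (eA' α) (eS' (M.proj t)) 1 b i j k v) ∨
      (∃ x α s a, M.IsCopy x α s a ∧ a ∈ M.avail s ∧
        writeAt 4 (eS' x) (eA' α) 0 (M.reward s a) b i j k v) ∨
      (∃ x α s a, M.IsCopy x α s a ∧ a ∈ M.avail s ∧
        writeAt 7 (eS' x) (eA' α) 0 1 b i j k v) ∨
      (∃ x α s a, M.IsCopy x α s a ∧ a ∈ M.avail s ∧
        writeAt 8 (eS' x) (eA' α) 0 (eS s) b i j k v) ∨
      (∃ x α s a, M.IsCopy x α s a ∧ a ∈ M.avail s ∧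
        writeAt 9 (eS' x) (eA' α) 0 (eA a) b i j k v)) μ (outputProg.run μ).1 := by
  have hstay : ∀ {μ : Memory}, M.HasData eS eA eS' eA' μ → ∀ b, IsTable b →
      M.HasData eS eA eS' eA' ((stayProg b).run μ).1 := fun h b hb =>
    h.of_frame ((stayProg_spec hcs h hb).frame fun b' i j k v ⟨_, _, hW⟩ => hW.1 ▸ hb)
  have hcopy : ∀ {μ : Memory}, M.HasData eS eA eS' eA' μ → ∀ b, IsTable b → ∀ (e : Expr)
      (f : S → A → ℕ), (∀ s a ν, a ∈ M.avail s → M.HasInput eS eA ν → ν.reg 13 = eS s →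
        ν.reg 14 = eA a → e.eval ν = f s a) →
      M.HasData eS eA eS' eA' ((copyProg b e).run μ).1 := fun h b hb e f he =>
    h.of_frame ((copyProg_spec hcs h hb he).frame
      fun b' i j k v ⟨_, _, _, _, _, _, hW⟩ => hW.1 ▸ hb)
  have t3 : IsTable 3 := by unfold IsTable; omega
  have t4 : IsTable 4 := by unfold IsTable; omega
  have t5 : IsTable 5 := by unfold IsTable; omega
  have t7 : IsTable 7 := by unfold IsTable; omega
  have t8 : IsTable 8 := by unfold IsTable; omega
  have t9 : IsTable 9 := by unfold IsTable; omega
  have e1 : ∀ s a ν, a ∈ M.avail s → M.HasInput eS eA ν → ν.reg 13 = eS s →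
      ν.reg 14 = eA a → (Expr.lit 1).eval ν = 1 := fun _ _ _ _ _ _ _ => rfl
  have er : ∀ s a ν, a ∈ M.avail s → M.HasInput eS eA ν → ν.reg 13 = eS s →
      ν.reg 14 = eA a → (Expr.cell 1 (.reg 13) (.reg 14) (.lit 0)).eval ν = M.reward s a := by
    intro s a ν hav hin hs ha
    simp only [Expr.eval, hs, ha]
    exact hin.reward s a hav
  have es : ∀ s a ν, a ∈ M.avail s → M.HasInput eS eA ν → ν.reg 13 = eS s →
      ν.reg 14 = eA a → (Expr.reg 13).eval ν = eS s := fun _ _ _ _ _ h _ => h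
  have ea : ∀ s a ν, a ∈ M.avail s → M.HasInput eS eA ν → ν.reg 13 = eS s →
      ν.reg 14 = eA a → (Expr.reg 14).eval ν = eA a := fun _ _ _ _ _ _ h => h
  have h1 := hstay h 3 t3
  have h2 := hstay h1 5 t5
  have h3 := hcopy h2 3 t3 _ _ e1
  have h4 := h3.of_frame ((copySuppProg_spec hcs h3).frame
    fun b' i j k v ⟨_, _, _, _, _, _, _, _, hW⟩ => hW.1 ▸ t5)
  have h5 := hcopy h4 4 t4 _ _ er
  have h6 := hcopy h5 7 t7 _ _ e1
  have h7 := hcopy h6 8 t8 _ _ es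
  exact Prog.does_seq (stayProg_spec hcs h t3) <| Prog.does_seq (stayProg_spec hcs h1 t5) <|
    Prog.does_seq (copyProg_spec hcs h2 t3 e1) <| Prog.does_seq (copySuppProg_spec hcs h3) <|
    Prog.does_seq (copyProg_spec hcs h4 t4 er) <| Prog.does_seq (copyProg_spec hcs h5 t7 e1) <|
    Prog.does_seq (copyProg_spec hcs h6 t8 es) (copyProg_spec hcs h7 t9 ea)

/-- The program computes the collapsed RMDP. Every cell of the output is either written with a
single value, or never written and thus still zero. -/
theorem collapseProg_spec (hcs : M.ConstantSupport) (h : IsInput μ M eS eA) :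
    IsCollapseOutput (collapseProg.run μ).1 M eS eA := by
  classical
  have hin := h.hasInput
  obtain ⟨-, -, hz⟩ := h
  obtain ⟨f1, c1, c2⟩ := coreProg_spec hin fun s a => hz _ _ _ _ (by omega)
  have hin1 := hin.of_frame f1 (by omega) (by omega)
  obtain ⟨f2, n', m', eS', eA', r3, r4, hnum⟩ := numberProg_spec hcs hin1.states hin1.actions c1 c2
    fun b i j k hb => by
      rw [f1.cell _ _ _ _ (by omega)]
      exact hz _ _ _ _ (by omega)
  have hd : M.HasData eS eA eS' eA' (numberProg.run (coreProg.run μ).1).1 :=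
    ⟨hin1.of_frame f2 (by omega) (by omega), c1.of_frame f2 (by omega), hnum⟩
  have key := outputProg_spec hcs hd
  have hrun : (collapseProg.run μ).1 =
      (outputProg.run (numberProg.run (coreProg.run μ).1).1).1 := by
    simp only [collapseProg, Prog.run]
  have hz2 : ∀ b i j k, 3 ≤ b → b ≤ 9 → b ≠ 6 →
      (numberProg.run (coreProg.run μ).1).1.cell b i j k = 0 := fun b i j k h3 h9 h6 => by
    rw [f2.cell _ _ _ _ (by omega), f1.cell _ _ _ _ (by omega)]
    exact hz _ _ _ _ h3
  rw [hrun]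
  clear hrun
  generalize (numberProg.run (coreProg.run μ).1).1 = μ2 at *
  generalize (outputProg.run μ2).1 = ν at *
  have hcopy : ∀ x α s a, M.IsCopy x α s a → α ∈ M.collapse.avail x →
      ν.cell 4 (eS' x) (eA' α) 0 = M.reward s a ∧ ν.cell 7 (eS' x) (eA' α) 0 = 1 ∧
      ν.cell 8 (eS' x) (eA' α) 0 = eS s ∧ ν.cell 9 (eS' x) (eA' α) 0 = eA a := by
    intro x α s a hc hav
    rw [hc.mem_avail_iff] at hav
    refine ⟨?_, ?_, ?_, ?_⟩
    · refine key.eq_of_unique (.inr <| .inr <| .inr <| .inr <| .inl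
        ⟨x, α, s, a, hc, hav, rfl, rfl, rfl, rfl, rfl⟩)
        fun v hv => ?_
      simp [writeAt, val_equiv_inj] at hv
      obtain ⟨s', a', hc', -, hv⟩ := hv
      obtain ⟨rfl, rfl⟩ := hc.unique hc'
      exact hv
    · refine key.eq_of_unique (.inr <| .inr <| .inr <| .inr <| .inr <| .inl
        ⟨x, α, s, a, hc, hav, rfl, rfl, rfl, rfl, rfl⟩) fun v hv => ?_
      simp [writeAt, val_equiv_inj] at hv
      obtain ⟨s', a', hc', -, hv⟩ := hv
      exact hv
    · refine key.eq_of_unique (.inr <| .inr <| .inr <| .inr <| .inr <| .inr <| .inl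
        ⟨x, α, s, a, hc, hav, rfl, rfl, rfl, rfl, rfl⟩)
        fun v hv => ?_
      simp [writeAt, val_equiv_inj] at hv
      obtain ⟨s', a', hc', -, hv⟩ := hv
      obtain ⟨rfl, rfl⟩ := hc.unique hc'
      exact hv
    · refine key.eq_of_unique (.inr <| .inr <| .inr <| .inr <| .inr <| .inr <| .inr
        ⟨x, α, s, a, hc, hav, rfl, rfl, rfl, rfl, rfl⟩)
        fun v hv => ?_
      simp [writeAt, val_equiv_inj] at hv
      obtain ⟨s', a', hc', -, hv⟩ := hv
      obtain ⟨rfl, rfl⟩ := hc.unique hc'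
      exact hv
  have hav : ∀ x α, ν.cell 3 (eS' x) (eA' α) 0 = if α ∈ M.collapse.avail x then 1 else 0 := by
    intro x α
    rw [key.cell_eq_ite (P := α ∈ M.collapse.avail x) (x := 1), hz2 _ _ _ _ (by omega) (by omega)
      (by omega)]
    intro v
    simp [writeAt, val_equiv_inj, hnum.sink]
    constructor
    · rintro (⟨hx, rfl, hv⟩ | ⟨s, a, hc, hs, hv⟩)
      · exact ⟨stay_mem_avail hx, hv⟩
      · exact ⟨hc.mem_avail_iff.2 hs, hv⟩
    · rintro ⟨hα, hv⟩
      rcases collapse_avail_cases hα with ⟨s, a, hc⟩ | ⟨hx, rfl⟩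
      · exact .inr ⟨s, a, hc, hc.mem_avail_iff.1 hα, hv⟩
      · exact .inl ⟨hx, rfl, hv⟩
  have hsupp : ∀ x α, α ∈ M.collapse.avail x → ∀ y, ν.cell 5 (eS' x) (eA' α) (eS' y) =
      if y ∈ M.collapse.succ x α then 1 else 0 := by
    intro x α hα y
    rw [key.cell_eq_ite (P := y ∈ M.collapse.succ x α) (x := 1), hz2 _ _ _ _ (by omega) (by omega)
      (by omega)]
    intro v
    simp [writeAt, val_equiv_inj]
    constructor
    · rintro (⟨hx, rfl, rfl, hv⟩ | ⟨s, a, hc, hs, t, ht, rfl, hv⟩)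
      · exact ⟨collapse_succ_stay hx ▸ rfl, hv⟩
      · exact ⟨hc.succ_eq ▸ ⟨t, ht, rfl⟩, hv⟩
    · rintro ⟨hy, hv⟩
      rcases collapse_avail_cases hα with ⟨s, a, hc⟩ | ⟨hx, rfl⟩
      · rw [hc.succ_eq] at hy
        obtain ⟨t, ht, rfl⟩ := hy
        exact .inr ⟨s, a, hc, hc.mem_avail_iff.1 hα, t, ht, rfl, hv⟩
      · rw [collapse_succ_stay hx] at hy
        exact .inl ⟨hx, rfl, hy, hv⟩
  have hrew : ∀ x α, α ∈ M.collapse.avail x →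
      ν.cell 4 (eS' x) (eA' α) 0 = M.collapse.reward x α := by
    intro x α hα
    rcases collapse_avail_cases hα with ⟨s, a, h⟩ | ⟨-, rfl⟩
    · rw [(hcopy _ _ _ _ h hα).1, h.reward_eq]
    · rw [key.eq_of_not, hz2 _ _ _ _ (by omega) (by omega) (by omega), collapse_reward_stay]
      intro v hv
      simp [writeAt, val_equiv_inj] at hv
      obtain ⟨s, a, h, -⟩ := hv
      exact h.ne_stay
  refine ⟨n', m', eS', eA', ⟨(key.reg 3 (by omega)).trans r3, (key.reg 4 (by omega)).trans r4,
    fun x α => ⟨hav x α, fun hα => ⟨hrew x α hα, hsupp x α hα⟩⟩⟩, fun s => ?_,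
    fun s hs a h => (hcopy _ _ _ _ (.keep s hs a) h).2, fun E s a h => ?_, fun x _ => ?_⟩
  · rw [key.eq_of_not]
    · exact hnum.proj s
    · intro v hv
      simp [writeAt] at hv
  · obtain ⟨_, hs, ha, _⟩ := id h
    exact (hcopy _ _ _ _ (.exit E s a hs ha) h).2
  · rw [key.eq_of_not, hz2 _ _ _ _ (by omega) (by omega) (by omega)]
    intro v hv
    simp [writeAt, val_equiv_inj] at hv
    obtain ⟨s, a, h, -⟩ := hv
    exact h.ne_stay

end RMDP

/-! ### The collapsing lemma -/

theorem mainTheorem7 :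
    ∃ (P : Prog) (T : Polynomial ℕ),
      ∀ (S A : Type*) [Fintype S] [Finite A] (M : RMDP S A),
        M.IsClosedRMDP → M.ConstantSupport →
        -- the collapsed RMDP is computed in polynomial time
        (∀ (n m : ℕ) (eS : S ≃ Fin n) (eA : A ≃ Fin m) (μ : Memory),
          RMDP.IsInput μ M eS eA →
          RMDP.IsCollapseOutput (P.run μ).1 M eS eA ∧ (P.run μ).2 ≤ T.eval (n + m)) ∧
        -- it has linear size
        (Nat.card M.CState ≤ Nat.card S + 1 ∧
          M.collapse.pairs.ncard ≤ M.pairs.ncard + 1 ∧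
          M.collapse.size ≤ M.size + 3) ∧
        ∀ opt : Opt,
          -- it has the same values
          ((∀ s hs, M.value opt s = M.collapse.value opt (.keep s hs)) ∧
            (∀ (E : M.ZeroMEC), ∀ s ∈ E.states,
              M.value opt s = M.collapse.value opt (.rep E))) ∧
          -- the Bellman operator has a unique fixpoint, namely the value
          (∃! V : M.CState → EReal,
            M.collapse.IsEstimate opt V ∧ M.collapse.bellman opt V = V) ∧
          M.collapse.bellman opt (fun s => (M.collapse.value opt s : EReal)) =
            (fun s => (M.collapse.value opt s : EReal)) ∧
          -- for maximization it is a contraction in a weighted supremum norm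
          (opt = .max → M.collapse.BellmanContraction opt) := by
  refine ⟨collapseProg, collapseProg.timeBound, fun S A _ _ M hM hcs => ⟨?_, ?_, fun opt => ?_⟩⟩
  · intro n m eS eA μ h
    refine ⟨RMDP.collapseProg_spec hcs h, (Prog.run_le_timeBound _ (by decide) μ (n + m) ?_ ?_).1⟩
    · rw [h.1.1]; omega
    · rw [h.1.2.1]; omega
  · exact ⟨RMDP.card_cState_le hcs, RMDP.ncard_pairs_collapse_le hcs, RMDP.size_collapse_le hcs⟩
  · have hM' := RMDP.collapse_isClosed hM
    have hcs' := RMDP.collapse_constantSupport hcs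
    have hz : ∀ E, M.collapse.IsZeroEC E → .sink ∈ E.1 := fun E hE =>
      RMDP.sink_mem_of_isZeroEC hcs hE
    have hzt : M.collapse.IsTerminal .sink := RMDP.isTerminal_sink
    have hV := RMDP.value_bellman hM' hcs' opt
    refine ⟨⟨fun s hs => ?_, fun E s hs => ?_⟩, ⟨_, ⟨RMDP.value_isEstimate hM' hcs' opt, hV⟩, ?_⟩,
      hV, ?_⟩
    · rw [← RMDP.proj_eq_keep hs, RMDP.value_collapse_proj hM hcs]
    · rw [← RMDP.proj_eq_rep hcs hs, RMDP.value_collapse_proj hM hcs]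
    · rintro V ⟨hest, hfix⟩
      exact RMDP.eq_value_of_fixpoint hM' hcs' hz hzt hest hfix
    · rintro rfl
      exact RMDP.bellmanContraction_max hM' hcs' hz hzt

end
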